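/- **Setting.** Let $\mathcal S,\mathcal A$ be finite, $\mathsf P=(p^a_s)$ a transition kernel, $r,c:\mathcal S\times\mathcal A\to[0,1]$, $\gamma\in[0,1)$, $\delta\in[0,1]$, $\rho$ an initial distribution, $b\in\mathbb R$ and $\sigma<0$. Let $\Theta\subseteq\mathbb R^d$ be nonempty, closed and convex, and let $\pi_\theta$, $\theta\in\Theta$, be policies whose probabilities $\pi_\theta(a|s)$ are given by functions on $\mathbb R^d$ that are twice differentiable at the points of $\Theta$, with $\|\nabla\pi_\theta(a|s)\|\le k$ and $\|\nabla^2\pi_\theta(a|s)\|\le l$ there, $k>0$. Put $\mathrm{LSE}(\sigma,V)=\frac1\sigma\log\sum_s e^{\sigma V(s)}$. For $u\in\{r,c\}$ the smoothed robust value function $V^\pi_{\sigma,u}$ of the $\delta$-contamination model is the fixed point of $$V\mapsto \sum_a\pi(a|s)\Big(u(s,a)+\gamma(1-\delta)\sum_{s'}p^a_{s,s'}V(s')+\gamma\delta\,\mathrm{LSE}(\sigma,V)\Big),$$ and $Q^\pi_{\sigma,u}(s,a)=u(s,a)+\gamma(1-\delta)\sum_{s'}p^a_{s,s'}V^\pi_{\sigma,u}(s')+\gamma\delta\,\mathrm{LSE}(\sigma,V^\pi_{\sigma,u})$.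 Write $V(\rho)=\sum_s\rho(s)V(s)$ and $V^L_\sigma(\theta,\lambda)=V^{\pi_\theta}_{\sigma,r}(\rho)+\lambda(V^{\pi_\theta}_{\sigma,c}(\rho)-b)$. **Step sizes.** Let $\Lambda^*>0$ and $$C_\sigma=\tfrac1{1-\gamma}\Big(1+2\gamma\delta\tfrac{\log|\mathcal S|}{|\sigma|}\Big),\quad C^V_\sigma=\tfrac{|\mathcal A|kC_\sigma}{1-\gamma},\quad k_B=\tfrac{|\mathcal A|C_\sigma l+|\mathcal A|kC_\sigma^V}{1-\gamma+\gamma\delta}+\tfrac{2|\mathcal A|^2\gamma(1-\delta)}{(1-\gamma+\gamma\delta)^2}k^2C_\sigma,$$ $$L_\sigma=k_B+\tfrac{\gamma\delta}{1-\gamma}\Big(\sqrt{|\mathcal S|}\,k_B+\tfrac{2|\sigma||\mathcal S|C_\sigma^V k|\mathcal A|C_\sigma}{1-\gamma+\gamma\delta}\Big).$$ Let $\nu>0$, $\tau>2$, $\xi>\frac{2\nu+(1+\Lambda^*)L_\sigma}{(C_\sigma^V)^2}$ and, for $t\ge1$, $$b_t=\frac{19}{20\xi t^{1/4}},\quad \beta_t=\frac1\xi,\quad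 \mu_t=\xi(C_\sigma^V)^2+\frac{16\tau(C_\sigma^V)^2}{\xi b_{t+1}^2}-2\nu,\quad \alpha_t=\nu+\mu_t .$$ **Algorithm.** Start from any $\lambda_1\in[0,\Lambda^*]$, $\theta_1\in\Theta$. At iteration $t\ge 1$ obtain estimates $\hat Q_{r},\hat Q_{c}$ of $Q^{\pi_{\theta_t}}_{\sigma,r},Q^{\pi_{\theta_t}}_{\sigma,c}$, put $\hat V_u(s)=\sum_a\pi_{\theta_t}(a|s)\hat Q_u(s,a)$ and $$\lambda_{t+1}=\Pi_{[0,\Lambda^*]}\Big(\lambda_t-\tfrac1{\beta_t}(\hat V_c(\rho)-b)-\tfrac{b_t}{\beta_t}\lambda_t\Big),\qquad \theta_{t+1}=\Pi_\Theta\Big(\theta_t+\tfrac1{\alpha_t}\big(\nabla_\theta\hat V_r(\rho)+\lambda_{t+1}\nabla_\theta\hat V_c(\rho)\big)\Big),$$ where $\nabla_\theta\hat V_u(\rho)=\sum_s\rho(s)\Big(B_u(s)+\frac{\gamma\delta\sum_{s'}e^{\sigma\hat V_u(s')}B_u(s')}{(1-\gamma)\sum_{s'}e^{\sigma\hat V_u(s')}}\Big)$,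 $B_u(s)=\frac1{1-\gamma+\gamma\delta}\sum_{s'}d_s(s')\sum_a\hat Q_u(s',a)\nabla\pi_{\theta_t}(a|s')$, and $d_s(s')=(1-\gamma+\gamma\delta)\sum_{n\ge0}(\gamma(1-\delta))^n\,\mathbb P(S_n=s'|S_0=s,\pi_{\theta_t},\mathsf P)$. In the online algorithm $\hat Q_r$ and $\hat Q_c$ are the outputs of two runs of smoothed robust TD of length $T_{\rm inner}(t)$ for $u=r,c$ under $\pi=\pi_{\theta_t}$: from fixed $Q_0,s_0$, for $n=0,1,\dots$ draw $a_n\sim\pi(\cdot|s_n)$, $s_{n+1}\sim p^{a_n}_{s_n}$ (one sample), put $V_n(s)=\sum_a\pi(a|s)Q_n(s,a)$ and add $\eta_n\big(u(s_n,a_n)+\gamma(1-\delta)V_n(s_{n+1})+\gamma\delta\,\mathrm{LSE}(\sigma,V_n)-Q_n(s_n,a_n)\big)$ to $Q_n(s_n,a_n)$. **Gradient mapping.** $$G_t=\Big(\beta_t\big(\lambda_t-\Pi_{[0,\Lambda^*]}(\lambda_t-\tfrac1{\beta_t}\nabla_\lambda V^L_\sigma(\theta_t,\lambda_t))\big),\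 \alpha_t\big(\theta_t-\Pi_\Theta(\theta_t+\tfrac1{\alpha_t}\nabla_\theta V^L_\sigma(\theta_t,\lambda_t))\big)\Big),$$ with the Euclidean norm. **Theorem.** There are constants $C_{\rm est},C_T>0$, independent of $\epsilon$, $t$ and of the starting point $(\lambda_1,\theta_1)$, such that with $\epsilon_{\rm est}(t)=C_{\rm est}\,\epsilon^2/t^{0.75}$ and $T=\lceil C_T\epsilon^{-4}\rceil$ the following hold for all $\epsilon\in(0,1]$. 1. Whenever $\|\hat Q_u-Q_{\sigma,u}^{\pi_{\theta_t}}\|_\infty\le\epsilon_{\rm est}(t)$ for $u=r,c$ and $1\le t<T$, one has $\min_{1\le t\le T}\|G_t\|\le(1+\sqrt2)\epsilon$. 2. Suppose moreover that TD explores: $\inf_{\theta\in\Theta,s,a}\pi_\theta(a|s)>0$, and every state is reachable from every state under $\mathsf P$. Then there are TD step sizes $\eta_n\in(0,1]$ and constants $C_{\rm in},C_N>0$, independent of $\epsilon$, $t$ and $(\lambda_1,\theta_1)$, such that (a) smoothed robust TD has sample complexity $O(e^{-2})$: for all $e>0$, $\theta\in\Theta$, $u\in\{r,c\}$ and $n\ge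 C_{\rm in}e^{-2}$, its output $Q_n$ satisfies $\mathbb E\|Q_n-Q^{\pi_\theta}_{\sigma,u}\|_\infty^2\le e^2$; (b) the online algorithm with $T_{\rm inner}(t)=\lceil C_{\rm in}\,\epsilon_{\rm est}(t)^{-2}\rceil$ satisfies $\mathbb E\big[\min_{1\le t\le T}\|G_t\|\big]\le(1+\sqrt2)\epsilon$; (c) the total number of samples it draws in its $T$ iterations is at most $C_N\,\epsilon^{-14}$. -/

import Mathlib

noncomputable section

namespace RobustRL

/-- Parameter vectors, with the Euclidean norm. -/
abbrev Param (d : ℕ) := EuclideanSpace ℝ (Fin d)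

/-- A finite constrained MDP with one constraint, centroid kernel `P`, and contamination level `δ`. -/
structure CMDP (S A : Type*) where
  P : S → A → PMF S
  r : S → A → ℝ
  c : S → A → ℝ
  γ : ℝ
  δ : ℝ
  ρ : PMF S
  b : ℝ
  r_mem : ∀ s a, r s a ∈ Set.Icc (0 : ℝ) 1
  c_mem : ∀ s a, c s a ∈ Set.Icc (0 : ℝ) 1
  γ_mem : γ ∈ Set.Ico (0 : ℝ) 1
  δ_mem : δ ∈ Set.Icc (0 : ℝ) 1

/-- A `k`-Lipschitz and `l`-smooth class of policies `π_θ(a|s)`, `θ ∈ Θ`. The function `π` is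
defined on the whole parameter space so that it can be differentiated at the boundary points of
`Θ`; it has to be a policy, and to be twice differentiable, only at the points of `Θ`. -/
structure PolicyClass (S A : Type*) [Fintype A] (d : ℕ) where
  Θ : Set (Param d)
  π : Param d → S → A → ℝ
  k : ℝ
  l : ℝ
  nonempty : Θ.Nonempty
  closed : IsClosed Θ
  convex : Convex ℝ Θ
  isPolicy : ∀ θ ∈ Θ, ∀ s, π θ s ∈ stdSimplex ℝ A
  differentiable : ∀ θ ∈ Θ, ∀ s a, DifferentiableAt ℝ (fun x => π x s a) θ
  twice_differentiable : ∀ θ ∈ Θ, ∀ s a,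
    DifferentiableAt ℝ (fun y => gradient (fun x => π x s a) y) θ
  k_pos : 0 < k
  lipschitz : ∀ θ ∈ Θ, ∀ s a, ‖gradient (fun x => π x s a) θ‖ ≤ k
  smooth : ∀ θ ∈ Θ, ∀ s a, ‖fderiv ℝ (fun y => gradient (fun x => π x s a) y) θ‖ ≤ l

section Values

variable {S A : Type*} [Fintype S] [Fintype A]

/-- `LSE(σ, V) = log (∑ₛ exp (σ V(s))) / σ`. -/
def LSE (σ : ℝ) (V : S → ℝ) : ℝ := Real.log (∑ s, Real.exp (σ * V s)) / σ

/-- One-step look-ahead of the state value `V` for the utility `u`. -/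
def lookahead (M : CMDP S A) (σ : ℝ) (u : S → A → ℝ) (V : S → ℝ) (s : S) (a : A) : ℝ :=
  u s a + M.γ * (1 - M.δ) * ∑ s', (M.P s a s').toReal * V s' + M.γ * M.δ * LSE σ V

/-- `∑ₐ pol(a|s) Q(s,a)`. -/
def stateValue (pol : S → A → ℝ) (Q : S → A → ℝ) (s : S) : ℝ := ∑ a, pol s a * Q s a

/-- The smoothed robust Bellman operator. -/
def smoothedBellman (M : CMDP S A) (σ : ℝ) (u pol : S → A → ℝ) (V : S → ℝ) : S → ℝ :=
  stateValue pol (lookahead M σ u V)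

/-- The smoothed robust value function: the fixed point of the smoothed robust Bellman operator.
The operator is a contraction, so that the fixed point is unique, when `pol` is a policy, and still
when `pol` is a signed perturbation of a policy with `γ · ∑ₐ |pol(a|s)| < 1` for all `s`. -/
def smoothedValue (M : CMDP S A) (σ : ℝ) (u pol : S → A → ℝ) : S → ℝ :=
  Classical.epsilon fun V => Function.IsFixedPt (smoothedBellman M σ u pol) V

/-- The smoothed robust action-value function. -/
def smoothedQ (M : CMDP S A) (σ : ℝ) (u pol : S → A → ℝ) : S → A → ℝ :=
  lookahead M σ u (smoothedValue M σ u pol)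

/-- `V(ρ) = ∑ₛ ρ(s) V(s)`. -/
def atInitial (M : CMDP S A) (V : S → ℝ) : ℝ := ∑ s, (M.ρ s).toReal * V s

/-- The smoothed Lagrangian `V_σ^L(θ, lam)`. -/
def lagrangian {d : ℕ} (M : CMDP S A) (PC : PolicyClass S A d) (σ : ℝ) (θ : Param d) (lam : ℝ) :
    ℝ :=
  atInitial M (smoothedValue M σ M.r (PC.π θ))
    + lam * (atInitial M (smoothedValue M σ M.c (PC.π θ)) - M.b)

end Values

section Constants

variable {S A : Type*} [Fintype S] [Fintype A] {d : ℕ}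

/-- `C_σ`, a bound on the smoothed robust value functions. -/
def Csig (M : CMDP S A) (σ : ℝ) : ℝ :=
  1 / (1 - M.γ) * (1 + 2 * M.γ * M.δ * (Real.log (Fintype.card S) / |σ|))

/-- `C_σ^V`, a Lipschitz constant of the smoothed robust value functions in `θ`. -/
def CVsig (M : CMDP S A) (PC : PolicyClass S A d) (σ : ℝ) : ℝ :=
  1 / (1 - M.γ) * Fintype.card A * PC.k * Csig M σ

/-- `k_B`. -/
def kB (M : CMDP S A) (PC : PolicyClass S A d) (σ : ℝ) : ℝ :=
  1 / (1 - M.γ + M.γ * M.δ)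
      * (Fintype.card A * Csig M σ * PC.l + Fintype.card A * PC.k * CVsig M PC σ)
    + 2 * (Fintype.card A : ℝ) ^ 2 * M.γ * (1 - M.δ) / (1 - M.γ + M.γ * M.δ) ^ 2
      * PC.k ^ 2 * Csig M σ

/-- `L_σ`, a Lipschitz constant of the gradients of the smoothed robust value functions. -/
def Lsig (M : CMDP S A) (PC : PolicyClass S A d) (σ : ℝ) : ℝ :=
  kB M PC σ + M.γ * M.δ / (1 - M.γ)
    * (Real.sqrt (Fintype.card S) * kB M PC σ
      + 2 * |σ| * Fintype.card S * CVsig M PC σ * (1 / (1 - M.γ + M.γ * M.δ))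
        * PC.k * Fintype.card A * Csig M σ)

/-- The free parameters of the primal-dual algorithm: the bound `Λ` on the dual variable and the
numbers `ξ`, `ν`, `τ` that determine the step sizes. -/
structure StepParams where
  Λ : ℝ
  ξ : ℝ
  ν : ℝ
  τ : ℝ

/-- The range in which the parameters of the algorithm may be chosen. -/
def StepParams.Admissible (p : StepParams) (M : CMDP S A) (PC : PolicyClass S A d) (σ : ℝ) :
    Prop :=
  0 < p.Λ ∧ 0 < p.ν ∧ 2 < p.τ ∧
    (2 * p.ν + (1 + p.Λ) * Lsig M PC σ) / CVsig M PC σ ^ 2 < p.ξ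

/-- `b_t = 19 / (20 ξ t^{1/4})`, for `t ≥ 1`. -/
def bSeq (p : StepParams) (t : ℕ) : ℝ := 19 / (20 * p.ξ * (t : ℝ) ^ (1 / 4 : ℝ))

def muSeq (M : CMDP S A) (PC : PolicyClass S A d) (σ : ℝ) (p : StepParams) (t : ℕ) : ℝ :=
  p.ξ * CVsig M PC σ ^ 2 + 16 * p.τ * CVsig M PC σ ^ 2 / (p.ξ * bSeq p (t + 1) ^ 2) - 2 * p.ν

def alphaSeq (M : CMDP S A) (PC : PolicyClass S A d) (σ : ℝ) (p : StepParams) (t : ℕ) : ℝ :=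
  p.ν + muSeq M PC σ p t

/-- `β_t = 1 / ξ` for all `t`. -/
def beta (p : StepParams) : ℝ := 1 / p.ξ

end Constants

section Projections

/-- The projection of `x` to the set `K`: a point of `K` nearest to `x` (it exists and is unique
for nonempty closed convex `K`). -/
def metricProj {d : ℕ} (K : Set (Param d)) (x : Param d) : Param d :=
  Classical.epsilon fun y => y ∈ K ∧ ∀ z ∈ K, dist x y ≤ dist x z

/-- The projection of `x` to `[0, Λ]`. -/
def clampTo (Λ x : ℝ) : ℝ := max 0 (min Λ x)

end Projections

section GradientMapping

variable {S A : Type*} [Fintype S] [Fintype A] {d : ℕ}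

/-- The gradient mapping `G_t` of the smoothed Lagrangian at `(lam, θ)`, in `ℝ × ℝᵈ` with the
Euclidean norm. -/
def gradMap (M : CMDP S A) (PC : PolicyClass S A d) (σ : ℝ) (p : StepParams) (t : ℕ)
    (x : ℝ × Param d) : WithLp 2 (ℝ × Param d) :=
  WithLp.toLp 2
    (beta p * (x.1 - clampTo p.Λ
        (x.1 - 1 / beta p * deriv (fun y => lagrangian M PC σ x.2 y) x.1)),
      alphaSeq M PC σ p t • (x.2 - metricProj PC.Θ
        (x.2 + (1 / alphaSeq M PC σ p t) • gradient (fun y => lagrangian M PC σ y x.1) x.2)))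

end GradientMapping

section Estimators

variable {S A : Type*} [Fintype S] [Fintype A] [DecidableEq S] {d : ℕ}

/-- The state transition matrix of the centroid kernel under `pol`. -/
def transition (M : CMDP S A) (pol : S → A → ℝ) : Matrix S S ℝ :=
  Matrix.of fun s s' => ∑ a, pol s a * (M.P s a s').toReal

/-- The visitation distribution of `pol` under the centroid kernel started at `s`, with the
effective discount factor `γ (1 - δ)`. -/
def visitation (M : CMDP S A) (pol : S → A → ℝ) (s s' : S) : ℝ :=
  (1 - M.γ + M.γ * M.δ) * ∑' n : ℕ, (M.γ * (1 - M.δ)) ^ n * (transition M pol ^ n) s s'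

/-- `B(s, θ)` with the action-value table `Q`. -/
def gradB (M : CMDP S A) (PC : PolicyClass S A d) (θ : Param d) (Q : S → A → ℝ) (s : S) :
    Param d :=
  (1 / (1 - M.γ + M.γ * M.δ)) • ∑ s', visitation M (PC.π θ) s s' •
    ∑ a, Q s' a • gradient (fun x => PC.π x s' a) θ

/-- The estimate of `∇_θ V_σ(ρ)`: the formula for the gradient of the smoothed robust value
function, evaluated with the table `Q` in place of the smoothed robust action-value function. -/
def gradEstimate (M : CMDP S A) (PC : PolicyClass S A d) (σ : ℝ) (θ : Param d) (Q : S → A → ℝ) :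
    Param d :=
  ∑ s, (M.ρ s).toReal • (gradB M PC θ Q s
    + (M.γ * M.δ
        / ((1 - M.γ) * ∑ s', Real.exp (σ * stateValue (PC.π θ) Q s'))) •
      ∑ s', Real.exp (σ * stateValue (PC.π θ) Q s') • gradB M PC θ Q s')

/-- One iteration of the primal-dual algorithm at time `t` from `x = (lam_t, θ_t)`, with the
action-value estimates `Qr` and `Qc` for the reward and the utility. -/
def rpdStep (M : CMDP S A) (PC : PolicyClass S A d) (σ : ℝ) (p : StepParams) (t : ℕ)
    (x : ℝ × Param d) (Qr Qc : S → A → ℝ) : ℝ × Param d :=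
  let lam' := clampTo p.Λ
    (x.1 - 1 / beta p * (atInitial M (stateValue (PC.π x.2) Qc) - M.b)
      - bSeq p t / beta p * x.1)
  (lam', metricProj PC.Θ (x.2 + (1 / alphaSeq M PC σ p t) •
    (gradEstimate M PC σ x.2 Qr + lam' • gradEstimate M PC σ x.2 Qc)))

end Estimators

section Sampling

variable {S A : Type*} [Fintype S] [Fintype A] [DecidableEq S] [DecidableEq A] {d : ℕ}

/-- The law with the weights `q`. (The second case is never met: the algorithm samples actions only
from policies.) -/
def simplexPMF [Nonempty A] (q : A → ℝ) : PMF A :=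
  open Classical in
  if h : q ∈ stdSimplex ℝ A then
    PMF.ofFintype (fun a => ENNReal.ofReal (q a)) (by
      rw [← ENNReal.ofReal_sum_of_nonneg (fun a _ => h.1 a), h.2, ENNReal.ofReal_one])
  else PMF.uniformOfFintype A

/-- The expectation of `f` under a discrete law. (All laws below have finite support.) -/
def expect {α : Type*} (μ : PMF α) (f : α → ℝ) : ℝ := ∑' x, (μ x).toReal * f x

/-- The update of the table `Q` in smoothed robust TD after the transition `s, a, s'`. -/
def tdUpdate (M : CMDP S A) (σ : ℝ) (u pol : S → A → ℝ) (η : ℝ) (Q : S → A → ℝ)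
    (s : S) (a : A) (s' : S) : S → A → ℝ :=
  Function.update Q s (Function.update (Q s) a
    (Q s a + η * (u s a + M.γ * (1 - M.δ) * stateValue pol Q s'
      + M.γ * M.δ * LSE σ (stateValue pol Q) - Q s a)))

/-- Smoothed robust TD with step sizes `η`, started at the table `Q₀` and the state `s₀`: the joint
law of the table and the state after `n` iterations. Each iteration draws one transition from the
centroid kernel. -/
def tdLaw [Nonempty A] (M : CMDP S A) (σ : ℝ) (u pol : S → A → ℝ) (η : ℕ → ℝ)
    (Q₀ : S → A → ℝ) (s₀ : S) : ℕ → PMF ((S → A → ℝ) × S)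
  | 0 => PMF.pure (Q₀, s₀)
  | n + 1 => (tdLaw M σ u pol η Q₀ s₀ n).bind fun z =>
      (simplexPMF (pol z.2)).bind fun a =>
        (M.P z.2 a).bind fun s' =>
          PMF.pure (tdUpdate M σ u pol (η n) z.1 z.2 a s', s')

/-- The law of the output of smoothed robust TD after `n` iterations. -/
def tdOutput [Nonempty A] (M : CMDP S A) (σ : ℝ) (u pol : S → A → ℝ) (η : ℕ → ℝ)
    (Q₀ : S → A → ℝ) (s₀ : S) (n : ℕ) : PMF (S → A → ℝ) :=
  (tdLaw M σ u pol η Q₀ s₀ n).map Prod.fst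

/-- The online robust primal-dual algorithm: the joint law of the iterates
`(lam_t, θ_t)`, `1 ≤ t ≤ n + 1`, after the iterations `1, …, n`, started at `(lam_1, θ_1) = x₁`.
Iteration `t` runs smoothed robust TD with `Tin t` samples for the reward and for the utility. The
entries of the history outside `1 ≤ t ≤ n + 1` have no meaning. -/
def rpdLaw [Nonempty A] (M : CMDP S A) (PC : PolicyClass S A d) (σ : ℝ) (p : StepParams)
    (η : ℕ → ℝ) (Q₀ : S → A → ℝ) (s₀ : S) (Tin : ℕ → ℕ) (x₁ : ℝ × Param d) :
    ℕ → PMF (ℕ → ℝ × Param d)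
  | 0 => PMF.pure fun _ => x₁
  | n + 1 => (rpdLaw M PC σ p η Q₀ s₀ Tin x₁ n).bind fun h =>
      (tdOutput M σ M.r (PC.π (h (n + 1)).2) η Q₀ s₀ (Tin (n + 1))).bind fun Qr =>
        (tdOutput M σ M.c (PC.π (h (n + 1)).2) η Q₀ s₀ (Tin (n + 1))).bind fun Qc =>
          PMF.pure (Function.update h (n + 2)
            (rpdStep M PC σ p (n + 1) (h (n + 1)) Qr Qc))

/-- The number of transitions drawn by the iterations `1, …, T`. -/
def totalSamples (Tin : ℕ → ℕ) (T : ℕ) : ℕ := ∑ t ∈ Finset.Icc 1 T, (Tin t + Tin t)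

/-- Exploration: the policies of the class take every action with a probability bounded away from
zero, and every state can be reached from every state under the centroid kernel. -/
def Exploring (M : CMDP S A) (PC : PolicyClass S A d) : Prop :=
  (∃ q : ℝ, 0 < q ∧ ∀ θ ∈ PC.Θ, ∀ s a, q ≤ PC.π θ s a) ∧
    ∀ s s', Relation.ReflTransGen (fun x y => ∃ a, M.P x a y ≠ 0) s s'

end Sampling

/-- The accuracy `ε_est = C ε² / t^{3/4}` of the estimates at iteration `t`. -/
def estAccuracy (C ε : ℝ) (t : ℕ) : ℝ := C * ε ^ 2 / (t : ℝ) ^ (3 / 4 : ℝ)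

/-- The number `⌈C / ε⁴⌉` of iterations. -/
def numIter (C ε : ℝ) : ℕ := ⌈C / ε ^ 4⌉₊

/-- The number `⌈C / ε_est²⌉` of samples of a TD run with target accuracy `ε_est`. -/
def numInner (C εest : ℝ) : ℕ := ⌈C / εest ^ 2⌉₊

end RobustRL

end

noncomputable section

set_option linter.unusedSectionVars false

namespace RobustRL

/-! ### Weighted averages over finite types. -/

section Averages

variable {ι : Type*} [Fintype ι]

/-! The proof is a Lyapunov argument for the primal-dual iteration, combined with a second Lyapunov
argument for TD.

Smoothness of the values. The smoothed Bellman operator is a sup-norm contraction that depends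
smoothly on the policy table, so the implicit function theorem differentiates its fixed point
(`differentiableAt_smoothedValue`). The derivative solves a linear `γ`-contractive equation
(`valueGrad_eq`). The closed formula evaluated by the algorithm solves the same equation, so the two
agree (`valueGrad_eq_gradAt`). Perturbing the equation shows that the gradient is Lipschitz on `Θ`,
hence a quadratic Taylor bound (`exists_taylor_atInitial`); perturbing the formula bounds the effect
of an inexact table (`exists_gradEstimate_error`).

The outer iteration. At time `t` the dual variable approximately minimizes `r + v lam + b_t lam² /
2` over `[0, Λ]`, where `r`, `v` are the current reward value and constraint slack. Strong convexity
gives a unique best response `lamStar`, Lipschitz in `v` with constant `1 / b_t`, and one dual step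
contracts towards it by `1 - 19/20 τ_t` with `τ_t = t^{-1/4}`. By an envelope argument a primal step
increases the regularized minimum `regMin` (`regMin_ascent`). The potential `pot` is `-regMin` plus
`τ_t / ξ` times the squared distance from `lam` to `lamStar`. The primal step size is `1 / α_t` with
`α_t` of order `τ_t^{-2}`: large enough to absorb the motion of the best response caused by the
primal step, and small enough that the decrease still controls `τ_t²` times the squared gradient
mapping. So `pot_step` and `exists_pot_decrease` give a decrease by `κ ‖G_t‖² / √t`, up to squared
estimation errors and a drift of order `1 / t`.

Summation runs over the second half of the horizon `T`. There the weights `1 / √t` add up to order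
`√T`, the errors `1 / t` to a constant, and the potential is bounded; so some `‖G_t‖²` is of order
`1 / √T`, and `T` of order `ε^{-4}` suffices. Expectations of the same recursion give the online
statement (`expect_pot_add_sum_le`, `expect_iInf_gradMap_le`).

TD. The updates are asynchronous and Markovian, and the mean update contracts only in the sup norm.
A high even power sum of the error replaces the sup norm by a smooth function, with a power large
enough that the cross terms fit into the drift (`contraction_drift_le`). Since only the visited
entry moves, the power of state `s` carries a weight `1 + c η h(s, x)`, where `h` behaves like an
expected hitting time of `s` from the current state `x` (`exists_hitting_function`): waiting lowers
the weight, and a visit pays for raising it again. The expected weighted power then obeys a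
recursion of rate `n^{-(k+1)}` for the power `2k + 2`, which yields a mean square error of order `1
/ n` (`exists_td_rate`). Summing `t^{3/2} / ε⁴` up to `T` gives the `ε^{-14}` samples
(`totalSamples_le`). -/

theorem sum_toReal_pmf (μ : PMF ι) : ∑ i, (μ i).toReal = 1 := by
  have h : ∑ i, μ i = 1 := by rw [← μ.tsum_coe, tsum_fintype]
  rw [← ENNReal.toReal_sum fun i _ => μ.apply_ne_top i, h, ENNReal.toReal_one]

theorem abs_sum_mul_le {w x : ι → ℝ} {W B : ℝ} (hw : ∑ i, |w i| ≤ W) (hB : 0 ≤ B)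
    (hx : ∀ i, |x i| ≤ B) : |∑ i, w i * x i| ≤ W * B := by
  calc |∑ i, w i * x i| ≤ ∑ i, |w i| * B := by
        refine (Finset.abs_sum_le_sum_abs _ _).trans (Finset.sum_le_sum fun i _ => ?_)
        rw [abs_mul]
        exact mul_le_mul_of_nonneg_left (hx i) (abs_nonneg _)
    _ = (∑ i, |w i|) * B := by rw [Finset.sum_mul]
    _ ≤ W * B := mul_le_mul_of_nonneg_right hw hB

theorem norm_sum_smul_le {E : Type*} [SeminormedAddCommGroup E] [NormedSpace ℝ E] {w : ι → ℝ}
    {x : ι → E} {W B : ℝ} (hw : ∑ i, |w i| ≤ W) (hB : 0 ≤ B)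
    (hx : ∀ i, ‖x i‖ ≤ B) : ‖∑ i, w i • x i‖ ≤ W * B := by
  calc ‖∑ i, w i • x i‖ ≤ ∑ i, |w i| * B := by
        refine (norm_sum_le _ _).trans (Finset.sum_le_sum fun i _ => ?_)
        rw [norm_smul, Real.norm_eq_abs]
        exact mul_le_mul_of_nonneg_left (hx i) (abs_nonneg _)
    _ = (∑ i, |w i|) * B := by rw [Finset.sum_mul]
    _ ≤ W * B := mul_le_mul_of_nonneg_right hw hB

theorem sum_abs_toReal_pmf (μ : PMF ι) : ∑ i, |(μ i).toReal| = 1 := by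
  rw [← sum_toReal_pmf μ]
  exact Finset.sum_congr rfl fun i _ => abs_of_nonneg ENNReal.toReal_nonneg

theorem sum_abs_of_mem_stdSimplex {w : ι → ℝ} (hw : w ∈ stdSimplex ℝ ι) : ∑ i, |w i| = 1 := by
  rw [← hw.2]
  exact Finset.sum_congr rfl fun i _ => abs_of_nonneg (hw.1 i)

theorem abs_apply_sub_le_norm {ι : Type*} [Fintype ι] (V V' : ι → ℝ) (i : ι) :
    |V i - V' i| ≤ ‖V - V'‖ := by
  simpa [Real.norm_eq_abs] using norm_le_pi_norm (V - V') i

theorem abs_apply_apply_le_norm {S A : Type*} [Fintype S] [Fintype A] (Q : S → A → ℝ) (s : S)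
    (a : A) : |Q s a| ≤ ‖Q‖ :=
  (norm_le_pi_norm (Q s) a).trans (norm_le_pi_norm Q s)

end Averages

/-! ### Log-sum-exp as a nonexpansive aggregation. -/

section LogSumExp

variable {S : Type*} [Fintype S]

theorem sum_exp_pos [Nonempty S] (σ : ℝ) (V : S → ℝ) : 0 < ∑ s, Real.exp (σ * V s) :=
  Finset.sum_pos (fun _ _ => Real.exp_pos _) Finset.univ_nonempty

theorem LSE_add_const [Nonempty S] {σ : ℝ} (hσ : σ ≠ 0) (V : S → ℝ) (c : ℝ) :
    LSE σ (fun s => V s + c) = LSE σ V + c := by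
  unfold LSE
  have h : ∑ s, Real.exp (σ * (V s + c)) = (∑ s, Real.exp (σ * V s)) * Real.exp (σ * c) := by
    rw [Finset.sum_mul]
    exact Finset.sum_congr rfl fun s _ => by rw [← Real.exp_add, mul_add]
  rw [h, Real.log_mul (sum_exp_pos σ V).ne' (Real.exp_pos _).ne', Real.log_exp]
  field_simp

theorem LSE_mono [Nonempty S] {σ : ℝ} (hσ : σ < 0) {V V' : S → ℝ} (h : ∀ s, V s ≤ V' s) :
    LSE σ V ≤ LSE σ V' := by
  unfold LSE
  refine div_le_div_of_nonpos_of_le hσ.le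
    (Real.log_le_log (sum_exp_pos σ V') (Finset.sum_le_sum fun s _ => Real.exp_le_exp.2 ?_))
  exact mul_le_mul_of_nonpos_left (h s) hσ.le

/-- A monotone functional that commutes with adding constants is nonexpansive: apply it to `V ≤ V' +
‖V - V'‖`. -/
theorem abs_LSE_sub_le [Nonempty S] {σ : ℝ} (hσ : σ < 0) (V V' : S → ℝ) :
    |LSE σ V - LSE σ V'| ≤ ‖V - V'‖ := by
  have key : ∀ V V' : S → ℝ, LSE σ V ≤ LSE σ V' + ‖V - V'‖ := fun V V' => by
    rw [← LSE_add_const hσ.ne V']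
    refine LSE_mono hσ fun s => ?_
    linarith [le_abs_self (V s - V' s), abs_apply_sub_le_norm V V' s]
  rw [abs_le]
  have h := key V' V
  rw [norm_sub_rev] at h
  constructor <;> linarith [key V V']

theorem abs_LSE_le [Nonempty S] {σ : ℝ} (hσ : σ < 0) (V : S → ℝ) :
    |LSE σ V| ≤ ‖V‖ + Real.log (Fintype.card S) / |σ| := by
  have h := abs_LSE_sub_le hσ V 0
  have h0 : |LSE σ (0 : S → ℝ)| = Real.log (Fintype.card S) / |σ| := by
    have hc : (0 : ℝ) ≤ Real.log (Fintype.card S) := Real.log_natCast_nonneg _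
    simp [LSE, abs_div, abs_of_nonneg hc]
  rw [sub_zero] at h
  rw [← h0]
  linarith [abs_sub_abs_le_abs_sub (LSE σ V) (LSE σ (0 : S → ℝ))]

end LogSumExp

/-! ### The smoothed Bellman operator: contraction, fixed point, bounds. -/

section Bellman

variable {S A : Type*} [Fintype S] [Fintype A]

theorem CMDP.one_sub_γ_pos (M : CMDP S A) : 0 < 1 - M.γ := sub_pos.2 M.γ_mem.2

theorem CMDP.discount_nonneg (M : CMDP S A) : 0 ≤ M.γ * (1 - M.δ) :=
  mul_nonneg M.γ_mem.1 (sub_nonneg.2 M.δ_mem.2)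

theorem CMDP.γδ_nonneg (M : CMDP S A) : 0 ≤ M.γ * M.δ := mul_nonneg M.γ_mem.1 M.δ_mem.1

/-- The centroid average and the log-sum-exp are both nonexpansive, and their coefficients `γ (1 -
δ)` and `γ δ` add up to `γ`. -/
theorem abs_lookahead_sub_le [Nonempty S] (M : CMDP S A) {σ : ℝ} (hσ : σ < 0) (u : S → A → ℝ)
    (V V' : S → ℝ) (s : S) (a : A) :
    |lookahead M σ u V s a - lookahead M σ u V' s a| ≤ M.γ * ‖V - V'‖ := by
  have h1 : |∑ s', (M.P s a s').toReal * (V s' - V' s')| ≤ 1 * ‖V - V'‖ :=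
    abs_sum_mul_le (sum_abs_toReal_pmf _).le (norm_nonneg _) (abs_apply_sub_le_norm V V')
  have h2 := abs_LSE_sub_le hσ V V'
  have e : lookahead M σ u V s a - lookahead M σ u V' s a
      = M.γ * (1 - M.δ) * (∑ s', (M.P s a s').toReal * (V s' - V' s'))
        + M.γ * M.δ * (LSE σ V - LSE σ V') := by
    simp only [lookahead, mul_sub, Finset.sum_sub_distrib]; ring
  rw [e]
  refine (abs_add_le _ _).trans ?_
  rw [abs_mul (M.γ * (1 - M.δ)), abs_mul (M.γ * M.δ), abs_of_nonneg M.discount_nonneg,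
    abs_of_nonneg M.γδ_nonneg]
  have := mul_le_mul_of_nonneg_left h1 M.discount_nonneg
  have := mul_le_mul_of_nonneg_left h2 M.γδ_nonneg
  linarith

theorem abs_lookahead_le [Nonempty S] (M : CMDP S A) {σ : ℝ} (hσ : σ < 0) {u : S → A → ℝ}
    (hu : ∀ s a, u s a ∈ Set.Icc (0 : ℝ) 1) (V : S → ℝ) (s : S) (a : A) :
    |lookahead M σ u V s a| ≤
      1 + M.γ * M.δ * (Real.log (Fintype.card S) / |σ|) + M.γ * ‖V‖ := by
  have h1 : |∑ s', (M.P s a s').toReal * V s'| ≤ 1 * ‖V‖ :=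
    abs_sum_mul_le (sum_abs_toReal_pmf _).le (norm_nonneg _) (norm_le_pi_norm V)
  have h2 := abs_LSE_le hσ V
  have h3 : |u s a| ≤ 1 := abs_le.2 ⟨by linarith [(hu s a).1], (hu s a).2⟩
  unfold lookahead
  refine (abs_add_three _ _ _).trans ?_
  rw [abs_mul (M.γ * (1 - M.δ)), abs_mul (M.γ * M.δ), abs_of_nonneg M.discount_nonneg,
    abs_of_nonneg M.γδ_nonneg]
  have := mul_le_mul_of_nonneg_left h1 M.discount_nonneg
  have := mul_le_mul_of_nonneg_left h2 M.γδ_nonneg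
  linarith

theorem abs_stateValue_sub_le {pol : S → A → ℝ} (hpol : ∀ s, pol s ∈ stdSimplex ℝ A)
    (Q Q' : S → A → ℝ) (s : S) : |stateValue pol Q s - stateValue pol Q' s| ≤ ‖Q - Q'‖ := by
  have := abs_sum_mul_le (x := fun a => Q s a - Q' s a) (sum_abs_of_mem_stdSimplex (hpol s)).le
    (norm_nonneg (Q - Q')) (fun a => abs_apply_apply_le_norm (Q - Q') s a)
  simpa [stateValue, mul_sub, Finset.sum_sub_distrib] using this

theorem norm_stateValue_sub_le {pol : S → A → ℝ} (hpol : ∀ s, pol s ∈ stdSimplex ℝ A)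
    (Q Q' : S → A → ℝ) : ‖stateValue pol Q - stateValue pol Q'‖ ≤ ‖Q - Q'‖ :=
  (pi_norm_le_iff_of_nonneg (norm_nonneg _)).2 fun s => abs_stateValue_sub_le hpol Q Q' s

theorem norm_stateValue_le {pol : S → A → ℝ} (hpol : ∀ s, pol s ∈ stdSimplex ℝ A)
    (Q : S → A → ℝ) : ‖stateValue pol Q‖ ≤ ‖Q‖ := by
  have := norm_stateValue_sub_le hpol Q 0
  have h0 : stateValue pol (0 : S → A → ℝ) = 0 := by funext s; simp [stateValue]
  rwa [h0, sub_zero, sub_zero] at this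

/-- Signed tables for which the smoothed robust Bellman operator is a contraction. -/
def Contractive (M : CMDP S A) (pol : S → A → ℝ) : Prop := ∀ s, M.γ * ∑ a, |pol s a| < 1

theorem Contractive.of_policy (M : CMDP S A) {pol : S → A → ℝ}
    (hpol : ∀ s, pol s ∈ stdSimplex ℝ A) : Contractive M pol := fun s => by
  rw [sum_abs_of_mem_stdSimplex (hpol s), mul_one]; exact M.γ_mem.2

theorem Contractive.exists_modulus {M : CMDP S A} {pol : S → A → ℝ} (h : Contractive M pol) :
    ∃ c, 0 ≤ c ∧ c < 1 ∧ ∀ s, M.γ * ∑ a, |pol s a| ≤ c := by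
  rcases isEmpty_or_nonempty S with hS | hS
  · exact ⟨0, le_rfl, one_pos, fun s => hS.elim s⟩
  · obtain ⟨s, hs⟩ := Finite.exists_max fun s => M.γ * ∑ a, |pol s a|
    exact ⟨_, mul_nonneg M.γ_mem.1 (Finset.sum_nonneg fun _ _ => abs_nonneg _), h s, hs⟩

/-- For a policy the modulus is `γ`. A general modulus is allowed because `π θ` need not be a policy
for `θ` outside `Θ`, while derivatives at points of `Θ` look at a full neighbourhood. -/
theorem norm_smoothedBellman_sub_le [Nonempty S] (M : CMDP S A) {σ : ℝ} (hσ : σ < 0)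
    (u : S → A → ℝ) {pol : S → A → ℝ} {c : ℝ} (hc : 0 ≤ c)
    (hpol : ∀ s, M.γ * ∑ a, |pol s a| ≤ c) (V V' : S → ℝ) :
    ‖smoothedBellman M σ u pol V - smoothedBellman M σ u pol V'‖ ≤ c * ‖V - V'‖ := by
  refine (pi_norm_le_iff_of_nonneg (mul_nonneg hc (norm_nonneg _))).2 fun s => ?_
  have := abs_sum_mul_le (w := pol s)
    (x := fun a => lookahead M σ u V s a - lookahead M σ u V' s a) le_rfl
    (mul_nonneg M.γ_mem.1 (norm_nonneg (V - V'))) (abs_lookahead_sub_le M hσ u V V' s)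
  have e : (smoothedBellman M σ u pol V - smoothedBellman M σ u pol V') s
      = ∑ a, pol s a * (lookahead M σ u V s a - lookahead M σ u V' s a) := by
    simp [smoothedBellman, stateValue, mul_sub, Finset.sum_sub_distrib]
  rw [e, Real.norm_eq_abs]
  refine this.trans ?_
  have := mul_le_mul_of_nonneg_right (hpol s) (norm_nonneg (V - V'))
  linarith

theorem smoothedValue_isFixedPt [Nonempty S] (M : CMDP S A) {σ : ℝ} (hσ : σ < 0)
    (u : S → A → ℝ) {pol : S → A → ℝ} (hpol : Contractive M pol) :
    smoothedBellman M σ u pol (smoothedValue M σ u pol) = smoothedValue M σ u pol := by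
  obtain ⟨c, hc0, hc1, hc⟩ := hpol.exists_modulus
  have hK : ContractingWith ⟨c, hc0⟩ (smoothedBellman M σ u pol) := by
    refine ⟨by exact_mod_cast hc1, LipschitzWith.of_dist_le_mul fun V V' => ?_⟩
    rw [dist_eq_norm, dist_eq_norm]
    exact norm_smoothedBellman_sub_le M hσ u hc0 hc V V'
  exact Classical.epsilon_spec
    (p := fun V => Function.IsFixedPt (smoothedBellman M σ u pol) V)
    ⟨_, hK.fixedPoint_isFixedPt⟩

theorem eq_smoothedValue [Nonempty S] (M : CMDP S A) {σ : ℝ} (hσ : σ < 0)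
    (u : S → A → ℝ) {pol : S → A → ℝ} (hpol : Contractive M pol) {V : S → ℝ}
    (hV : smoothedBellman M σ u pol V = V) : V = smoothedValue M σ u pol := by
  obtain ⟨c, hc0, hc1, hc⟩ := hpol.exists_modulus
  have h := norm_smoothedBellman_sub_le M hσ u hc0 hc V (smoothedValue M σ u pol)
  rw [hV, smoothedValue_isFixedPt M hσ u hpol] at h
  have h0 : ‖V - smoothedValue M σ u pol‖ = 0 := by
    nlinarith [norm_nonneg (V - smoothedValue M σ u pol)]
  exact sub_eq_zero.1 (norm_eq_zero.1 h0)

theorem stateValue_smoothedQ [Nonempty S] (M : CMDP S A) {σ : ℝ} (hσ : σ < 0)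
    (u : S → A → ℝ) {pol : S → A → ℝ} (hpol : Contractive M pol) :
    stateValue pol (smoothedQ M σ u pol) = smoothedValue M σ u pol :=
  smoothedValue_isFixedPt M hσ u hpol

theorem Csig_eq (M : CMDP S A) (σ : ℝ) : (1 - M.γ) * Csig M σ
    = 1 + 2 * M.γ * M.δ * (Real.log (Fintype.card S) / |σ|) := by
  have := M.one_sub_γ_pos
  unfold Csig; field_simp

theorem Csig_pos (M : CMDP S A) (σ : ℝ) : 0 < Csig M σ := by
  have := M.one_sub_γ_pos
  have h : 0 ≤ Real.log (Fintype.card S) / |σ| :=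
    div_nonneg (Real.log_natCast_nonneg _) (abs_nonneg _)
  have := mul_nonneg M.γδ_nonneg h
  unfold Csig
  refine mul_pos (by positivity) (by nlinarith)

/-- The fixed-point equation bounds `‖Q‖` by a constant plus `γ ‖Q‖`. The entropy term is needed
only once; the factor `2` in `Csig` is slack. -/
theorem norm_smoothedQ_le [Nonempty S] (M : CMDP S A) {σ : ℝ} (hσ : σ < 0)
    {u : S → A → ℝ} (hu : ∀ s a, u s a ∈ Set.Icc (0 : ℝ) 1) {pol : S → A → ℝ}
    (hpol : ∀ s, pol s ∈ stdSimplex ℝ A) : ‖smoothedQ M σ u pol‖ ≤ Csig M σ := by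
  set Q := smoothedQ M σ u pol with hQ
  have hV : ‖smoothedValue M σ u pol‖ ≤ ‖Q‖ := by
    rw [← stateValue_smoothedQ M hσ u (Contractive.of_policy M hpol)]
    exact norm_stateValue_le hpol Q
  have hl : 0 ≤ Real.log (Fintype.card S) / |σ| :=
    div_nonneg (Real.log_natCast_nonneg _) (abs_nonneg _)
  have hl' := mul_nonneg M.γδ_nonneg hl
  have h : ‖Q‖ ≤ 1 + M.γ * M.δ * (Real.log (Fintype.card S) / |σ|) + M.γ * ‖Q‖ := by
    have h0 : 0 ≤ 1 + M.γ * M.δ * (Real.log (Fintype.card S) / |σ|) + M.γ * ‖Q‖ :=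
      add_nonneg (by linarith) (mul_nonneg M.γ_mem.1 (norm_nonneg _))
    refine (pi_norm_le_iff_of_nonneg h0).2 fun s => (pi_norm_le_iff_of_nonneg h0).2 fun a => ?_
    refine (abs_lookahead_le M hσ hu (smoothedValue M σ u pol) s a).trans ?_
    have := mul_le_mul_of_nonneg_left hV M.γ_mem.1
    linarith
  have := Csig_eq M σ
  have := M.one_sub_γ_pos
  have h2 : (1 - M.γ) * ‖Q‖ ≤ (1 - M.γ) * Csig M σ := by linarith
  exact le_of_mul_le_mul_left h2 this

theorem norm_smoothedValue_le [Nonempty S] (M : CMDP S A) {σ : ℝ} (hσ : σ < 0)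
    {u : S → A → ℝ} (hu : ∀ s a, u s a ∈ Set.Icc (0 : ℝ) 1) {pol : S → A → ℝ}
    (hpol : ∀ s, pol s ∈ stdSimplex ℝ A) : ‖smoothedValue M σ u pol‖ ≤ Csig M σ := by
  rw [← stateValue_smoothedQ M hσ u (Contractive.of_policy M hpol)]
  exact (norm_stateValue_le hpol _).trans (norm_smoothedQ_le M hσ hu hpol)

/-- The smoothed robust value function is Lipschitz in the policy. -/
theorem norm_smoothedValue_sub_le [Nonempty S] (M : CMDP S A) {σ : ℝ} (hσ : σ < 0)
    {u : S → A → ℝ} (hu : ∀ s a, u s a ∈ Set.Icc (0 : ℝ) 1) {pol pol' : S → A → ℝ}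
    (hpol : ∀ s, pol s ∈ stdSimplex ℝ A) (hpol' : ∀ s, pol' s ∈ stdSimplex ℝ A) :
    ‖smoothedValue M σ u pol - smoothedValue M σ u pol'‖
      ≤ 1 / (1 - M.γ) * Fintype.card A * ‖pol - pol'‖ * Csig M σ := by
  set V := smoothedValue M σ u pol
  set V' := smoothedValue M σ u pol'
  have hc : ∀ s, M.γ * ∑ a, |pol s a| ≤ M.γ := fun s => by
    rw [sum_abs_of_mem_stdSimplex (hpol s), mul_one]
  have h1 := norm_smoothedBellman_sub_le M hσ u M.γ_mem.1 hc V V'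
  have h2 : ‖smoothedBellman M σ u pol V' - smoothedBellman M σ u pol' V'‖
      ≤ Fintype.card A * ‖pol - pol'‖ * Csig M σ := by
    refine (pi_norm_le_iff_of_nonneg (by have := Csig_pos M σ; positivity)).2 fun s => ?_
    have hw : ∑ a, |pol s a - pol' s a| ≤ Fintype.card A * ‖pol - pol'‖ := by
      refine (Finset.sum_le_card_nsmul _ _ _
        fun a _ => abs_apply_apply_le_norm (pol - pol') s a).trans ?_
      rw [nsmul_eq_mul, Finset.card_univ]
    have := abs_sum_mul_le (x := fun a => smoothedQ M σ u pol' s a) hw (Csig_pos M σ).le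
      (fun a => (abs_apply_apply_le_norm _ s a).trans (norm_smoothedQ_le M hσ hu hpol'))
    simpa [smoothedBellman, stateValue, smoothedQ, sub_mul, Finset.sum_sub_distrib] using this
  -- Change the value under one policy (a contraction), then the policy at the fixed value `V'`.
  have e : V - V' = (smoothedBellman M σ u pol V - smoothedBellman M σ u pol V')
      + (smoothedBellman M σ u pol V' - smoothedBellman M σ u pol' V') := by
    rw [smoothedValue_isFixedPt M hσ u (Contractive.of_policy M hpol),
      smoothedValue_isFixedPt M hσ u (Contractive.of_policy M hpol')]
    abel
  have h3 : ‖V - V'‖ ≤ M.γ * ‖V - V'‖ + Fintype.card A * ‖pol - pol'‖ * Csig M σ := by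
    conv_lhs => rw [e]
    exact (norm_add_le _ _).trans (add_le_add h1 h2)
  have := M.one_sub_γ_pos
  have e2 : 1 / (1 - M.γ) * Fintype.card A * ‖pol - pol'‖ * Csig M σ
      = (Fintype.card A * ‖pol - pol'‖ * Csig M σ) / (1 - M.γ) := by ring
  rw [e2, le_div_iff₀ this]
  linarith

theorem norm_smoothedQ_sub_le [Nonempty S] (M : CMDP S A) {σ : ℝ} (hσ : σ < 0)
    (u pol pol' : S → A → ℝ) : ‖smoothedQ M σ u pol - smoothedQ M σ u pol'‖
      ≤ ‖smoothedValue M σ u pol - smoothedValue M σ u pol'‖ := by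
  refine (pi_norm_le_iff_of_nonneg (norm_nonneg _)).2 fun s =>
    (pi_norm_le_iff_of_nonneg (norm_nonneg _)).2 fun a => ?_
  refine (abs_lookahead_sub_le M hσ u _ _ s a).trans ?_
  have := mul_le_mul_of_nonneg_right M.γ_mem.2.le
    (norm_nonneg (smoothedValue M σ u pol - smoothedValue M σ u pol'))
  linarith

theorem abs_atInitial_sub_le (M : CMDP S A) (V V' : S → ℝ) :
    |atInitial M V - atInitial M V'| ≤ ‖V - V'‖ := by
  have := abs_sum_mul_le (sum_abs_toReal_pmf M.ρ).le (norm_nonneg (V - V'))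
    (abs_apply_sub_le_norm V V')
  simpa [atInitial, mul_sub, Finset.sum_sub_distrib] using this

theorem abs_atInitial_le (M : CMDP S A) (V : S → ℝ) : |atInitial M V| ≤ ‖V‖ := by
  have := abs_sum_mul_le (sum_abs_toReal_pmf M.ρ).le (norm_nonneg V) (norm_le_pi_norm V)
  simpa [atInitial] using this

end Bellman

/-! ### Softmin weights and the derivative of log-sum-exp. -/

section SoftWeights

variable {S : Type*} [Fintype S]

/-- The weights of the softmin, `exp (σ V(s)) / ∑ exp (σ V)`: the derivative of `LSE`. -/
def softWeight (σ : ℝ) (V : S → ℝ) (s : S) : ℝ :=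
  Real.exp (σ * V s) / ∑ s', Real.exp (σ * V s')

theorem softWeight_mem_stdSimplex [Nonempty S] (σ : ℝ) (V : S → ℝ) :
    softWeight σ V ∈ stdSimplex ℝ S := by
  refine ⟨fun s => div_nonneg (Real.exp_pos _).le (sum_exp_pos σ V).le, ?_⟩
  simp only [softWeight]
  rw [← Finset.sum_div, div_self (sum_exp_pos σ V).ne']

/-- Numerator and denominator each change by a factor of at most `exp (|σ| ‖V - V'‖)`; this gives
the `2` in the exponent. -/
theorem exp_neg_mul_softWeight_le [Nonempty S] (σ : ℝ) (V V' : S → ℝ) (s : S) :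
    Real.exp (-(2 * (|σ| * ‖V - V'‖))) * softWeight σ V s ≤ softWeight σ V' s := by
  set h := |σ| * ‖V - V'‖
  have key : ∀ s, |σ * V s - σ * V' s| ≤ h := fun s => by
    rw [← mul_sub, abs_mul]
    exact mul_le_mul_of_nonneg_left (abs_apply_sub_le_norm V V' s) (abs_nonneg _)
  have h1 : ∑ s, Real.exp (σ * V' s) ≤ Real.exp h * ∑ s, Real.exp (σ * V s) := by
    rw [Finset.mul_sum]
    refine Finset.sum_le_sum fun s _ => ?_
    rw [← Real.exp_add]
    exact Real.exp_le_exp.2 (by linarith [neg_abs_le (σ * V s - σ * V' s), key s])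
  have h2 : Real.exp (-h) * Real.exp (σ * V s) ≤ Real.exp (σ * V' s) := by
    rw [← Real.exp_add]
    exact Real.exp_le_exp.2 (by linarith [le_abs_self (σ * V s - σ * V' s), key s])
  have p1 := sum_exp_pos σ V
  have p2 := sum_exp_pos σ V'
  unfold softWeight
  rw [mul_div_assoc', div_le_div_iff₀ p1 p2]
  calc Real.exp (-(2 * h)) * Real.exp (σ * V s) * ∑ s, Real.exp (σ * V' s)
      ≤ Real.exp (-(2 * h)) * Real.exp (σ * V s) * (Real.exp h * ∑ s, Real.exp (σ * V s)) := by
        gcongr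
    _ = (Real.exp (-h) * Real.exp (σ * V s)) * ∑ s, Real.exp (σ * V s) := by
        have : Real.exp (-(2 * h)) * Real.exp h = Real.exp (-h) := by
          rw [← Real.exp_add]; ring_nf
        rw [← this]; ring
    _ ≤ _ := by gcongr

/-- The multiplicative comparison is used in both directions with `1 - 2h ≤ exp (-2h)`, so that each
difference is at most `2h` times the sum of the two weights. No derivative of the weights is needed.
-/
theorem sum_abs_softWeight_sub_le [Nonempty S] (σ : ℝ) (V V' : S → ℝ) :
    ∑ s, |softWeight σ V s - softWeight σ V' s| ≤ 4 * |σ| * ‖V - V'‖ := by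
  set h := |σ| * ‖V - V'‖ with hh
  have hexp : 1 - 2 * h ≤ Real.exp (-(2 * h)) := by linarith [Real.add_one_le_exp (-(2 * h))]
  have h0 : 0 ≤ h := by positivity
  have m := softWeight_mem_stdSimplex σ V
  have m' := softWeight_mem_stdSimplex σ V'
  have key : ∀ s, |softWeight σ V s - softWeight σ V' s|
      ≤ 2 * h * (softWeight σ V s + softWeight σ V' s) := fun s => by
    have a := exp_neg_mul_softWeight_le σ V V' s
    have b := exp_neg_mul_softWeight_le σ V' V s
    rw [norm_sub_rev, ← hh] at b
    rw [← hh] at a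
    have a' := mul_le_mul_of_nonneg_right hexp (m.1 s)
    have b' := mul_le_mul_of_nonneg_right hexp (m'.1 s)
    have := mul_nonneg h0 (m.1 s)
    have := mul_nonneg h0 (m'.1 s)
    rw [abs_le]
    constructor <;> linarith
  refine (Finset.sum_le_sum fun s _ => key s).trans ?_
  rw [← Finset.mul_sum, Finset.sum_add_distrib, m.2, m'.2, hh]
  linarith

theorem LSE_hasFDerivAt [Nonempty S] {E : Type*} [NormedAddCommGroup E] [NormedSpace ℝ E] {σ : ℝ}
    (hσ : σ ≠ 0) {f : E → S → ℝ} {f' : S → E →L[ℝ] ℝ} {x : E}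
    (hf : ∀ s, HasFDerivAt (fun y => f y s) (f' s) x) :
    HasFDerivAt (fun y => LSE σ (f y)) (∑ s, softWeight σ (f x) s • f' s) x := by
  have h1 : HasFDerivAt (fun y => ∑ s, Real.exp (σ * f y s))
      (∑ s, Real.exp (σ * f x s) • (σ • f' s)) x :=
    HasFDerivAt.fun_sum fun s _ => ((hf s).const_mul σ).exp
  have h2 := (h1.log (sum_exp_pos σ (f x)).ne').const_mul σ⁻¹
  have e : (fun y => LSE σ (f y)) = fun y => σ⁻¹ * Real.log (∑ s, Real.exp (σ * f y s)) := by
    funext y; simp [LSE, div_eq_inv_mul]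
  rw [e]
  refine h2.congr_fderiv ?_
  ext v
  have := (sum_exp_pos σ (f x)).ne'
  simp only [softWeight, smul_apply, sum_apply,
    smul_eq_mul, Finset.mul_sum]
  refine Finset.sum_congr rfl fun s _ => ?_
  field_simp

end SoftWeights

/-! ### Differentiability of the value and the equation for its gradient. -/

section ValueDerivative

variable {S A : Type*} [Fintype S] [Fintype A]

theorem isInvertible_one_sub_of_norm_lt {E : Type*} [NormedAddCommGroup E] [NormedSpace ℝ E]
    [CompleteSpace E] {T : E →L[ℝ] E} (hT : ‖T‖ < 1) :
    (ContinuousLinearMap.id ℝ E - T).IsInvertible :=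
  ⟨ContinuousLinearEquiv.unitsEquiv ℝ E (Units.oneSub T hT), by ext; simp⟩

theorem contDiff_smoothedBellman [Nonempty S] (M : CMDP S A) (σ : ℝ) (u : S → A → ℝ) :
    ContDiff ℝ 1 fun z : (S → A → ℝ) × (S → ℝ) => smoothedBellman M σ u z.1 z.2 := by
  have h : ContDiff ℝ 1 fun z : (S → A → ℝ) × (S → ℝ) =>
      Real.log (∑ s, Real.exp (σ * z.2 s)) :=
    ContDiff.log (by fun_prop) fun z => (sum_exp_pos σ z.2).ne'
  unfold smoothedBellman stateValue lookahead LSE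
  fun_prop

/-- Openness makes the fixed point unique for all nearby tables, which identifies the branch given
by the implicit function theorem and extends the fixed-point equation to parameters off `Θ`. -/
theorem isOpen_contractive (M : CMDP S A) : IsOpen {pol : S → A → ℝ | Contractive M pol} := by
  simp only [Contractive, Set.ofPred_forall]
  exact isOpen_iInter_of_finite fun s => isOpen_lt (by fun_prop) continuous_const

/-- Implicit function theorem for `V - T(pol, V) = 0`: the partial derivative in `V` is the identity
minus an operator of norm below one, hence invertible by a Neumann series. -/
theorem differentiableAt_smoothedValue [Nonempty S] (M : CMDP S A) {σ : ℝ} (hσ : σ < 0)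
    (u : S → A → ℝ) {pol : S → A → ℝ} (hpol : Contractive M pol) :
    DifferentiableAt ℝ (smoothedValue M σ u) pol := by
  set V := smoothedValue M σ u pol with hV
  set f : (S → A → ℝ) × (S → ℝ) → (S → ℝ) := fun z => z.2 - smoothedBellman M σ u z.1 z.2 with hf
  have hfc : ContDiff ℝ 1 f := contDiff_snd.sub (contDiff_smoothedBellman M σ u)
  have hs : HasStrictFDerivAt f (fderiv ℝ f (pol, V)) (pol, V) :=
    hfc.contDiffAt.hasStrictFDerivAt one_ne_zero
  have hT : HasFDerivAt (smoothedBellman M σ u pol) (fderiv ℝ (smoothedBellman M σ u pol) V) V := by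
    have : ContDiff ℝ 1 (smoothedBellman M σ u pol) :=
      (contDiff_smoothedBellman M σ u).comp (contDiff_const.prodMk contDiff_id)
    exact (this.differentiable one_ne_zero V).hasFDerivAt
  have hpart : fderiv ℝ f (pol, V) ∘L .inr ℝ (S → A → ℝ) (S → ℝ)
      = ContinuousLinearMap.id ℝ (S → ℝ) - fderiv ℝ (smoothedBellman M σ u pol) V := by
    have h1 : HasFDerivAt (fun W : S → ℝ => f (pol, W))
        (fderiv ℝ f (pol, V) ∘L .inr ℝ (S → A → ℝ) (S → ℝ)) V :=
      HasFDerivAt.comp V hs.hasFDerivAt (hasFDerivAt_prodMk_right pol V)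
    exact h1.unique ((hasFDerivAt_id V).sub hT)
  obtain ⟨c, hc0, hc1, hc⟩ := hpol.exists_modulus
  have hinv : (fderiv ℝ f (pol, V) ∘L .inr ℝ (S → A → ℝ) (S → ℝ)).IsInvertible := by
    rw [hpart]
    refine isInvertible_one_sub_of_norm_lt (lt_of_le_of_lt ?_ hc1)
    have := norm_fderiv_le_of_lipschitz ℝ (x₀ := V) (C := ⟨c, hc0⟩)
      (f := smoothedBellman M σ u pol) (LipschitzWith.of_dist_le_mul fun W W' => by
        rw [dist_eq_norm, dist_eq_norm]
        exact norm_smoothedBellman_sub_le M hσ u hc0 hc W W')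
    exact this
  have hd := (hs.hasStrictFDerivAt_implicitFunctionOfProdDomain hinv).hasFDerivAt.differentiableAt
  -- The implicit function produces fixed points for tables near `pol`; uniqueness of the fixed
  -- point makes it equal to `smoothedValue` there.
  refine hd.congr_of_eventuallyEq ?_
  have h0 : f (pol, V) = 0 := by
    simp only [hf, hV]
    rw [smoothedValue_isFixedPt M hσ u hpol, sub_self]
  filter_upwards [hs.eventually_apply_implicitFunctionOfProdDomain hinv,
    (isOpen_contractive M).mem_nhds hpol] with pol' h1 h2
  rw [h0] at h1
  exact (eq_smoothedValue M hσ u h2 (sub_eq_zero.1 h1).symm).symm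

variable {d : ℕ}

theorem PolicyClass.differentiableAt_π (PC : PolicyClass S A d) {θ : Param d} (hθ : θ ∈ PC.Θ) :
    DifferentiableAt ℝ PC.π θ :=
  differentiableAt_pi.2 fun s => differentiableAt_pi.2 fun a => PC.differentiable θ hθ s a

theorem PolicyClass.contractive (PC : PolicyClass S A d) (M : CMDP S A) {θ : Param d}
    (hθ : θ ∈ PC.Θ) : Contractive M (PC.π θ) :=
  Contractive.of_policy M (PC.isPolicy θ hθ)

/-- The gradient of the smoothed robust value function in the policy parameter. -/
def valueGrad (M : CMDP S A) (PC : PolicyClass S A d) (σ : ℝ) (u : S → A → ℝ) (θ : Param d)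
    (s : S) : Param d :=
  gradient (fun y => smoothedValue M σ u (PC.π y) s) θ

theorem hasGradientAt_value [Nonempty S] (M : CMDP S A) (PC : PolicyClass S A d) {σ : ℝ}
    (hσ : σ < 0) (u : S → A → ℝ) {θ : Param d} (hθ : θ ∈ PC.Θ) (s : S) :
    HasGradientAt (fun y => smoothedValue M σ u (PC.π y) s) (valueGrad M PC σ u θ s) θ := by
  have h : DifferentiableAt ℝ (fun y => smoothedValue M σ u (PC.π y)) θ :=
    DifferentiableAt.comp (g := smoothedValue M σ u) θ
      (differentiableAt_smoothedValue M hσ u (PC.contractive M hθ))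
      (PC.differentiableAt_π hθ)
  exact (differentiableAt_pi.1 h s).hasGradientAt

/-- The derivative of the one-step look-ahead at `V` in the direction `X`. -/
def lookaheadLin (M : CMDP S A) (σ : ℝ) (V : S → ℝ) (X : S → Param d) (s : S) (a : A) : Param d :=
  (M.γ * (1 - M.δ)) • ∑ s', (M.P s a s').toReal • X s'
    + (M.γ * M.δ) • ∑ s', softWeight σ V s' • X s'

/-- Product rule applied to the fixed-point equation: one term differentiates the policy, the other
the look-ahead. -/
theorem valueGrad_eq [Nonempty S] (M : CMDP S A) (PC : PolicyClass S A d) {σ : ℝ}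
    (hσ : σ < 0) (u : S → A → ℝ) {θ : Param d} (hθ : θ ∈ PC.Θ) (s : S) :
    valueGrad M PC σ u θ s = ∑ a, smoothedQ M σ u (PC.π θ) s a • gradient (fun x => PC.π x s a) θ
      + ∑ a, PC.π θ s a •
        lookaheadLin M σ (smoothedValue M σ u (PC.π θ)) (valueGrad M PC σ u θ) s a := by
  have hV : ∀ s, HasFDerivAt (fun y => smoothedValue M σ u (PC.π y) s)
      (innerSL ℝ (valueGrad M PC σ u θ s)) θ :=
    fun s => (hasGradientAt_value M PC hσ u hθ s).hasFDerivAt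
  have hπ : ∀ a, HasFDerivAt (fun y => PC.π y s a)
      (innerSL ℝ (gradient (fun x => PC.π x s a) θ)) θ :=
    fun a => (PC.differentiable θ hθ s a).hasGradientAt.hasFDerivAt
  have hQ : ∀ a, HasFDerivAt (fun y => lookahead M σ u (smoothedValue M σ u (PC.π y)) s a)
      ((M.γ * (1 - M.δ)) • ∑ s', (M.P s a s').toReal • innerSL ℝ (valueGrad M PC σ u θ s')
        + (M.γ * M.δ) • ∑ s', softWeight σ (smoothedValue M σ u (PC.π θ)) s' •
          innerSL ℝ (valueGrad M PC σ u θ s')) θ := fun a => by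
    have h1 : HasFDerivAt (fun y => ∑ s', (M.P s a s').toReal * smoothedValue M σ u (PC.π y) s')
        (∑ s', (M.P s a s').toReal • innerSL ℝ (valueGrad M PC σ u θ s')) θ :=
      HasFDerivAt.fun_sum fun s' _ => (hV s').const_mul _
    exact ((h1.const_mul (M.γ * (1 - M.δ))).const_add (u s a)).add
      ((LSE_hasFDerivAt hσ.ne hV).const_mul (M.γ * M.δ))
  have hR : HasFDerivAt (fun y => smoothedBellman M σ u (PC.π y) (smoothedValue M σ u (PC.π y)) s)
      _ θ := HasFDerivAt.fun_sum (u := Finset.univ) fun a _ => (hπ a).mul (hQ a)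
  -- The equation holds on a neighbourhood of `θ`, not only on `Θ`, so both sides have the same
  -- derivative even at boundary points.
  have hev : (fun y => smoothedValue M σ u (PC.π y) s) =ᶠ[nhds θ]
      fun y => smoothedBellman M σ u (PC.π y) (smoothedValue M σ u (PC.π y)) s := by
    have := (PC.differentiableAt_π hθ).continuousAt.eventually
      ((isOpen_contractive M).mem_nhds (PC.contractive M hθ))
    filter_upwards [this] with y hy
    rw [smoothedValue_isFixedPt M hσ u hy]
  have heq := (hV s).unique (hR.congr_of_eventuallyEq hev)
  refine ext_inner_right ℝ fun v => ?_
  have hv := congrArg (fun T : Param d →L[ℝ] ℝ => T v) heq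
  simp only [innerSL_apply_apply, sum_apply, add_apply,
    smul_apply, smul_eq_mul] at hv
  rw [hv, ← Finset.sum_add_distrib, sum_inner]
  refine Finset.sum_congr rfl fun a _ => ?_
  simp only [lookaheadLin, inner_add_left, real_inner_smul_left, sum_inner, smoothedQ]
  ring

end ValueDerivative

/-! ### The linearized Bellman equation and Lipschitz gradients. -/

section LinearizedBellman

variable {S A : Type*} [Fintype S] [Fintype A] {d : ℕ}

theorem norm_lookaheadLin_le [Nonempty S] (M : CMDP S A) (σ : ℝ) (V : S → ℝ) (X : S → Param d)
    (s : S) (a : A) : ‖lookaheadLin M σ V X s a‖ ≤ M.γ * ‖X‖ := by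
  have h1 : ‖∑ s', (M.P s a s').toReal • X s'‖ ≤ 1 * ‖X‖ :=
    norm_sum_smul_le (sum_abs_toReal_pmf _).le (norm_nonneg _) (norm_le_pi_norm X)
  have h2 : ‖∑ s', softWeight σ V s' • X s'‖ ≤ 1 * ‖X‖ :=
    norm_sum_smul_le (sum_abs_of_mem_stdSimplex (softWeight_mem_stdSimplex σ V)).le
      (norm_nonneg _) (norm_le_pi_norm X)
  refine (norm_add_le _ _).trans ?_
  rw [norm_smul, norm_smul, Real.norm_of_nonneg M.discount_nonneg, Real.norm_of_nonneg M.γδ_nonneg]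
  have := mul_le_mul_of_nonneg_left h1 M.discount_nonneg
  have := mul_le_mul_of_nonneg_left h2 M.γδ_nonneg
  linarith

theorem lookaheadLin_sub (M : CMDP S A) (σ : ℝ) (V : S → ℝ) (X Y : S → Param d) (s : S) (a : A) :
    lookaheadLin M σ V (X - Y) s a = lookaheadLin M σ V X s a - lookaheadLin M σ V Y s a := by
  simp only [lookaheadLin, Pi.sub_apply, smul_sub, Finset.sum_sub_distrib]
  abel

theorem norm_lookaheadLin_sub_le [Nonempty S] (M : CMDP S A) (σ : ℝ) (V V' : S → ℝ)
    (X : S → Param d) (s : S) (a : A) :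
    ‖lookaheadLin M σ V X s a - lookaheadLin M σ V' X s a‖ ≤ 4 * |σ| * ‖V - V'‖ * ‖X‖ := by
  have e : lookaheadLin M σ V X s a - lookaheadLin M σ V' X s a
      = (M.γ * M.δ) • ∑ s', (softWeight σ V s' - softWeight σ V' s') • X s' := by
    simp only [lookaheadLin, sub_smul, Finset.sum_sub_distrib, smul_sub]; abel
  have h := norm_sum_smul_le (sum_abs_softWeight_sub_le σ V V') (norm_nonneg X) (norm_le_pi_norm X)
  rw [e, norm_smul, Real.norm_of_nonneg M.γδ_nonneg]
  have h1 : M.γ * M.δ ≤ 1 := mul_le_one₀ M.γ_mem.2.le M.δ_mem.1 M.δ_mem.2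
  calc _ ≤ 1 * ‖∑ s', (softWeight σ V s' - softWeight σ V' s') • X s'‖ := by gcongr
    _ ≤ _ := by rw [one_mul]; exact h

theorem norm_sum_policy_smul_le {E : Type*} [SeminormedAddCommGroup E] [NormedSpace ℝ E]
    {pol : S → A → ℝ} (hpol : ∀ s, pol s ∈ stdSimplex ℝ A) {B : ℝ} (hB : 0 ≤ B)
    {x : A → E} (hx : ∀ a, ‖x a‖ ≤ B) (s : S) : ‖∑ a, pol s a • x a‖ ≤ B := by
  simpa using norm_sum_smul_le (sum_abs_of_mem_stdSimplex (hpol s)).le hB hx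

theorem sum_abs_sub_le_card_mul (pol pol' : S → A → ℝ) (s : S) :
    ∑ a, |pol s a - pol' s a| ≤ Fintype.card A * ‖pol - pol'‖ := by
  refine (Finset.sum_le_card_nsmul _ _ _
    fun a _ => abs_apply_apply_le_norm (pol - pol') s a).trans ?_
  rw [nsmul_eq_mul, Finset.card_univ]

theorem sum_abs_le_card_mul (Q : S → A → ℝ) (s : S) : ∑ a, |Q s a| ≤ Fintype.card A * ‖Q‖ := by
  simpa using sum_abs_sub_le_card_mul Q 0 s

/-- The difference of two solutions solves the homogeneous equation, which is a `γ`-contraction.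
This lets the policy gradient formula be verified by substitution. -/
theorem eq_of_linearized [Nonempty S] (M : CMDP S A) (σ : ℝ) (V : S → ℝ) {pol : S → A → ℝ}
    (hpol : ∀ s, pol s ∈ stdSimplex ℝ A) {g X Y : S → Param d}
    (hX : ∀ s, X s = g s + ∑ a, pol s a • lookaheadLin M σ V X s a)
    (hY : ∀ s, Y s = g s + ∑ a, pol s a • lookaheadLin M σ V Y s a) : X = Y := by
  have h : ‖X - Y‖ ≤ M.γ * ‖X - Y‖ := by
    have h0 : 0 ≤ M.γ * ‖X - Y‖ := mul_nonneg M.γ_mem.1 (norm_nonneg _)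
    refine (pi_norm_le_iff_of_nonneg h0).2 fun s => ?_
    have e : (X - Y) s = ∑ a, pol s a • lookaheadLin M σ V (X - Y) s a := by
      rw [Pi.sub_apply, hX s, hY s]
      simp only [lookaheadLin_sub, smul_sub, Finset.sum_sub_distrib]; abel
    rw [e]
    exact norm_sum_policy_smul_le hpol h0 (norm_lookaheadLin_le M σ V (X - Y) s) s
  have h0 : ‖X - Y‖ = 0 := by nlinarith [norm_nonneg (X - Y), M.one_sub_γ_pos]
  exact sub_eq_zero.1 (norm_eq_zero.1 h0)

theorem CVsig_eq (M : CMDP S A) (PC : PolicyClass S A d) (σ : ℝ) :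
    (1 - M.γ) * CVsig M PC σ = Fintype.card A * PC.k * Csig M σ := by
  have := M.one_sub_γ_pos
  unfold CVsig; field_simp

theorem CVsig_pos [Nonempty A] (M : CMDP S A) (PC : PolicyClass S A d) (σ : ℝ) :
    0 < CVsig M PC σ := by
  have := M.one_sub_γ_pos
  have := PC.k_pos
  have := Csig_pos M σ
  unfold CVsig; positivity

theorem norm_policyTerm_le (PC : PolicyClass S A d) {θ : Param d} (hθ : θ ∈ PC.Θ)
    (Q : S → A → ℝ) (s : S) :
    ‖∑ a, Q s a • gradient (fun x => PC.π x s a) θ‖ ≤ Fintype.card A * ‖Q‖ * PC.k :=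
  norm_sum_smul_le (sum_abs_le_card_mul Q s) PC.k_pos.le (PC.lipschitz θ hθ s)

theorem norm_valueGrad_le [Nonempty S] (M : CMDP S A) (PC : PolicyClass S A d) {σ : ℝ}
    (hσ : σ < 0) {u : S → A → ℝ} (hu : ∀ s a, u s a ∈ Set.Icc (0 : ℝ) 1) {θ : Param d}
    (hθ : θ ∈ PC.Θ) : ‖valueGrad M PC σ u θ‖ ≤ CVsig M PC σ := by
  set X := valueGrad M PC σ u θ
  have hk := PC.k_pos
  have hC := Csig_pos M σ
  have h : ‖X‖ ≤ Fintype.card A * PC.k * Csig M σ + M.γ * ‖X‖ := by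
    have h0 : 0 ≤ M.γ * ‖X‖ := mul_nonneg M.γ_mem.1 (norm_nonneg _)
    refine (pi_norm_le_iff_of_nonneg (by positivity)).2 fun s => ?_
    rw [show X s = _ from valueGrad_eq M PC hσ u hθ s]
    refine (norm_add_le _ _).trans (add_le_add ?_ ?_)
    · refine (norm_policyTerm_le PC hθ _ s).trans ?_
      have := norm_smoothedQ_le M hσ hu (PC.isPolicy θ hθ)
      calc (Fintype.card A : ℝ) * ‖smoothedQ M σ u (PC.π θ)‖ * PC.k
          ≤ Fintype.card A * Csig M σ * PC.k := by gcongr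
        _ = _ := by ring
    · exact norm_sum_policy_smul_le (PC.isPolicy θ hθ) h0 (norm_lookaheadLin_le M σ _ X s) s
  have := CVsig_eq M PC σ
  refine le_of_mul_le_mul_left (?_ : (1 - M.γ) * ‖X‖ ≤ _) M.one_sub_γ_pos
  linarith

/-- The policies are Lipschitz on `Θ`. -/
theorem norm_π_sub_le (PC : PolicyClass S A d) {θ θ' : Param d} (hθ : θ ∈ PC.Θ)
    (hθ' : θ' ∈ PC.Θ) : ‖PC.π θ - PC.π θ'‖ ≤ PC.k * ‖θ - θ'‖ := by
  have h0 : 0 ≤ PC.k * ‖θ - θ'‖ := mul_nonneg PC.k_pos.le (norm_nonneg _)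
  refine (pi_norm_le_iff_of_nonneg h0).2 fun s => (pi_norm_le_iff_of_nonneg h0).2 fun a => ?_
  refine PC.convex.norm_image_sub_le_of_norm_hasFDerivWithin_le
    (f := fun x => PC.π x s a) (fun x hx =>
      (PC.differentiable x hx s a).hasGradientAt.hasFDerivAt.hasFDerivWithinAt) (fun x hx => ?_)
    hθ' hθ
  rw [LinearIsometryEquiv.norm_map]
  exact PC.lipschitz x hx s a

theorem norm_gradπ_sub_le (PC : PolicyClass S A d) {θ θ' : Param d} (hθ : θ ∈ PC.Θ)
    (hθ' : θ' ∈ PC.Θ) (s : S) (a : A) :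
    ‖gradient (fun x => PC.π x s a) θ - gradient (fun x => PC.π x s a) θ'‖ ≤ PC.l * ‖θ - θ'‖ :=
  PC.convex.norm_image_sub_le_of_norm_hasFDerivWithin_le
    (f := fun y => gradient (fun x => PC.π x s a) y)
    (fun x hx => (PC.twice_differentiable x hx s a).hasFDerivAt.hasFDerivWithinAt)
    (fun x hx => PC.smooth x hx s a) hθ' hθ

theorem norm_value_sub_le [Nonempty S] (M : CMDP S A) (PC : PolicyClass S A d) {σ : ℝ}
    (hσ : σ < 0) {u : S → A → ℝ} (hu : ∀ s a, u s a ∈ Set.Icc (0 : ℝ) 1) {θ θ' : Param d}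
    (hθ : θ ∈ PC.Θ) (hθ' : θ' ∈ PC.Θ) :
    ‖smoothedValue M σ u (PC.π θ) - smoothedValue M σ u (PC.π θ')‖ ≤ CVsig M PC σ * ‖θ - θ'‖ := by
  refine (norm_smoothedValue_sub_le M hσ hu (PC.isPolicy θ hθ) (PC.isPolicy θ' hθ')).trans ?_
  have := M.one_sub_γ_pos
  have := Csig_pos M σ
  calc 1 / (1 - M.γ) * Fintype.card A * ‖PC.π θ - PC.π θ'‖ * Csig M σ
      ≤ 1 / (1 - M.γ) * Fintype.card A * (PC.k * ‖θ - θ'‖) * Csig M σ := by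
        gcongr; exact norm_π_sub_le PC hθ hθ'
    _ = _ := by unfold CVsig; ring

/-- The gradient of the smoothed robust value function is Lipschitz on `Θ`. -/
theorem exists_lipschitz_valueGrad [Nonempty S] (M : CMDP S A) (PC : PolicyClass S A d) {σ : ℝ}
    (hσ : σ < 0) {u : S → A → ℝ} (hu : ∀ s a, u s a ∈ Set.Icc (0 : ℝ) 1) :
    ∃ L, 0 ≤ L ∧ ∀ θ ∈ PC.Θ, ∀ θ' ∈ PC.Θ,
      ‖valueGrad M PC σ u θ - valueGrad M PC σ u θ'‖ ≤ L * ‖θ - θ'‖ := by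
  have hγ := M.one_sub_γ_pos
  have hk := PC.k_pos
  set C := CVsig M PC σ with hCdef
  have hC : 0 ≤ C := by
    obtain ⟨θ, hθ⟩ := PC.nonempty
    exact (norm_nonneg _).trans (norm_valueGrad_le M PC hσ hu hθ)
  have hCs := Csig_pos M σ
  -- One summand for each ingredient of the gradient equation that varies with `θ`: the policy
  -- gradient, the action values, the softmin weights, and the averaging policy.
  set L₀ : ℝ := Fintype.card A * Csig M σ * |PC.l| + Fintype.card A * C * PC.k
    + 4 * |σ| * C * C + Fintype.card A * PC.k * C with hL₀
  have hL₀0 : 0 ≤ L₀ := by positivity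
  refine ⟨L₀ / (1 - M.γ), by positivity, fun θ hθ θ' hθ' => ?_⟩
  set X := valueGrad M PC σ u θ
  set X' := valueGrad M PC σ u θ'
  set V := smoothedValue M σ u (PC.π θ)
  set V' := smoothedValue M σ u (PC.π θ')
  set Q := smoothedQ M σ u (PC.π θ)
  set Q' := smoothedQ M σ u (PC.π θ')
  have hX' : ‖X'‖ ≤ C := norm_valueGrad_le M PC hσ hu hθ'
  have hV : ‖V - V'‖ ≤ C * ‖θ - θ'‖ := norm_value_sub_le M PC hσ hu hθ hθ'
  have hQ : ‖Q - Q'‖ ≤ C * ‖θ - θ'‖ := (norm_smoothedQ_sub_le M hσ u _ _).trans hV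
  have hQb : ‖Q‖ ≤ Csig M σ := norm_smoothedQ_le M hσ hu (PC.isPolicy θ hθ)
  have hπ := norm_π_sub_le PC hθ hθ'
  have hn := norm_nonneg (θ - θ')
  have main : ‖X - X'‖ ≤ M.γ * ‖X - X'‖ + L₀ * ‖θ - θ'‖ := by
    have hγX : 0 ≤ M.γ * ‖X - X'‖ := mul_nonneg M.γ_mem.1 (norm_nonneg _)
    refine (pi_norm_le_iff_of_nonneg (by positivity)).2 fun s => ?_
    -- Replace the ingredients one at a time. The first sum is the contraction applied to `X - X'`;
    -- the other four have size of order `‖θ - θ'‖`.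
    have e : (X - X') s =
        ∑ a, PC.π θ s a • lookaheadLin M σ V (X - X') s a
        + (∑ a, Q s a • (gradient (fun x => PC.π x s a) θ - gradient (fun x => PC.π x s a) θ')
        + ∑ a, (Q s a - Q' s a) • gradient (fun x => PC.π x s a) θ'
        + ∑ a, PC.π θ s a • (lookaheadLin M σ V X' s a - lookaheadLin M σ V' X' s a)
        + ∑ a, (PC.π θ s a - PC.π θ' s a) • lookaheadLin M σ V' X' s a) := by
      rw [Pi.sub_apply, show X s = _ from valueGrad_eq M PC hσ u hθ s,
        show X' s = _ from valueGrad_eq M PC hσ u hθ' s]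
      simp only [lookaheadLin_sub, smul_sub, sub_smul, Finset.sum_sub_distrib]
      abel
    rw [e]
    refine (norm_add_le _ _).trans (add_le_add ?_ ?_)
    · exact norm_sum_policy_smul_le (PC.isPolicy θ hθ) hγX (norm_lookaheadLin_le M σ V _ s) s
    · have t1 : ‖∑ a, Q s a • (gradient (fun x => PC.π x s a) θ
          - gradient (fun x => PC.π x s a) θ')‖
          ≤ Fintype.card A * Csig M σ * (|PC.l| * ‖θ - θ'‖) := by
        refine norm_sum_smul_le ((sum_abs_le_card_mul Q s).trans (by gcongr)) (by positivity)
          fun a => (norm_gradπ_sub_le PC hθ hθ' s a).trans ?_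
        gcongr; exact le_abs_self _
      have t2 : ‖∑ a, (Q s a - Q' s a) • gradient (fun x => PC.π x s a) θ'‖
          ≤ Fintype.card A * (C * ‖θ - θ'‖) * PC.k :=
        norm_sum_smul_le ((sum_abs_sub_le_card_mul Q Q' s).trans (by gcongr)) hk.le
          (PC.lipschitz θ' hθ' s)
      have t3 : ‖∑ a, PC.π θ s a • (lookaheadLin M σ V X' s a - lookaheadLin M σ V' X' s a)‖
          ≤ 4 * |σ| * (C * ‖θ - θ'‖) * C :=
        norm_sum_policy_smul_le (PC.isPolicy θ hθ) (by positivity) (fun a =>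
          (norm_lookaheadLin_sub_le M σ V V' X' s a).trans (by gcongr)) s
      have t4 : ‖∑ a, (PC.π θ s a - PC.π θ' s a) • lookaheadLin M σ V' X' s a‖
          ≤ Fintype.card A * (PC.k * ‖θ - θ'‖) * C := by
        refine norm_sum_smul_le ((sum_abs_sub_le_card_mul _ _ s).trans (by gcongr)) hC
          fun a => (norm_lookaheadLin_le M σ V' X' s a).trans ?_
        calc M.γ * ‖X'‖ ≤ 1 * C := by gcongr; exact M.γ_mem.2.le
          _ = C := one_mul C
      refine norm_add₄_le.trans ((add_le_add (add_le_add (add_le_add t1 t2) t3) t4).trans ?_)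
      rw [hL₀]
      exact le_of_eq (by ring)
  rw [div_mul_eq_mul_div, le_div_iff₀ hγ]
  linarith

end LinearizedBellman

/-! ### Discounted visitation distributions. -/

section Visitation

variable {S A : Type*} [Fintype S] [Fintype A] [DecidableEq S]

theorem CMDP.discount_lt_one (M : CMDP S A) : M.γ * (1 - M.δ) < 1 :=
  lt_of_le_of_lt (mul_le_of_le_one_right M.γ_mem.1 (by linarith [M.δ_mem.1])) M.γ_mem.2

theorem CMDP.one_sub_discount (M : CMDP S A) : 1 - M.γ + M.γ * M.δ = 1 - M.γ * (1 - M.δ) := by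
  ring

theorem CMDP.one_sub_discount_pos (M : CMDP S A) : 0 < 1 - M.γ + M.γ * M.δ := by
  rw [M.one_sub_discount]; exact sub_pos.2 M.discount_lt_one

theorem transition_pow_mem (M : CMDP S A) {pol : S → A → ℝ} (hpol : ∀ s, pol s ∈ stdSimplex ℝ A)
    (n : ℕ) (s : S) : (transition M pol ^ n) s ∈ stdSimplex ℝ S := by
  induction n generalizing s with
  | zero =>
    refine ⟨fun s' => ?_, ?_⟩
    · rw [pow_zero, Matrix.one_apply]; split_ifs <;> norm_num
    · simp [Matrix.one_apply]
  | succ n ih =>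
    have h0 : ∀ s s', 0 ≤ transition M pol s s' := fun s s' =>
      Finset.sum_nonneg fun a _ => mul_nonneg ((hpol s).1 a) ENNReal.toReal_nonneg
    have h1 : ∑ s', transition M pol s s' = 1 := by
      simp only [transition, Matrix.of_apply]
      rw [Finset.sum_comm]
      simp only [← Finset.mul_sum, sum_toReal_pmf, mul_one]
      exact (hpol s).2
    rw [pow_succ']
    refine ⟨fun s' => ?_, ?_⟩
    · rw [Matrix.mul_apply]
      exact Finset.sum_nonneg fun x _ => mul_nonneg (h0 s x) ((ih x).1 s')
    · simp only [Matrix.mul_apply]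
      rw [Finset.sum_comm]
      simp only [← Finset.mul_sum, (ih _).2, mul_one]
      exact h1

theorem summable_visitation (M : CMDP S A) {pol : S → A → ℝ}
    (hpol : ∀ s, pol s ∈ stdSimplex ℝ A) (s s' : S) :
    Summable fun n : ℕ => (M.γ * (1 - M.δ)) ^ n * (transition M pol ^ n) s s' := by
  refine Summable.of_nonneg_of_le
    (fun n => mul_nonneg (pow_nonneg M.discount_nonneg n) ((transition_pow_mem M hpol n s).1 s'))
    (fun n => ?_) (summable_geometric_of_lt_one M.discount_nonneg M.discount_lt_one)
  have h := transition_pow_mem M hpol n s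
  have : (transition M pol ^ n) s s' ≤ 1 := by
    rw [← h.2]; exact Finset.single_le_sum (fun x _ => h.1 x) (Finset.mem_univ s')
  exact mul_le_of_le_one_right (pow_nonneg M.discount_nonneg n) this

theorem visitation_mem_stdSimplex (M : CMDP S A) {pol : S → A → ℝ}
    (hpol : ∀ s, pol s ∈ stdSimplex ℝ A) (s : S) : visitation M pol s ∈ stdSimplex ℝ S := by
  refine ⟨fun s' => mul_nonneg M.one_sub_discount_pos.le (tsum_nonneg fun n =>
    mul_nonneg (pow_nonneg M.discount_nonneg n) ((transition_pow_mem M hpol n s).1 s')), ?_⟩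
  simp only [visitation]
  rw [← Finset.mul_sum, ← Summable.tsum_finsetSum fun s' _ => summable_visitation M hpol s s']
  simp only [← Finset.mul_sum, (transition_pow_mem M hpol _ s).2, mul_one]
  rw [tsum_geometric_of_lt_one M.discount_nonneg M.discount_lt_one, M.one_sub_discount]
  exact mul_inv_cancel₀ (sub_pos.2 M.discount_lt_one).ne'

/-- Split off the term `n = 0` and factor one transition out of the rest of the Neumann series. -/
theorem visitation_eq (M : CMDP S A) {pol : S → A → ℝ} (hpol : ∀ s, pol s ∈ stdSimplex ℝ A)
    (s s' : S) : visitation M pol s s' = (1 - M.γ + M.γ * M.δ) * (1 : Matrix S S ℝ) s s'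
      + M.γ * (1 - M.δ) * ∑ x, transition M pol s x * visitation M pol x s' := by
  have h1 : ∑' n : ℕ, (M.γ * (1 - M.δ)) ^ (n + 1) * (transition M pol ^ (n + 1)) s s'
      = M.γ * (1 - M.δ) * ∑ x, transition M pol s x *
        ∑' n : ℕ, (M.γ * (1 - M.δ)) ^ n * (transition M pol ^ n) x s' := by
    simp only [← tsum_mul_left]
    rw [← Summable.tsum_finsetSum fun x _ => (summable_visitation M hpol x s').mul_left _,
      ← tsum_mul_left]
    refine tsum_congr fun n => ?_
    rw [pow_succ' (transition M pol), Matrix.mul_apply, Finset.mul_sum, Finset.mul_sum]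
    exact Finset.sum_congr rfl fun x _ => by ring
  unfold visitation
  rw [(summable_visitation M hpol s s').tsum_eq_zero_add, h1, pow_zero, pow_zero, one_mul, mul_add]
  congr 1
  simp only [Finset.mul_sum]
  exact Finset.sum_congr rfl fun x _ => by ring

end Visitation

/-! ### The policy gradient formula and its stability. -/

section PolicyGradient

variable {S A : Type*} [Fintype S] [Fintype A] [DecidableEq S] {d : ℕ}

/-- The visitation measure is a resolvent, so `gradB` solves the gradient equation with the
log-sum-exp part removed. -/
theorem gradB_eq (M : CMDP S A) (PC : PolicyClass S A d) {θ : Param d} (hθ : θ ∈ PC.Θ)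
    (Q : S → A → ℝ) (s : S) :
    gradB M PC θ Q s = ∑ a, Q s a • gradient (fun x => PC.π x s a) θ
      + (M.γ * (1 - M.δ)) • ∑ a, PC.π θ s a • ∑ s', (M.P s a s').toReal • gradB M PC θ Q s' := by
  set g : S → Param d := fun s => ∑ a, Q s a • gradient (fun x => PC.π x s a) θ with hg
  have hκ := M.one_sub_discount_pos
  set κ := 1 - M.γ + M.γ * M.δ with hκdef
  have hB : ∀ s, gradB M PC θ Q s = (1 / κ) • ∑ s', visitation M (PC.π θ) s s' • g s' :=
    fun s => rfl
  have h2 : ∑ a, PC.π θ s a • ∑ s', (M.P s a s').toReal • gradB M PC θ Q s'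
      = ∑ x, transition M (PC.π θ) s x • gradB M PC θ Q x := by
    simp only [transition, Matrix.of_apply, Finset.sum_smul, Finset.smul_sum, smul_smul]
    rw [Finset.sum_comm]
  rw [h2]
  simp only [hB]
  have h3 : ∑ s', visitation M (PC.π θ) s s' • g s' = κ • g s + (M.γ * (1 - M.δ)) •
      ∑ x, transition M (PC.π θ) s x • ∑ s', visitation M (PC.π θ) x s' • g s' := by
    have : ∀ s', visitation M (PC.π θ) s s' • g s' = (κ * (1 : Matrix S S ℝ) s s') • g s'
        + (M.γ * (1 - M.δ)) • ∑ x, (transition M (PC.π θ) s x * visitation M (PC.π θ) x s') • g s' :=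
      fun s' => by
        rw [visitation_eq M (PC.isPolicy θ hθ) s s', add_smul, ← hκdef, ← Finset.sum_smul,
          smul_smul]
    simp only [this, Finset.sum_add_distrib, ← Finset.smul_sum]
    congr 1
    · simp [Matrix.one_apply]
    · rw [Finset.sum_comm]
      simp only [Finset.smul_sum, smul_smul]
  rw [h3, smul_add, smul_smul, one_div_mul_cancel hκ.ne', one_smul]
  congr 1
  simp only [Finset.smul_sum, smul_smul]
  exact Finset.sum_congr rfl fun x _ => Finset.sum_congr rfl fun s' _ => by congr 1; ring

/-- The estimate of the gradient of the value of the state `s`. -/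
def gradAt (M : CMDP S A) (PC : PolicyClass S A d) (σ : ℝ) (θ : Param d) (Q : S → A → ℝ) (s : S) :
    Param d :=
  gradB M PC θ Q s + (M.γ * M.δ / (1 - M.γ)) •
    ∑ s', softWeight σ (stateValue (PC.π θ) Q) s' • gradB M PC θ Q s'

theorem gradEstimate_eq (M : CMDP S A) (PC : PolicyClass S A d) (σ : ℝ) (θ : Param d)
    (Q : S → A → ℝ) :
    gradEstimate M PC σ θ Q = ∑ s, (M.ρ s).toReal • gradAt M PC σ θ Q s := by
  unfold gradEstimate gradAt
  refine Finset.sum_congr rfl fun s _ => ?_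
  congr 2
  simp only [Finset.smul_sum, smul_smul, softWeight]
  refine Finset.sum_congr rfl fun s' _ => ?_
  congr 1
  rw [div_mul_div_comm, div_mul_eq_mul_div]

/-- The policy gradient theorem for the smoothed robust value function. -/
theorem valueGrad_eq_gradAt [Nonempty S] (M : CMDP S A) (PC : PolicyClass S A d) {σ : ℝ}
    (hσ : σ < 0) (u : S → A → ℝ) {θ : Param d} (hθ : θ ∈ PC.Θ) :
    valueGrad M PC σ u θ = gradAt M PC σ θ (smoothedQ M σ u (PC.π θ)) := by
  refine eq_of_linearized M σ (smoothedValue M σ u (PC.π θ)) (PC.isPolicy θ hθ)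
    (valueGrad_eq M PC hσ u hθ) fun s => ?_
  have hV := stateValue_smoothedQ M hσ u (PC.contractive M hθ)
  set Q := smoothedQ M σ u (PC.π θ)
  set V := smoothedValue M σ u (PC.π θ)
  set B := gradB M PC θ Q with hBdef
  set w := softWeight σ V
  set wB := ∑ s', w s' • B s' with hc
  have hX : ∀ s, gradAt M PC σ θ Q s = B s + (M.γ * M.δ / (1 - M.γ)) • wB := fun s => by
    simp only [gradAt, hV]; rfl
  have hw : ∑ s', w s' • gradAt M PC σ θ Q s' = wB + (M.γ * M.δ / (1 - M.γ)) • wB := by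
    simp only [hX, smul_add, Finset.sum_add_distrib, ← Finset.sum_smul]
    rw [(softWeight_mem_stdSimplex σ V).2, one_smul]
  have hP : ∀ a, ∑ s', (M.P s a s').toReal • gradAt M PC σ θ Q s'
      = ∑ s', (M.P s a s').toReal • B s' + (M.γ * M.δ / (1 - M.γ)) • wB := fun a => by
    simp only [hX, smul_add, Finset.sum_add_distrib, ← Finset.sum_smul]
    rw [sum_toReal_pmf, one_smul]
  -- The log-sum-exp part contributes the same vector at every state. Its coefficient `x = γδ / (1 -
  -- γ)` is the solution of `x = γδ + γ x`, which is what makes the formula close.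
  have hL : ∑ a, PC.π θ s a • lookaheadLin M σ V (gradAt M PC σ θ Q) s a
      = (M.γ * (1 - M.δ)) • ∑ a, PC.π θ s a • ∑ s', (M.P s a s').toReal • B s'
        + (M.γ * M.δ / (1 - M.γ)) • wB := by
    have : ∀ a, PC.π θ s a • lookaheadLin M σ V (gradAt M PC σ θ Q) s a
        = (M.γ * (1 - M.δ)) • PC.π θ s a • ∑ s', (M.P s a s').toReal • B s'
          + PC.π θ s a • (M.γ * M.δ / (1 - M.γ)) • wB := fun a => by
      simp only [lookaheadLin]
      rw [hP a, show (∑ s', softWeight σ V s' • gradAt M PC σ θ Q s') = _ from hw]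
      have hγ := M.one_sub_γ_pos.ne'
      match_scalars <;> field_simp
      ring
    simp only [this, Finset.sum_add_distrib, ← Finset.smul_sum, ← Finset.sum_smul]
    rw [(PC.isPolicy θ hθ s).2, one_smul]
  rw [hX s, hL, ← add_assoc]
  congr 1
  exact gradB_eq M PC hθ Q s

theorem gradB_sub (M : CMDP S A) (PC : PolicyClass S A d) (θ : Param d) (Q Q' : S → A → ℝ) (s : S) :
    gradB M PC θ Q s - gradB M PC θ Q' s = gradB M PC θ (Q - Q') s := by
  simp only [gradB, Pi.sub_apply, sub_smul, Finset.sum_sub_distrib, smul_sub]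

theorem norm_gradB_le (M : CMDP S A) (PC : PolicyClass S A d) {θ : Param d} (hθ : θ ∈ PC.Θ)
    (Q : S → A → ℝ) (s : S) :
    ‖gradB M PC θ Q s‖ ≤ 1 / (1 - M.γ + M.γ * M.δ) * (Fintype.card A * ‖Q‖ * PC.k) := by
  have hκ := M.one_sub_discount_pos
  have hk := PC.k_pos
  have := norm_sum_smul_le
    (sum_abs_of_mem_stdSimplex (visitation_mem_stdSimplex M (PC.isPolicy θ hθ) s)).le
    (by positivity) (norm_policyTerm_le PC hθ Q)
  unfold gradB
  rw [norm_smul, Real.norm_of_nonneg (by positivity)]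
  rw [one_mul] at this
  gcongr

/-- The gradient estimate is Lipschitz in the action-value table. -/
theorem exists_gradEstimate_error [Nonempty S] (M : CMDP S A) (PC : PolicyClass S A d) {σ : ℝ}
    (hσ : σ < 0) {u : S → A → ℝ} (hu : ∀ s a, u s a ∈ Set.Icc (0 : ℝ) 1) :
    ∃ K, 0 ≤ K ∧ ∀ θ ∈ PC.Θ, ∀ Q : S → A → ℝ,
      ‖gradEstimate M PC σ θ Q - gradEstimate M PC σ θ (smoothedQ M σ u (PC.π θ))‖
        ≤ K * ‖Q - smoothedQ M σ u (PC.π θ)‖ := by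
  have hκ := M.one_sub_discount_pos
  have hk := PC.k_pos
  have hγ := M.one_sub_γ_pos
  have hCs := Csig_pos M σ
  have hγδ := M.γδ_nonneg
  set D : ℝ := 1 / (1 - M.γ + M.γ * M.δ) * (Fintype.card A * PC.k) with hD
  have hD0 : 0 ≤ D := by positivity
  set c : ℝ := M.γ * M.δ / (1 - M.γ) with hc
  have hc0 : 0 ≤ c := by positivity
  refine ⟨D + c * (D + 4 * |σ| * (D * Csig M σ)), by positivity, fun θ hθ Q => ?_⟩
  set Q' := smoothedQ M σ u (PC.π θ)
  have hQ' : ‖Q'‖ ≤ Csig M σ := norm_smoothedQ_le M hσ hu (PC.isPolicy θ hθ)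
  have hB : ∀ Q s, ‖gradB M PC θ Q s‖ ≤ D * ‖Q‖ := fun Q s =>
    (norm_gradB_le M PC hθ Q s).trans (le_of_eq (by rw [hD]; ring))
  have hBs : ∀ s, ‖gradB M PC θ Q s - gradB M PC θ Q' s‖ ≤ D * ‖Q - Q'‖ := fun s => by
    rw [gradB_sub]; exact hB _ s
  set w := softWeight σ (stateValue (PC.π θ) Q)
  set w' := softWeight σ (stateValue (PC.π θ) Q')
  have hw : ∑ s, |w s - w' s| ≤ 4 * |σ| * ‖Q - Q'‖ :=
    (sum_abs_softWeight_sub_le σ _ _).trans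
      (by gcongr; exact norm_stateValue_sub_le (PC.isPolicy θ hθ) Q Q')
  have key : ∀ s, ‖gradAt M PC σ θ Q s - gradAt M PC σ θ Q' s‖
      ≤ (D + c * (D + 4 * |σ| * (D * Csig M σ))) * ‖Q - Q'‖ := fun s => by
    -- `gradB` is linear in the table, so only the softmin weights contribute a nonlinear error.
    have e : gradAt M PC σ θ Q s - gradAt M PC σ θ Q' s
        = (gradB M PC θ Q s - gradB M PC θ Q' s)
          + c • (∑ s', w s' • (gradB M PC θ Q s' - gradB M PC θ Q' s')
            + ∑ s', (w s' - w' s') • gradB M PC θ Q' s') := by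
      simp only [gradAt, smul_sub, sub_smul, Finset.sum_sub_distrib, smul_add]
      abel
    have t1 : ‖∑ s', w s' • (gradB M PC θ Q s' - gradB M PC θ Q' s')‖ ≤ 1 * (D * ‖Q - Q'‖) :=
      norm_sum_smul_le (sum_abs_of_mem_stdSimplex (softWeight_mem_stdSimplex _ _)).le
        (by positivity) hBs
    have t2 : ‖∑ s', (w s' - w' s') • gradB M PC θ Q' s'‖
        ≤ 4 * |σ| * ‖Q - Q'‖ * (D * Csig M σ) :=
      norm_sum_smul_le hw (by positivity) fun s => (hB Q' s).trans (by gcongr)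
    rw [e]
    have t3 := mul_le_mul_of_nonneg_left ((norm_add_le _ _).trans (add_le_add t1 t2)) hc0
    refine (norm_add_le _ _).trans ?_
    rw [norm_smul, Real.norm_of_nonneg hc0]
    exact (add_le_add (hBs s) t3).trans (le_of_eq (by ring))
  rw [gradEstimate_eq, gradEstimate_eq, ← Finset.sum_sub_distrib]
  simp only [← smul_sub]
  simpa using norm_sum_smul_le (sum_abs_toReal_pmf M.ρ).le (by positivity) key

theorem hasGradientAt_atInitial [Nonempty S] (M : CMDP S A) (PC : PolicyClass S A d) {σ : ℝ}
    (hσ : σ < 0) (u : S → A → ℝ) {θ : Param d} (hθ : θ ∈ PC.Θ) :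
    HasGradientAt (fun y => atInitial M (smoothedValue M σ u (PC.π y)))
      (gradEstimate M PC σ θ (smoothedQ M σ u (PC.π θ))) θ := by
  rw [gradEstimate_eq, ← valueGrad_eq_gradAt M PC hσ u hθ, hasGradientAt_iff_hasFDerivAt, map_sum]
  refine HasFDerivAt.fun_sum fun s _ => ?_
  rw [map_smul]
  exact (hasGradientAt_value M PC hσ u hθ s).hasFDerivAt.const_mul _

theorem norm_gradEstimate_le [Nonempty S] (M : CMDP S A) (PC : PolicyClass S A d) {σ : ℝ}
    (hσ : σ < 0) {u : S → A → ℝ} (hu : ∀ s a, u s a ∈ Set.Icc (0 : ℝ) 1) {θ : Param d}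
    (hθ : θ ∈ PC.Θ) :
    ‖gradEstimate M PC σ θ (smoothedQ M σ u (PC.π θ))‖ ≤ CVsig M PC σ := by
  have h := norm_valueGrad_le M PC hσ hu hθ
  rw [gradEstimate_eq, ← valueGrad_eq_gradAt M PC hσ u hθ]
  refine (norm_sum_smul_le (sum_abs_toReal_pmf M.ρ).le (norm_nonneg _)
    (norm_le_pi_norm (valueGrad M PC σ u θ))).trans ?_
  rwa [one_mul]

theorem exists_lipschitz_gradEstimate [Nonempty S] (M : CMDP S A) (PC : PolicyClass S A d) {σ : ℝ}
    (hσ : σ < 0) {u : S → A → ℝ} (hu : ∀ s a, u s a ∈ Set.Icc (0 : ℝ) 1) :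
    ∃ L, 0 ≤ L ∧ ∀ θ ∈ PC.Θ, ∀ θ' ∈ PC.Θ,
      ‖gradEstimate M PC σ θ (smoothedQ M σ u (PC.π θ))
        - gradEstimate M PC σ θ' (smoothedQ M σ u (PC.π θ'))‖ ≤ L * ‖θ - θ'‖ := by
  obtain ⟨L, hL, h⟩ := exists_lipschitz_valueGrad M PC hσ hu
  refine ⟨L, hL, fun θ hθ θ' hθ' => ?_⟩
  rw [gradEstimate_eq, gradEstimate_eq, ← valueGrad_eq_gradAt M PC hσ u hθ,
    ← valueGrad_eq_gradAt M PC hσ u hθ', ← Finset.sum_sub_distrib]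
  simp only [← smul_sub]
  refine (norm_sum_smul_le (sum_abs_toReal_pmf M.ρ).le (norm_nonneg _)
    (norm_le_pi_norm (valueGrad M PC σ u θ - valueGrad M PC σ u θ'))).trans ?_
  rw [one_mul]
  exact h θ hθ θ' hθ'

/-- The quadratic bound on the first order Taylor remainder of the value on `Θ`. -/
theorem exists_taylor_atInitial [Nonempty S] (M : CMDP S A) (PC : PolicyClass S A d) {σ : ℝ}
    (hσ : σ < 0) {u : S → A → ℝ} (hu : ∀ s a, u s a ∈ Set.Icc (0 : ℝ) 1) :
    ∃ L, 0 ≤ L ∧ ∀ θ ∈ PC.Θ, ∀ θ' ∈ PC.Θ,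
      atInitial M (smoothedValue M σ u (PC.π θ))
        + inner ℝ (gradEstimate M PC σ θ (smoothedQ M σ u (PC.π θ))) (θ' - θ) - L * ‖θ' - θ‖ ^ 2
      ≤ atInitial M (smoothedValue M σ u (PC.π θ')) := by
  obtain ⟨L, hL, h⟩ := exists_lipschitz_gradEstimate M PC hσ hu
  refine ⟨L, hL, fun θ hθ θ' hθ' => ?_⟩
  have hsub : segment ℝ θ θ' ⊆ PC.Θ := PC.convex.segment_subset hθ hθ'
  -- Mean value inequality on the segment only: there the gradient stays within `L ‖θ' - θ‖` of its
  -- value at `θ`.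
  have key := (convex_segment θ θ').norm_image_sub_le_of_norm_hasFDerivWithin_le'
    (f := fun y => atInitial M (smoothedValue M σ u (PC.π y)))
    (f' := fun y => innerSL ℝ (gradEstimate M PC σ y (smoothedQ M σ u (PC.π y))))
    (φ := innerSL ℝ (gradEstimate M PC σ θ (smoothedQ M σ u (PC.π θ)))) (C := L * ‖θ' - θ‖)
    (fun y hy => (hasGradientAt_atInitial M PC hσ u (hsub hy)).hasFDerivAt.hasFDerivWithinAt)
    (fun y hy => by
      rw [← map_sub, innerSL_apply_norm]
      refine (h y (hsub hy) θ hθ).trans (mul_le_mul_of_nonneg_left ?_ hL)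
      obtain ⟨a, b, ha, hb, hab, rfl⟩ := hy
      have : a • θ + b • θ' - θ = b • (θ' - θ) := by
        rw [show a = 1 - b by linarith]; module
      rw [this, norm_smul, Real.norm_of_nonneg hb]
      exact mul_le_of_le_one_left (norm_nonneg _) (by linarith))
    (left_mem_segment ℝ θ θ') (right_mem_segment ℝ θ θ')
  rw [innerSL_apply_apply, Real.norm_eq_abs] at key
  nlinarith [neg_abs_le (atInitial M (smoothedValue M σ u (PC.π θ'))
    - atInitial M (smoothedValue M σ u (PC.π θ))
    - inner ℝ (gradEstimate M PC σ θ (smoothedQ M σ u (PC.π θ))) (θ' - θ))]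

end PolicyGradient

/-! ### Projection to an interval. -/

section Clamp

variable {Λ : ℝ}

theorem clampTo_mem (hΛ : 0 ≤ Λ) (x : ℝ) : clampTo Λ x ∈ Set.Icc 0 Λ :=
  ⟨le_max_left _ _, max_le hΛ (min_le_left _ _)⟩

theorem abs_clampTo_sub_le (x y : ℝ) : |clampTo Λ x - clampTo Λ y| ≤ |x - y| := by
  unfold clampTo
  rw [max_comm 0, max_comm 0, min_comm Λ, min_comm Λ]
  exact (abs_max_sub_max_le_abs _ _ _).trans
    ((abs_min_sub_min_le_max x Λ y Λ).trans (by simp))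

theorem clampTo_cases (hΛ : 0 ≤ Λ) (z : ℝ) :
    (z ≤ 0 ∧ clampTo Λ z = 0) ∨ (0 ≤ z ∧ z ≤ Λ ∧ clampTo Λ z = z) ∨
      (Λ ≤ z ∧ clampTo Λ z = Λ) := by
  unfold clampTo
  rcases le_total z 0 with h | h
  · exact Or.inl ⟨h, by rw [min_eq_right (h.trans hΛ), max_eq_left h]⟩
  · rcases le_total z Λ with h' | h'
    · exact Or.inr (Or.inl ⟨h, h', by rw [min_eq_right h', max_eq_right h]⟩)
    · exact Or.inr (Or.inr ⟨h', by rw [min_eq_left h', max_eq_right hΛ]⟩)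

/-- All points on the ray from the projection of `z` through `z` have that same projection (normal
cone); `a > 1` is allowed. -/
theorem clampTo_combination (hΛ : 0 ≤ Λ) (z : ℝ) {a : ℝ} (ha : 0 ≤ a) :
    clampTo Λ ((1 - a) * clampTo Λ z + a * z) = clampTo Λ z := by
  rcases clampTo_cases hΛ z with ⟨h, e⟩ | ⟨h, h', e⟩ | ⟨h, e⟩ <;> rw [e]
  · have : (1 - a) * 0 + a * z ≤ 0 := by nlinarith
    unfold clampTo
    rw [min_eq_right (this.trans hΛ), max_eq_left this]
  · rw [← e]; congr 1; rw [e]; ring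
  · have : Λ ≤ (1 - a) * Λ + a * z := by nlinarith
    unfold clampTo
    rw [min_eq_left this, max_eq_right hΛ]

theorem sq_clampTo_sub_le (hΛ : 0 ≤ Λ) (z : ℝ) {y : ℝ} (hy : y ∈ Set.Icc 0 Λ) :
    (clampTo Λ z - z) ^ 2 ≤ (y - z) ^ 2 := by
  obtain ⟨h0, h1⟩ := hy
  rcases clampTo_cases hΛ z with ⟨h, e⟩ | ⟨h, h', e⟩ | ⟨h, e⟩ <;> rw [e] <;> nlinarith

theorem abs_clampTo_sub_clampTo_mul_le (hΛ : 0 ≤ Λ) (z : ℝ) {c : ℝ} (hc : 0 ≤ c) (hc1 : c ≤ 1) :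
    |clampTo Λ z - clampTo Λ (c * z)| ≤ (1 - c) * Λ := by
  rcases clampTo_cases hΛ z with ⟨h, e⟩ | ⟨h, h', e⟩ | ⟨h, e⟩ <;>
    rcases clampTo_cases hΛ (c * z) with ⟨k, e'⟩ | ⟨k, k', e'⟩ | ⟨k, e'⟩ <;>
    rw [e, e', abs_le] <;> constructor <;> nlinarith

end Clamp

/-! ### The regularized dual problem and its best response. -/

section DualBestResponse

/-- The minimizer over `[0, Λ]` of `v lam + b lam² / 2`. -/
def lamStar (Λ b v : ℝ) : ℝ := clampTo Λ (-v / b)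

/-- The minimum over `[0, Λ]` of `r + v lam + b lam² / 2`. -/
def regMin (Λ b r v : ℝ) : ℝ := r + v * lamStar Λ b v + b / 2 * lamStar Λ b v ^ 2

variable {Λ b : ℝ}

theorem lamStar_mem (hΛ : 0 ≤ Λ) (b v : ℝ) : lamStar Λ b v ∈ Set.Icc 0 Λ := clampTo_mem hΛ _

/-- After completing the square, minimizing over the interval means projecting the unconstrained
minimizer `-v / b`. -/
theorem regMin_le (hΛ : 0 ≤ Λ) (hb : 0 < b) (r v : ℝ) {y : ℝ} (hy : y ∈ Set.Icc 0 Λ) :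
    regMin Λ b r v ≤ r + v * y + b / 2 * y ^ 2 := by
  have h := sq_clampTo_sub_le hΛ (-v / b) hy
  have e : ∀ x : ℝ, r + v * x + b / 2 * x ^ 2 = r + b / 2 * ((x - -v / b) ^ 2 - (-v / b) ^ 2) :=
    fun x => by field_simp; ring
  unfold regMin lamStar
  rw [e, e]
  have := mul_le_mul_of_nonneg_left h (half_pos hb).le
  linarith

/-- The gradient step moves from the projection along the ray through `-v / b`, so projecting
returns to the same point. -/
theorem lamStar_fixed (hΛ : 0 ≤ Λ) (hb : 0 < b) (v : ℝ) {ξ : ℝ} (hξ : 0 ≤ ξ) :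
    clampTo Λ (lamStar Λ b v - ξ * v - ξ * b * lamStar Λ b v) = lamStar Λ b v := by
  have e : lamStar Λ b v - ξ * v - ξ * b * lamStar Λ b v
      = (1 - ξ * b) * clampTo Λ (-v / b) + ξ * b * (-v / b) := by
    unfold lamStar; field_simp; ring
  rw [e]
  exact clampTo_combination hΛ _ (mul_nonneg hξ hb.le)

theorem abs_lamStar_sub_le (hb : 0 < b) (v v' : ℝ) :
    |lamStar Λ b v - lamStar Λ b v'| ≤ |v - v'| / b := by
  refine (abs_clampTo_sub_le _ _).trans (le_of_eq ?_)
  rw [← sub_div, abs_div, abs_of_pos hb, neg_sub_neg, abs_sub_comm]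

/-- The unconstrained minimizers for `b` and `b'` differ by the factor `b' / b`. This measures how
the best response drifts as the regularization decays. -/
theorem abs_lamStar_sub_lamStar_le (hΛ : 0 ≤ Λ) {b' : ℝ} (hb' : 0 < b') (hbb : b' ≤ b) (v : ℝ) :
    |lamStar Λ b' v - lamStar Λ b v| ≤ (1 - b' / b) * Λ := by
  have hb : 0 < b := hb'.trans_le hbb
  have e : -v / b = b' / b * (-v / b') := by field_simp
  unfold lamStar
  rw [e]
  exact abs_clampTo_sub_clampTo_mul_le hΛ _ (by positivity) ((div_le_one hb).2 hbb)

/-- Use the minimizer for `b'` as a competitor in the problem for `b`. -/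
theorem regMin_mono (hΛ : 0 ≤ Λ) (hb : 0 < b) {b' : ℝ} (hbb : b' ≤ b) (r v : ℝ) :
    regMin Λ b r v ≤ regMin Λ b' r v + (b - b') / 2 * Λ ^ 2 := by
  have hm := lamStar_mem hΛ b' v
  refine (regMin_le hΛ hb r v hm).trans ?_
  unfold regMin
  have : lamStar Λ b' v ^ 2 ≤ Λ ^ 2 := pow_le_pow_left₀ hm.1 hm.2 2
  have := mul_le_mul_of_nonneg_left this (sub_nonneg.2 hbb)
  linarith

theorem abs_regMin_le (hΛ : 0 ≤ Λ) (hb : 0 ≤ b) (r v : ℝ) :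
    |regMin Λ b r v| ≤ |r| + |v| * Λ + b / 2 * Λ ^ 2 := by
  have hm := lamStar_mem hΛ b v
  unfold regMin
  refine (abs_add_three _ _ _).trans ?_
  rw [abs_mul, abs_mul, abs_of_nonneg hm.1, abs_of_nonneg (div_nonneg hb two_pos.le),
    abs_of_nonneg (sq_nonneg (lamStar Λ b v))]
  have := hm.2
  have := hm.1
  gcongr

/-- One step of projected gradient descent on the regularized dual problem. -/
theorem abs_dualStep_sub_lamStar_le (hΛ : 0 ≤ Λ) (hb : 0 < b) {ξ : ℝ} (hξ : 0 ≤ ξ)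
    (hξb : ξ * b ≤ 1) {lam v w e : ℝ} (he : |w - v| ≤ e) :
    |clampTo Λ (lam - ξ * w - ξ * b * lam) - lamStar Λ b v|
      ≤ (1 - ξ * b) * |lam - lamStar Λ b v| + ξ * e := by
  rw [← lamStar_fixed hΛ hb v hξ]
  refine (abs_clampTo_sub_le _ _).trans ?_
  rw [lamStar_fixed hΛ hb v hξ]
  have e1 : lam - ξ * w - ξ * b * lam
      - (lamStar Λ b v - ξ * v - ξ * b * lamStar Λ b v)
      = (1 - ξ * b) * (lam - lamStar Λ b v) + -(ξ * (w - v)) := by ring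
  rw [e1]
  refine (abs_add_le _ _).trans ?_
  rw [abs_mul, abs_of_nonneg (sub_nonneg.2 hξb), abs_neg, abs_mul, abs_of_nonneg hξ]
  gcongr

/-- The residual of the unregularized dual problem. -/
theorem abs_dualResidual_le (hΛ : 0 ≤ Λ) (hb : 0 < b) {ξ : ℝ} (hξ : 0 ≤ ξ)
    (lam v : ℝ) :
    |lam - clampTo Λ (lam - ξ * v)| ≤ 2 * |lam - lamStar Λ b v| + ξ * b * Λ := by
  have hm := lamStar_mem hΛ b v
  have h1 : |lamStar Λ b v - clampTo Λ (lam - ξ * v)| ≤ |lam - lamStar Λ b v| + ξ * b * Λ := by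
    conv_lhs => rw [← lamStar_fixed hΛ hb v hξ]
    refine (abs_clampTo_sub_le _ _).trans ?_
    have e1 : lamStar Λ b v - ξ * v - ξ * b * lamStar Λ b v - (lam - ξ * v)
        = -(lam - lamStar Λ b v) + -(ξ * b * lamStar Λ b v) := by ring
    rw [e1]
    refine (abs_add_le _ _).trans ?_
    rw [abs_neg, abs_neg, abs_of_nonneg (mul_nonneg (mul_nonneg hξ hb.le) hm.1)]
    have := mul_le_mul_of_nonneg_left hm.2 (mul_nonneg hξ hb.le)
    linarith
  have := abs_sub_le lam (lamStar Λ b v) (clampTo Λ (lam - ξ * v))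
  linarith

end DualBestResponse

/-! ### Projection to a closed convex set of parameters. -/

section MetricProjection

variable {d : ℕ} {K : Set (Param d)}

theorem metricProj_spec (hne : K.Nonempty) (hc : IsClosed K) (x : Param d) :
    metricProj K x ∈ K ∧ ∀ z ∈ K, dist x (metricProj K x) ≤ dist x z := by
  obtain ⟨y, hy, h⟩ := hc.exists_infDist_eq_dist hne x
  exact Classical.epsilon_spec (p := fun y => y ∈ K ∧ ∀ z ∈ K, dist x y ≤ dist x z)
    ⟨y, hy, fun z hz => h ▸ Metric.infDist_le_dist_of_mem hz⟩

theorem inner_sub_metricProj_nonpos (hne : K.Nonempty) (hc : IsClosed K) (hK : Convex ℝ K)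
    (x : Param d) {z : Param d} (hz : z ∈ K) :
    inner ℝ (x - metricProj K x) (z - metricProj K x) ≤ 0 := by
  obtain ⟨hm, h⟩ := metricProj_spec hne hc x
  refine (norm_eq_iInf_iff_real_inner_le_zero hK hm).1 ?_ z hz
  have : Nonempty K := ⟨⟨_, hm⟩⟩
  refine le_antisymm (le_ciInf fun w => ?_) (ciInf_le ⟨0, ?_⟩ (⟨_, hm⟩ : K))
  · simpa [dist_eq_norm] using h w w.2
  · rintro _ ⟨w, rfl⟩; exact norm_nonneg _

theorem norm_metricProj_sub_le (hne : K.Nonempty) (hc : IsClosed K) (hK : Convex ℝ K)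
    (x y : Param d) : ‖metricProj K x - metricProj K y‖ ≤ ‖x - y‖ := by
  have h1 := inner_sub_metricProj_nonpos hne hc hK x (metricProj_spec hne hc y).1
  have h2 := inner_sub_metricProj_nonpos hne hc hK y (metricProj_spec hne hc x).1
  set p := metricProj K x
  set q := metricProj K y
  -- Firm nonexpansiveness, the sum of the two variational inequalities.
  have h3 : ‖p - q‖ ^ 2 ≤ inner ℝ (x - y) (p - q) := by
    have e : inner ℝ (x - y) (p - q) - inner ℝ (p - q) (p - q)
        = -(inner ℝ (x - p) (q - p)) - inner ℝ (y - q) (p - q) := by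
      rw [← inner_sub_left, ← inner_neg_right, neg_sub, ← inner_sub_left]
      congr 1; abel
    rw [real_inner_self_eq_norm_sq] at e
    linarith
  have h4 := real_inner_le_norm (x - y) (p - q)
  by_contra hlt
  push Not at hlt
  nlinarith [norm_nonneg (p - q), norm_nonneg (x - y)]

/-- The gain of a projected gradient step. -/
theorem mul_sq_norm_le_inner_of_step (hne : K.Nonempty) (hc : IsClosed K) (hK : Convex ℝ K)
    {x : Param d} (hx : x ∈ K) (g : Param d) {α : ℝ} (hα : 0 < α) :
    α * ‖metricProj K (x + (1 / α) • g) - x‖ ^ 2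
      ≤ inner ℝ g (metricProj K (x + (1 / α) • g) - x) := by
  have h := inner_sub_metricProj_nonpos hne hc hK (x + (1 / α) • g) hx
  set p := metricProj K (x + (1 / α) • g)
  have e : inner ℝ (x + (1 / α) • g - p) (x - p)
      = ‖p - x‖ ^ 2 - 1 / α * inner ℝ g (p - x) := by
    rw [← real_inner_self_eq_norm_sq, ← real_inner_smul_left, ← inner_sub_left, ← neg_sub p x,
      inner_neg_right, ← inner_neg_left]
    congr 1; abel
  rw [e] at h
  have : 1 / α * inner ℝ g (p - x) = inner ℝ g (p - x) / α := by ring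
  rw [this, sub_nonpos, le_div_iff₀ hα] at h
  linarith

end MetricProjection

/-! ### The potential and its decrease in one abstract step. -/

section Potential

variable {E : Type*} [NormedAddCommGroup E] [InnerProductSpace ℝ E]

/-- Envelope argument: insert the new best response into the Taylor bounds and compare it with the
old minimum. Replacing the new best response by the old one in the gradient costs a product of two
terms of order `‖Δ‖`, which is the `C² / b`. -/
theorem regMin_ascent {Λ b L C r r' v v' : ℝ} (hΛ : 0 ≤ Λ) (hb : 0 < b) (hL : 0 ≤ L)
    {g₀ g₁ Δ : E}
    (hr : r + inner ℝ g₀ Δ - L * ‖Δ‖ ^ 2 ≤ r') (hv : v + inner ℝ g₁ Δ - L * ‖Δ‖ ^ 2 ≤ v')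
    (hvC : |v' - v| ≤ C * ‖Δ‖) (hg : ‖g₁‖ ≤ C) :
    regMin Λ b r v + inner ℝ (g₀ + lamStar Λ b v • g₁) Δ - (L * (1 + Λ) + C ^ 2 / b) * ‖Δ‖ ^ 2
      ≤ regMin Λ b r' v' := by
  have hm' := lamStar_mem hΛ b v'
  have h1 := regMin_le hΛ hb r v hm'
  have hdiff : |lamStar Λ b v' - lamStar Λ b v| ≤ C * ‖Δ‖ / b :=
    (abs_lamStar_sub_le hb v' v).trans (by gcongr)
  have h2 : |(lamStar Λ b v' - lamStar Λ b v) * inner ℝ g₁ Δ| ≤ C ^ 2 / b * ‖Δ‖ ^ 2 := by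
    rw [abs_mul]
    calc _ ≤ C * ‖Δ‖ / b * (C * ‖Δ‖) :=
          mul_le_mul hdiff ((abs_real_inner_le_norm _ _).trans (by gcongr)) (abs_nonneg _)
            ((abs_nonneg _).trans hdiff)
      _ = _ := by ring
  have h3 := neg_abs_le ((lamStar Λ b v' - lamStar Λ b v) * inner ℝ g₁ Δ)
  have h4 := mul_le_mul_of_nonneg_left hv hm'.1
  have h5 : lamStar Λ b v' * (L * ‖Δ‖ ^ 2) ≤ Λ * (L * ‖Δ‖ ^ 2) :=
    mul_le_mul_of_nonneg_right hm'.2 (by positivity)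
  rw [inner_add_left, real_inner_smul_left]
  rw [show regMin Λ b r' v' = r' + v' * lamStar Λ b v' + b / 2 * lamStar Λ b v' ^ 2 from rfl]
  nlinarith

/-- The Lyapunov function of the primal-dual algorithm: the negative of the regularized primal
objective plus the squared distance of the dual variable to its best response. -/
def pot (ξ Λ τ r v lam : ℝ) : ℝ :=
  -regMin Λ (19 / 20 * τ / ξ) r v + τ / ξ * (lam - lamStar Λ (19 / 20 * τ / ξ) v) ^ 2

theorem abs_pot_le {ξ Λ τ r v lam R : ℝ} (hξ : 0 < ξ) (hΛ : 0 ≤ Λ) (hτ : 0 ≤ τ) (hτ1 : τ ≤ 1)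
    (hlam : lam ∈ Set.Icc 0 Λ) (hr : |r| ≤ R) (hv : |v| ≤ R) :
    |pot ξ Λ τ r v lam| ≤ R + R * Λ + 2 * Λ ^ 2 / ξ := by
  have hm := lamStar_mem hΛ (19 / 20 * τ / ξ) v
  have h1 := abs_regMin_le hΛ (b := 19 / 20 * τ / ξ) (by positivity) r v
  have h2 : (lam - lamStar Λ (19 / 20 * τ / ξ) v) ^ 2 ≤ Λ ^ 2 := by
    rw [← sq_abs (lam - _)]
    exact pow_le_pow_left₀ (abs_nonneg _)
      (abs_le.2 ⟨by linarith [hlam.1, hm.2], by linarith [hlam.2, hm.1]⟩) 2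
  have h3 : τ / ξ ≤ 1 / ξ := by gcongr
  have h4 : τ / ξ * (lam - lamStar Λ (19 / 20 * τ / ξ) v) ^ 2 ≤ 1 / ξ * Λ ^ 2 := by gcongr
  have h5 : 19 / 20 * τ / ξ / 2 * Λ ^ 2 ≤ 1 / ξ * Λ ^ 2 := by
    refine mul_le_mul_of_nonneg_right ?_ (sq_nonneg Λ)
    rw [show 19 / 20 * τ / ξ / 2 = τ / ξ * (19 / 40) by ring]
    linarith [div_nonneg hτ hξ.le]
  have h6 : |v| * Λ ≤ R * Λ := by gcongr
  unfold pot
  refine (abs_add_le _ _).trans ?_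
  rw [abs_neg, abs_of_nonneg (by positivity : 0 ≤ τ / ξ * (lam - _) ^ 2),
    show 2 * Λ ^ 2 / ξ = 1 / ξ * Λ ^ 2 + 1 / ξ * Λ ^ 2 by ring]
  linarith

/-- Convexity of the square, for a contraction with an additive error. -/
theorem sq_le_of_le_contraction {F F' a y : ℝ} (ha : 0 < a) (ha1 : a ≤ 1) (hF' : 0 ≤ F')
    (h : F' ≤ (1 - a) * F + y) : F' ^ 2 ≤ (1 - a) * F ^ 2 + y ^ 2 / a := by
  have h1 : F' ^ 2 ≤ ((1 - a) * F + y) ^ 2 := pow_le_pow_left₀ hF' h 2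
  have h2 : (1 - a) * F ^ 2 + y ^ 2 / a - ((1 - a) * F + y) ^ 2
      = (1 - a) / a * (a * F - y) ^ 2 := by field_simp; ring
  have h3 : 0 ≤ (1 - a) / a * (a * F - y) ^ 2 :=
    mul_nonneg (div_nonneg (sub_nonneg.2 ha1) ha.le) (sq_nonneg _)
  linarith

theorem sq_add_add_le (x y z : ℝ) : (x + y + z) ^ 2 ≤ 2 * x ^ 2 + 4 * y ^ 2 + 4 * z ^ 2 := by
  nlinarith [sq_nonneg (x - (y + z)), sq_nonneg (y - z)]

theorem sq_add_add_le_three (x y z : ℝ) :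
    (x + y + z) ^ 2 ≤ 3 * x ^ 2 + 3 * y ^ 2 + 3 * z ^ 2 := by
  nlinarith [sq_nonneg (x - y), sq_nonneg (y - z), sq_nonneg (x - z)]

/-- Squaring a contraction of rate `19/20 τ` divides the squared error by that rate; the weight `τ /
ξ` of the potential turns this into a constant. The lower bound on `α τ'²` absorbs the displacement
of the best response due to the primal step into a small part of `α D²`. -/
theorem dualError_sq_le {ξ Λ C α τ τ' F F' D e : ℝ} (hξ : 0 < ξ) (hC : 0 < C)
    (hα0 : 0 < α) (hτ' : 0 < τ') (hττ : τ' ≤ τ) (hτ1 : τ ≤ 1)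
    (hα : 32 * C ^ 2 * ξ ≤ α * τ' ^ 2) (hF'0 : 0 ≤ F')
    (hF' : F' ≤ (1 - 19 / 20 * τ) * F
      + (C * D / (19 / 20 * τ' / ξ) + (1 - τ' / τ) * Λ + ξ * e)) :
    τ' / ξ * F' ^ 2 ≤ τ / ξ * F ^ 2 - 19 / 20 * (τ ^ 2 / ξ * F ^ 2)
      + 1 / 13 * (α * D ^ 2) + 5 / ξ * ((1 - τ' / τ) * Λ) ^ 2 + 5 * ξ * e ^ 2 := by
  have hτ : 0 < τ := hτ'.trans_le hττ
  have hsq := sq_le_of_le_contraction (by positivity) (by linarith) hF'0 hF'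
  have hCb : 2 * (C * D / (19 / 20 * τ' / ξ)) ^ 2 ≤ ξ / 14 * (α * D ^ 2) := by
    have e1 : 2 * (C * D / (19 / 20 * τ' / ξ)) ^ 2
        = 800 / 361 * (C ^ 2 * ξ) * ξ * D ^ 2 / τ' ^ 2 := by field_simp; ring
    rw [e1, div_le_iff₀ (by positivity)]
    have h1 : 800 / 361 * (C ^ 2 * ξ) ≤ 1 / 14 * (α * τ' ^ 2) := by
      have : 0 < C ^ 2 * ξ := by positivity
      linarith
    calc 800 / 361 * (C ^ 2 * ξ) * ξ * D ^ 2 = 800 / 361 * (C ^ 2 * ξ) * (ξ * D ^ 2) := by ring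
      _ ≤ 1 / 14 * (α * τ' ^ 2) * (ξ * D ^ 2) := by gcongr
      _ = _ := by ring
  have hy := sq_add_add_le (C * D / (19 / 20 * τ' / ξ)) ((1 - τ' / τ) * Λ) (ξ * e)
  set Y := (C * D / (19 / 20 * τ' / ξ) + (1 - τ' / τ) * Λ + ξ * e) ^ 2
  have hY : Y ≤ ξ / 14 * (α * D ^ 2) + 4 * ((1 - τ' / τ) * Λ) ^ 2 + 4 * (ξ * e) ^ 2 := by
    linarith
  calc τ' / ξ * F' ^ 2 ≤ τ / ξ * F' ^ 2 := by gcongr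
    _ ≤ τ / ξ * ((1 - 19 / 20 * τ) * F ^ 2 + Y / (19 / 20 * τ)) := by gcongr
    _ = τ / ξ * F ^ 2 - 19 / 20 * (τ ^ 2 / ξ * F ^ 2) + 20 / (19 * ξ) * Y := by field_simp
    _ ≤ τ / ξ * F ^ 2 - 19 / 20 * (τ ^ 2 / ξ * F ^ 2) + 20 / (19 * ξ) *
        (ξ / 14 * (α * D ^ 2) + 4 * ((1 - τ' / τ) * Λ) ^ 2 + 4 * (ξ * e) ^ 2) := by gcongr
    _ = τ / ξ * F ^ 2 - 19 / 20 * (τ ^ 2 / ξ * F ^ 2) + 20 / 266 * (α * D ^ 2)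
        + 80 / 19 * (1 / ξ * ((1 - τ' / τ) * Λ) ^ 2) + 80 / 19 * (ξ * e ^ 2) := by
          field_simp; ring
    _ ≤ _ := by
        have p1 : 0 ≤ α * D ^ 2 := by positivity
        have p2 : 0 ≤ 1 / ξ * ((1 - τ' / τ) * Λ) ^ 2 := by positivity
        have p3 : 0 ≤ ξ * e ^ 2 := by positivity
        rw [show 5 / ξ * ((1 - τ' / τ) * Λ) ^ 2 = 5 * (1 / ξ * ((1 - τ' / τ) * Λ) ^ 2) by ring]
        linarith

/-- Young's inequality: a quarter of the gain `α D²` along the direction actually used pays for its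
deviation from the ideal direction. -/
theorem primalGain_le {α D X Y C F K e : ℝ} (hα : 0 < α) (hX : α * D ^ 2 ≤ X)
    (h : X - Y ≤ (C * F + K * e) * D) :
    3 / 4 * (α * D ^ 2) - 2 * C ^ 2 / α * F ^ 2 - 2 * K ^ 2 / α * e ^ 2 ≤ Y := by
  have t2 : 1 / 4 * (α * D ^ 2) + (C * F + K * e) ^ 2 / α - (C * F + K * e) * D
      = (α * D / 2 - (C * F + K * e)) ^ 2 / α := by field_simp; ring
  have t3 : 0 ≤ (α * D / 2 - (C * F + K * e)) ^ 2 / α := by positivity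
  have t4 : 2 * C ^ 2 / α * F ^ 2 + 2 * K ^ 2 / α * e ^ 2 - (C * F + K * e) ^ 2 / α
      = (C * F - K * e) ^ 2 / α := by ring
  have t5 : 0 ≤ (C * F - K * e) ^ 2 / α := by positivity
  linarith

/-- The weight `τ²` is what the decrease can pay: the primal residual contributes `(α τ²) α D²` with
`α τ²` bounded, and the dual distance contributes `τ² F²`, the order of the decrease in
`dualError_sq_le`. -/
theorem gradientMapping_sq_le {ξ Λ C K κ α τ D F e dual primal : ℝ} (hξ : 0 < ξ)
    (hκ : 0 ≤ κ) (hα : 0 < α) (hτ : 0 < τ) (hτ1 : τ ≤ 1)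
    (hκα : 6 * (κ * (α * τ ^ 2)) ≤ 1) (hκF : κ * (8 / ξ ^ 2 + 12 * C ^ 2) ≤ 1 / (2 * ξ))
    (hdual : |dual| ≤ 1 / ξ * (2 * F + τ * Λ))
    (hprimal : |primal| ≤ α * D + 2 * C * F + K * e) :
    κ * τ ^ 2 * (dual ^ 2 + primal ^ 2) ≤ 1 / 2 * (α * D ^ 2)
      + 1 / 2 * (τ ^ 2 / ξ * F ^ 2) + 2 * κ * (Λ / ξ) ^ 2 * τ ^ 4 + K ^ 2 * (3 * κ) * e ^ 2 := by
  have hdualF : dual ^ 2 ≤ 8 / ξ ^ 2 * F ^ 2 + 2 * (Λ / ξ) ^ 2 * τ ^ 2 := by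
    have t2 : dual ^ 2 ≤ (1 / ξ * (2 * F + τ * Λ)) ^ 2 := by
      rw [← sq_abs]; exact pow_le_pow_left₀ (abs_nonneg _) hdual 2
    have t3 : 8 / ξ ^ 2 * F ^ 2 + 2 * (Λ / ξ) ^ 2 * τ ^ 2 - (1 / ξ * (2 * F + τ * Λ)) ^ 2
        = ((2 * F - τ * Λ) / ξ) ^ 2 := by field_simp; ring
    linarith [sq_nonneg ((2 * F - τ * Λ) / ξ)]
  have hprimF : primal ^ 2 ≤ 3 * α * (α * D ^ 2) + 12 * C ^ 2 * F ^ 2 + 3 * K ^ 2 * e ^ 2 := by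
    have t2 : primal ^ 2 ≤ (α * D + 2 * C * F + K * e) ^ 2 := by
      rw [← sq_abs]; exact pow_le_pow_left₀ (abs_nonneg _) hprimal 2
    have t3 := sq_add_add_le_three (α * D) (2 * C * F) (K * e)
    linarith
  have hτ2 : τ ^ 2 ≤ 1 := pow_le_one₀ hτ.le hτ1
  calc κ * τ ^ 2 * (dual ^ 2 + primal ^ 2)
      ≤ κ * τ ^ 2 * ((8 / ξ ^ 2 * F ^ 2 + 2 * (Λ / ξ) ^ 2 * τ ^ 2)
        + (3 * α * (α * D ^ 2) + 12 * C ^ 2 * F ^ 2 + 3 * K ^ 2 * e ^ 2)) := by gcongr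
    _ = 1 / 2 * (6 * (κ * (α * τ ^ 2))) * (α * D ^ 2)
        + κ * (8 / ξ ^ 2 + 12 * C ^ 2) * (τ ^ 2 * F ^ 2) + 2 * κ * (Λ / ξ) ^ 2 * τ ^ 4
        + K ^ 2 * (3 * κ) * e ^ 2 * τ ^ 2 := by ring
    _ ≤ 1 / 2 * 1 * (α * D ^ 2) + 1 / (2 * ξ) * (τ ^ 2 * F ^ 2) + 2 * κ * (Λ / ξ) ^ 2 * τ ^ 4
        + K ^ 2 * (3 * κ) * e ^ 2 * 1 := by gcongr
    _ = _ := by field_simp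

theorem norm_lagrangianGrad_sub_le {Λ C K e lam' : ℝ} (hlam' : lam' ∈ Set.Icc 0 Λ) (hΛ : 0 ≤ Λ)
    {g₀ g₁ h₀ h₁ : E} (hg : ‖g₁‖ ≤ C) (hh₀ : ‖h₀ - g₀‖ ≤ K * e) (hh₁ : ‖h₁ - g₁‖ ≤ K * e) (y : ℝ) :
    ‖(h₀ + lam' • h₁) - (g₀ + y • g₁)‖ ≤ C * |lam' - y| + K * (1 + Λ) * e := by
  have e1 : (h₀ + lam' • h₁) - (g₀ + y • g₁)
      = (h₀ - g₀) + lam' • (h₁ - g₁) + (lam' - y) • g₁ := by module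
  rw [e1]
  refine norm_add₃_le.trans ?_
  rw [norm_smul, norm_smul, Real.norm_of_nonneg hlam'.1, Real.norm_eq_abs]
  have t1 : lam' * ‖h₁ - g₁‖ ≤ Λ * (K * e) := mul_le_mul hlam'.2 hh₁ (norm_nonneg _) hΛ
  have t2 : |lam' - y| * ‖g₁‖ ≤ |lam' - y| * C := by gcongr
  linarith

/-- The curvature of `regMin` grows only like `1 / τ`, while `α` is at least of order `1 / τ'²`. -/
theorem smoothness_le {ξ Λ C L α τ τ' D : ℝ} (hξ : 0 < ξ) (hα0 : 0 < α) (hC : 0 < C) (hτ' : 0 < τ')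
    (hττ : τ' ≤ τ) (hτ1 : τ ≤ 1) (hα : 32 * C ^ 2 * ξ ≤ α * τ' ^ 2)
    (hαL : 8 * (L * (1 + Λ)) ≤ α) :
    (L * (1 + Λ) + C ^ 2 / (19 / 20 * τ / ξ)) * D ^ 2 ≤ 1 / 6 * (α * D ^ 2) := by
  have hτ : 0 < τ := hτ'.trans_le hττ
  have t : C ^ 2 / (19 / 20 * τ / ξ) ≤ α / 28 := by
    rw [div_le_iff₀ (by positivity), show α / 28 * (19 / 20 * τ / ξ) = 19 / 560 * (α * τ) / ξ by
      ring, le_div_iff₀ hξ]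
    have t1 : α * τ' ^ 2 ≤ α * τ := by
      gcongr
      calc τ' ^ 2 ≤ τ ^ 2 := by gcongr
        _ ≤ τ := by nlinarith
    have : 0 < C ^ 2 * ξ := by positivity
    linarith
  have := mul_le_mul_of_nonneg_right
    (by linarith : L * (1 + Λ) + C ^ 2 / (19 / 20 * τ / ξ) ≤ 1 / 6 * α) (sq_nonneg D)
  linarith

/-- The budget: `3/4 - 1/6 - 1/13` and `19/20 - 1/16` both exceed the `1/2` spent on the gradient
mapping. -/
theorem pot_le_combine {P P' ασ F2 G E1 E2 B B₁ B₂ A₁ A₂ A₃ X Y : ℝ} (hασ : 0 ≤ ασ)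
    (hF2 : 0 ≤ F2) (hdual : Y ≤ X - 19 / 20 * F2 + 1 / 13 * ασ + A₁ + A₂)
    (hgain : P + (3 / 4 * ασ - E1 - E2) - 1 / 6 * ασ ≤ P' + B)
    (hE1 : E1 ≤ 1 / 16 * F2) (hE2 : E2 ≤ A₃)
    (hG : G ≤ 1 / 2 * ασ + 1 / 2 * F2 + B₁ + B₂) :
    -P' + Y + G ≤ -P + X + (A₃ + B₂ + A₂) + B₁ + (B + A₁) := by
  linarith

/-- One iteration decreases the potential, up to the errors, by a multiple of the squared norm of
the gradient mapping, whose components are `dual` and `primal`. -/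
theorem pot_step {ξ Λ C L K κ α τ τ' : ℝ} (hξ : 0 < ξ) (hΛ : 0 ≤ Λ) (hC : 0 < C) (hL : 0 ≤ L)
    (hκ : 0 ≤ κ) (hτ' : 0 < τ') (hττ : τ' ≤ τ) (hτ1 : τ ≤ 1)
    (hα : 32 * C ^ 2 * ξ ≤ α * τ' ^ 2) (hαL : 8 * (L * (1 + Λ)) ≤ α)
    (hκα : 6 * (κ * (α * τ ^ 2)) ≤ 1) (hκF : κ * (8 / ξ ^ 2 + 12 * C ^ 2) ≤ 1 / (2 * ξ))
    {r r' v v' w lam e dual primal : ℝ} {g₀ g₁ h₀ h₁ Δ : E}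
    (hw : |w - v| ≤ e)
    (hr : r + inner ℝ g₀ Δ - L * ‖Δ‖ ^ 2 ≤ r') (hv : v + inner ℝ g₁ Δ - L * ‖Δ‖ ^ 2 ≤ v')
    (hvC : |v' - v| ≤ C * ‖Δ‖) (hg : ‖g₁‖ ≤ C) (hh₀ : ‖h₀ - g₀‖ ≤ K * e) (hh₁ : ‖h₁ - g₁‖ ≤ K * e)
    {lam' : ℝ}
    (hlam' : lam' = clampTo Λ (lam - ξ * w - ξ * (19 / 20 * τ / ξ) * lam))
    (hstep : α * ‖Δ‖ ^ 2 ≤ inner ℝ (h₀ + lam' • h₁) Δ)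
    (hdual : |dual| ≤ 1 / ξ * |lam - clampTo Λ (lam - ξ * v)|)
    (hprimal : |primal| ≤ α * ‖Δ‖ + ‖(h₀ + lam' • h₁) - (g₀ + lam • g₁)‖) :
    pot ξ Λ τ' r' v' lam' + κ * τ ^ 2 * (dual ^ 2 + primal ^ 2) ≤ pot ξ Λ τ r v lam
      + ((K * (1 + Λ) + C * ξ) ^ 2 * (1 / (16 * C ^ 2 * ξ) + 3 * κ) + 5 * ξ) * e ^ 2
      + 2 * κ * (Λ / ξ) ^ 2 * τ ^ 4 + Λ ^ 2 / ξ * ((τ - τ') + 5 * (1 - τ' / τ) ^ 2) := by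
  have hτ : 0 < τ := hτ'.trans_le hττ
  have hb : 0 < 19 / 20 * τ / ξ := by positivity
  have hb' : 0 < 19 / 20 * τ' / ξ := by positivity
  have hbb : 19 / 20 * τ' / ξ ≤ 19 / 20 * τ / ξ := by gcongr
  have hξb : ξ * (19 / 20 * τ / ξ) = 19 / 20 * τ := by field_simp
  have hα0 : 0 < α := by
    by_contra hneg
    push Not at hneg
    have : α * τ' ^ 2 ≤ 0 := mul_nonpos_of_nonpos_of_nonneg hneg (sq_nonneg _)
    have : 0 < 32 * C ^ 2 * ξ := by positivity
    linarith
  have hαξ : 32 * C ^ 2 * ξ ≤ α := hα.trans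
    (mul_le_of_le_one_right hα0.le (pow_le_one₀ hτ'.le (hττ.trans hτ1)))
  have hlam'_mem : lam' ∈ Set.Icc 0 Λ := hlam' ▸ clampTo_mem hΛ _
  obtain ⟨ls, hls⟩ : ∃ y, y = lamStar Λ (19 / 20 * τ / ξ) v := ⟨_, rfl⟩
  obtain ⟨ls', hls'⟩ : ∃ y, y = lamStar Λ (19 / 20 * τ' / ξ) v' := ⟨_, rfl⟩
  have hE : |lam' - ls| ≤ (1 - 19 / 20 * τ) * |lam - ls| + ξ * e := by
    have := abs_dualStep_sub_lamStar_le hΛ hb hξ.le (by rw [hξb]; linarith) (lam := lam) hw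
    rw [← hlam', hξb, ← hls] at this
    exact this
  have hF' : |lam' - ls'| ≤ (1 - 19 / 20 * τ) * |lam - ls|
      + (C * ‖Δ‖ / (19 / 20 * τ' / ξ) + (1 - τ' / τ) * Λ + ξ * e) := by
    have t1 := abs_lamStar_sub_lamStar_le hΛ hb' hbb v
    rw [show 19 / 20 * τ' / ξ / (19 / 20 * τ / ξ) = τ' / τ by field_simp, ← hls,
      abs_sub_comm] at t1
    have t2 : |lamStar Λ (19 / 20 * τ' / ξ) v - ls'| ≤ C * ‖Δ‖ / (19 / 20 * τ' / ξ) := by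
      rw [hls']
      refine (abs_lamStar_sub_le hb' v v').trans ?_
      rw [abs_sub_comm]; gcongr
    have t3 := abs_sub_le lam' ls ls'
    have t4 := abs_sub_le ls (lamStar Λ (19 / 20 * τ' / ξ) v) ls'
    linarith
  have hτF : 0 ≤ τ * |lam - ls| := by positivity
  -- The direction is off by the gradient errors, weighted by at most `1 + Λ`, and by `C` times the
  -- error `ξ e` of the dual step.
  obtain ⟨K', hK'⟩ : ∃ y, y = K * (1 + Λ) + C * ξ := ⟨_, rfl⟩
  have herr1 : ‖(h₀ + lam' • h₁) - (g₀ + ls • g₁)‖ ≤ C * |lam - ls| + K' * e := by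
    refine (norm_lagrangianGrad_sub_le hlam'_mem hΛ hg hh₀ hh₁ ls).trans ?_
    have := mul_le_mul_of_nonneg_left (by linarith : |lam' - ls| ≤ |lam - ls| + ξ * e) hC.le
    rw [hK']; linarith
  have herr2 : ‖(h₀ + lam' • h₁) - (g₀ + lam • g₁)‖ ≤ 2 * C * |lam - ls| + K' * e := by
    have t : |lam' - lam| ≤ 2 * |lam - ls| + ξ * e := by
      have := abs_sub_le lam' ls lam
      rw [abs_sub_comm ls lam] at this
      linarith
    refine (norm_lagrangianGrad_sub_le hlam'_mem hΛ hg hh₀ hh₁ lam).trans ?_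
    have := mul_le_mul_of_nonneg_left t hC.le
    rw [hK']; linarith
  have hdualF : |dual| ≤ 1 / ξ * (2 * |lam - ls| + τ * Λ) := by
    refine hdual.trans (mul_le_mul_of_nonneg_left ?_ (by positivity))
    have t := abs_dualResidual_le hΛ hb hξ.le lam v
    rw [hξb, ← hls] at t
    have : 0 ≤ τ * Λ := by positivity
    linarith
  -- The ascent of `regMin` is governed by the gradient at the best response `ls`, whereas the
  -- gradient mapping uses the gradient at `lam`; hence the two error bounds `herr1` and `herr2`.
  have hgain := primalGain_le hα0 hstep (Y := inner ℝ (g₀ + ls • g₁) Δ) (C := C) (K := K')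
    (F := |lam - ls|) (e := e) (by
      rw [← inner_sub_left]
      exact (real_inner_le_norm _ _).trans (by gcongr))
  have hasc := regMin_ascent hΛ hb hL hr hv hvC hg
  rw [← hls] at hasc
  have hmono := regMin_mono hΛ hb hbb r' v'
  have hsmooth := smoothness_le (D := ‖Δ‖) hξ hα0 hC hτ' hττ hτ1 hα hαL
  have hbL : (19 / 20 * τ / ξ - 19 / 20 * τ' / ξ) / 2 * Λ ^ 2 ≤ Λ ^ 2 / ξ * (τ - τ') := by
    rw [show (19 / 20 * τ / ξ - 19 / 20 * τ' / ξ) / 2 * Λ ^ 2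
      = 19 / 40 * (Λ ^ 2 / ξ * (τ - τ')) by ring]
    have : 0 ≤ Λ ^ 2 / ξ * (τ - τ') := mul_nonneg (by positivity) (sub_nonneg.2 hττ)
    linarith
  have hCα : 2 * C ^ 2 / α * |lam - ls| ^ 2 ≤ 1 / 16 * (τ ^ 2 / ξ * |lam - ls| ^ 2) := by
    rw [← mul_assoc]
    refine mul_le_mul_of_nonneg_right ?_ (sq_nonneg _)
    rw [div_le_iff₀ hα0, show 1 / 16 * (τ ^ 2 / ξ) * α = α * τ ^ 2 / (16 * ξ) by ring,
      le_div_iff₀ (by positivity)]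
    have : α * τ' ^ 2 ≤ α * τ ^ 2 := by gcongr
    linarith
  have hK'α : 2 * K' ^ 2 / α * e ^ 2 ≤ K' ^ 2 * (1 / (16 * C ^ 2 * ξ)) * e ^ 2 := by
    refine mul_le_mul_of_nonneg_right ?_ (sq_nonneg _)
    rw [show K' ^ 2 * (1 / (16 * C ^ 2 * ξ)) = 2 * K' ^ 2 / (32 * C ^ 2 * ξ) by field_simp; ring]
    gcongr
  have hprimalF : |primal| ≤ α * ‖Δ‖ + 2 * C * |lam - ls| + K' * e := by linarith
  have key := pot_le_combine (by positivity) (by positivity)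
    (dualError_sq_le hξ hC hα0 hτ' hττ hτ1 hα (abs_nonneg _) hF')
    (P := regMin Λ (19 / 20 * τ / ξ) r v) (P' := regMin Λ (19 / 20 * τ' / ξ) r' v')
    (B := Λ ^ 2 / ξ * (τ - τ')) (by linarith) hCα hK'α
    (gradientMapping_sq_le hξ hκ hα0 hτ hτ1 hκα hκF hdualF hprimalF)
  rw [sq_abs, sq_abs] at key
  unfold pot
  rw [← hls, ← hls', ← hK']
  refine key.trans (le_of_eq ?_)
  ring

end Potential

/-! ### Step sizes: orders of magnitude and drift. -/

section StepSizes

/-- The decay `t^{-1/4}` of the regularization. -/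
def tauSeq (t : ℕ) : ℝ := ((t : ℝ) ^ (1 / 4 : ℝ))⁻¹

theorem tauSeq_pos {t : ℕ} (ht : 1 ≤ t) : 0 < tauSeq t := by
  have : (0 : ℝ) < t := by exact_mod_cast ht
  unfold tauSeq; positivity

theorem tauSeq_pow_four (t : ℕ) : tauSeq t ^ 4 = (t : ℝ)⁻¹ := by
  unfold tauSeq
  rw [inv_pow, ← Real.rpow_natCast, ← Real.rpow_mul (Nat.cast_nonneg t)]
  norm_num

theorem tauSeq_sq (t : ℕ) : tauSeq t ^ 2 = 1 / Real.sqrt t := by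
  unfold tauSeq
  rw [inv_pow, ← Real.rpow_natCast, ← Real.rpow_mul (Nat.cast_nonneg t), Real.sqrt_eq_rpow,
    one_div]
  norm_num

theorem tauSeq_le_one {t : ℕ} (ht : 1 ≤ t) : tauSeq t ≤ 1 := by
  have h1 : (1 : ℝ) ≤ t := by exact_mod_cast ht
  exact inv_le_one_of_one_le₀ (Real.one_le_rpow h1 (by norm_num))

theorem tauSeq_succ_le {t : ℕ} (ht : 1 ≤ t) : tauSeq (t + 1) ≤ tauSeq t := by
  have : (0 : ℝ) < t := by exact_mod_cast ht
  unfold tauSeq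
  gcongr
  exact_mod_cast Nat.le_succ t

theorem tauSeq_ratio_pow_four {t : ℕ} (ht : 1 ≤ t) :
    (tauSeq (t + 1) / tauSeq t) ^ 4 = t / (t + 1) := by
  have : (0 : ℝ) < t := by exact_mod_cast ht
  rw [div_pow, tauSeq_pow_four, tauSeq_pow_four]
  push_cast
  field_simp

/-- The ratio is at most one, hence at least its fourth power, which is `t / (t + 1)`. -/
theorem one_sub_tauSeq_ratio_le {t : ℕ} (ht : 1 ≤ t) :
    1 - tauSeq (t + 1) / tauSeq t ≤ 1 / t := by
  have h0 : (0 : ℝ) < t := by exact_mod_cast ht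
  have hr0 : 0 ≤ tauSeq (t + 1) / tauSeq t :=
    div_nonneg (tauSeq_pos (by omega)).le (tauSeq_pos ht).le
  have hr1 : tauSeq (t + 1) / tauSeq t ≤ 1 := (div_le_one (tauSeq_pos ht)).2 (tauSeq_succ_le ht)
  have h := pow_le_of_le_one hr0 hr1 (n := 4) (by norm_num)
  rw [tauSeq_ratio_pow_four ht] at h
  have : 1 - (t : ℝ) / (t + 1) ≤ 1 / t := by
    rw [one_sub_div (by positivity), div_le_div_iff₀ (by positivity) h0]
    linarith
  linarith

theorem one_sub_tauSeq_ratio_nonneg {t : ℕ} (ht : 1 ≤ t) :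
    0 ≤ 1 - tauSeq (t + 1) / tauSeq t :=
  sub_nonneg.2 ((div_le_one (tauSeq_pos ht)).2 (tauSeq_succ_le ht))

theorem tauSeq_ratio_sq_ge {t : ℕ} (ht : 1 ≤ t) : tauSeq t ^ 2 ≤ 2 * tauSeq (t + 1) ^ 2 := by
  have h0 : (1 : ℝ) ≤ t := by exact_mod_cast ht
  have h1 := tauSeq_pos ht
  have h2 := tauSeq_pos (t := t + 1) (by omega)
  have e1 := tauSeq_pow_four t
  have e2 := tauSeq_pow_four (t + 1)
  push_cast at e2
  have h4 : (tauSeq t ^ 2) ^ 2 ≤ (2 * tauSeq (t + 1) ^ 2) ^ 2 := by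
    rw [← pow_mul, mul_pow, ← pow_mul, e1, e2, ← div_eq_mul_inv, le_div_iff₀ (by positivity),
      inv_mul_le_iff₀ (by positivity)]
    linarith
  exact le_of_sq_le_sq h4 (by positivity)
where
  le_of_sq_le_sq {a b : ℝ} (h : a ^ 2 ≤ b ^ 2) (hb : 0 ≤ b) : a ≤ b := abs_le_of_sq_le_sq' h hb |>.2

variable {S A : Type*} [Fintype S] [Fintype A] {d : ℕ}

theorem bSeq_eq (p : StepParams) (t : ℕ) : bSeq p t = 19 / 20 * tauSeq t / p.ξ := by
  unfold bSeq tauSeq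
  simp only [div_eq_mul_inv, mul_inv]
  ring

theorem Lsig_nonneg [Nonempty S] [Nonempty A] (M : CMDP S A) (PC : PolicyClass S A d) (σ : ℝ) :
    0 ≤ Lsig M PC σ := by
  have hl : 0 ≤ PC.l := by
    obtain ⟨θ, hθ⟩ := PC.nonempty
    exact (norm_nonneg _).trans (PC.smooth θ hθ (Classical.arbitrary S) (Classical.arbitrary A))
  have h1 := M.one_sub_γ_pos
  have h2 := M.γδ_nonneg
  have h3 : 0 < 1 - M.γ + M.γ * M.δ := by linarith
  have h4 := Csig_pos M σ
  have h5 := CVsig_pos M PC σ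
  have h6 := PC.k_pos
  have h7 : 0 ≤ 1 - M.δ := sub_nonneg.2 M.δ_mem.2
  have h8 := M.γ_mem.1
  have h9 : 0 ≤ kB M PC σ := by unfold kB; positivity
  unfold Lsig
  positivity

/-- The lower bound imposed on `ξ` enters the convergence proof only through these two consequences.
-/
theorem StepParams.Admissible.bounds [Nonempty S] [Nonempty A] {p : StepParams} {M : CMDP S A}
    {PC : PolicyClass S A d} {σ : ℝ} (hp : p.Admissible M PC σ) :
    0 < p.ξ ∧ p.ν ≤ p.ξ * CVsig M PC σ ^ 2 := by
  obtain ⟨h1, h2, h3, h4⟩ := hp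
  have hC := CVsig_pos M PC σ
  have hL := Lsig_nonneg M PC σ
  have hnum : 0 < 2 * p.ν + (1 + p.Λ) * Lsig M PC σ := by positivity
  refine ⟨(div_pos hnum (by positivity)).trans h4, ?_⟩
  rw [div_lt_iff₀ (by positivity)] at h4
  have : 0 ≤ (1 + p.Λ) * Lsig M PC σ := by positivity
  linarith

theorem alphaSeq_eq (p : StepParams) (M : CMDP S A) (PC : PolicyClass S A d)
    (σ : ℝ) (t : ℕ) : alphaSeq M PC σ p t = p.ξ * CVsig M PC σ ^ 2 - p.ν
      + 6400 / 361 * p.τ * (CVsig M PC σ ^ 2 * p.ξ) / tauSeq (t + 1) ^ 2 := by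
  have h := tauSeq_pos (t := t + 1) (by omega)
  unfold alphaSeq muSeq
  rw [bSeq_eq]
  field_simp
  ring

/-- Here `2 < τ` is used: `2 · 6400 / 361` exceeds `32`, and the remaining part of `α_t` is
nonnegative. -/
theorem alphaSeq_lower [Nonempty S] [Nonempty A] {M : CMDP S A} {PC : PolicyClass S A d} {σ : ℝ}
    {p : StepParams} (hp : p.Admissible M PC σ) (t : ℕ) :
    32 * CVsig M PC σ ^ 2 * p.ξ ≤ alphaSeq M PC σ p t * tauSeq (t + 1) ^ 2 := by
  obtain ⟨hξ, hνξ⟩ := hp.bounds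
  have hτ' := tauSeq_pos (t := t + 1) (by omega)
  have hC := CVsig_pos M PC σ
  have e : alphaSeq M PC σ p t * tauSeq (t + 1) ^ 2
      = (p.ξ * CVsig M PC σ ^ 2 - p.ν) * tauSeq (t + 1) ^ 2
        + 6400 / 361 * p.τ * (CVsig M PC σ ^ 2 * p.ξ) := by
    rw [alphaSeq_eq, add_mul, div_mul_cancel₀ _ (by positivity)]
  have h1 : 0 ≤ (p.ξ * CVsig M PC σ ^ 2 - p.ν) * tauSeq (t + 1) ^ 2 :=
    mul_nonneg (by linarith) (by positivity)
  have h2 := mul_le_mul_of_nonneg_right hp.2.2.1.le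
    (by positivity : 0 ≤ CVsig M PC σ ^ 2 * p.ξ)
  have h3 : 0 < CVsig M PC σ ^ 2 * p.ξ := by positivity
  rw [e]; linarith

theorem alphaSeq_pos [Nonempty S] [Nonempty A] {M : CMDP S A} {PC : PolicyClass S A d} {σ : ℝ}
    {p : StepParams} (hp : p.Admissible M PC σ) (t : ℕ) : 0 < alphaSeq M PC σ p t := by
  have hC := CVsig_pos M PC σ
  have hξ := hp.bounds.1
  have hτ' := tauSeq_pos (t := t + 1) (by omega)
  have : 0 < alphaSeq M PC σ p t * tauSeq (t + 1) ^ 2 :=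
    lt_of_lt_of_le (by positivity) (alphaSeq_lower hp t)
  exact pos_of_mul_pos_left this (by positivity)

/-- `α_t` is built from `b_{t+1}`, so the comparison with time `t` loses a factor two from
`tauSeq_ratio_sq_ge`; `12800 / 361` is below `40`. -/
theorem alphaSeq_upper [Nonempty S] [Nonempty A] {M : CMDP S A} {PC : PolicyClass S A d} {σ : ℝ}
    {p : StepParams} (hp : p.Admissible M PC σ) {t : ℕ} (ht : 1 ≤ t) :
    alphaSeq M PC σ p t * tauSeq t ^ 2
      ≤ p.ξ * CVsig M PC σ ^ 2 + 40 * p.τ * (CVsig M PC σ ^ 2 * p.ξ) := by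
  obtain ⟨hξ, hνξ⟩ := hp.bounds
  obtain ⟨-, hν, hτ, -⟩ := hp
  have hτ' := tauSeq_pos (t := t + 1) (by omega)
  have hC := CVsig_pos M PC σ
  set C := CVsig M PC σ
  have e : alphaSeq M PC σ p t * tauSeq t ^ 2 = (p.ξ * C ^ 2 - p.ν) * tauSeq t ^ 2
      + 6400 / 361 * p.τ * (C ^ 2 * p.ξ) * (tauSeq t ^ 2 / tauSeq (t + 1) ^ 2) := by
    rw [alphaSeq_eq, add_mul, div_mul_eq_mul_div, mul_div_assoc]
  have h1 : (p.ξ * C ^ 2 - p.ν) * tauSeq t ^ 2 ≤ p.ξ * C ^ 2 * 1 := by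
    have : tauSeq t ^ 2 ≤ 1 := pow_le_one₀ (tauSeq_pos ht).le (tauSeq_le_one ht)
    gcongr
    linarith
  have h2 : tauSeq t ^ 2 / tauSeq (t + 1) ^ 2 ≤ 2 :=
    (div_le_iff₀ (by positivity)).2 (tauSeq_ratio_sq_ge ht)
  have h3 : 6400 / 361 * p.τ * (C ^ 2 * p.ξ) * (tauSeq t ^ 2 / tauSeq (t + 1) ^ 2)
      ≤ 6400 / 361 * p.τ * (C ^ 2 * p.ξ) * 2 := by gcongr
  have h4 : 0 < p.τ * (C ^ 2 * p.ξ) := by positivity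
  rw [e]; linarith

/-- The drift of the regularization is of order `1 / t`. -/
theorem regularization_drift_le {κ Λ ξ : ℝ} (hξ : 0 < ξ) {t : ℕ} (ht : 1 ≤ t) :
    2 * κ * (Λ / ξ) ^ 2 * (t : ℝ)⁻¹ + Λ ^ 2 / ξ *
      (tauSeq t - tauSeq (t + 1) + 5 * (1 - tauSeq (t + 1) / tauSeq t) ^ 2)
      ≤ (2 * κ * (Λ / ξ) ^ 2 + 6 * (Λ ^ 2 / ξ)) / t := by
  have htR : (1 : ℝ) ≤ t := by exact_mod_cast ht
  have hr0 := one_sub_tauSeq_ratio_nonneg ht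
  have hr1 := one_sub_tauSeq_ratio_le ht
  have f1 : tauSeq t - tauSeq (t + 1) ≤ 1 / t := by
    have h1 := tauSeq_pos ht
    have : tauSeq t - tauSeq (t + 1) = tauSeq t * (1 - tauSeq (t + 1) / tauSeq t) := by field_simp
    rw [this]
    exact (mul_le_of_le_one_left hr0 (tauSeq_le_one ht)).trans hr1
  have f2 : (1 - tauSeq (t + 1) / tauSeq t) ^ 2 ≤ 1 / t := by
    have : (1 : ℝ) / t ≤ 1 := (div_le_one (by linarith)).2 htR
    nlinarith
  have : Λ ^ 2 / ξ * (tauSeq t - tauSeq (t + 1) + 5 * (1 - tauSeq (t + 1) / tauSeq t) ^ 2)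
      ≤ Λ ^ 2 / ξ * (6 * (1 / t)) := by
    gcongr
    linarith
  calc _ ≤ 2 * κ * (Λ / ξ) ^ 2 * (t : ℝ)⁻¹ + Λ ^ 2 / ξ * (6 * (1 / t)) := by linarith
    _ = _ := by ring

end StepSizes

/-! ### The decrease of the potential along the algorithm. -/

section AlgorithmStep

variable {S A : Type*} [Fintype S] [Fintype A] [DecidableEq S] {d : ℕ}

/-- The potential of the primal-dual algorithm at the iterate `x` before iteration `t`. -/
def potAt (M : CMDP S A) (PC : PolicyClass S A d) (σ : ℝ) (p : StepParams) (t : ℕ)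
    (x : ℝ × Param d) : ℝ :=
  pot p.ξ p.Λ (tauSeq t) (atInitial M (smoothedValue M σ M.r (PC.π x.2)))
    (atInitial M (smoothedValue M σ M.c (PC.π x.2)) - M.b) x.1

/-- The feasible pairs of a dual and a primal variable. -/
def Feasible (PC : PolicyClass S A d) (p : StepParams) (x : ℝ × Param d) : Prop :=
  x.1 ∈ Set.Icc 0 p.Λ ∧ x.2 ∈ PC.Θ

theorem feasible_rpdStep (M : CMDP S A) (PC : PolicyClass S A d) (σ : ℝ) {p : StepParams}
    (hΛ : 0 ≤ p.Λ) (t : ℕ) (x : ℝ × Param d) (Qr Qc : S → A → ℝ) :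
    Feasible PC p (rpdStep M PC σ p t x Qr Qc) :=
  ⟨clampTo_mem hΛ _, (metricProj_spec PC.nonempty PC.closed _).1⟩

theorem abs_potAt_le [Nonempty S] (M : CMDP S A) (PC : PolicyClass S A d) {σ : ℝ} (hσ : σ < 0)
    {p : StepParams} (hξ : 0 < p.ξ) (hΛ : 0 ≤ p.Λ) {t : ℕ} (ht : 1 ≤ t) {x : ℝ × Param d}
    (hx : Feasible PC p x) :
    |potAt M PC σ p t x| ≤ (Csig M σ + |M.b|) + (Csig M σ + |M.b|) * p.Λ
      + 2 * p.Λ ^ 2 / p.ξ := by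
  have h : ∀ u : S → A → ℝ, (∀ s a, u s a ∈ Set.Icc (0 : ℝ) 1) →
      |atInitial M (smoothedValue M σ u (PC.π x.2))| ≤ Csig M σ := fun u hu =>
    (abs_atInitial_le M _).trans (norm_smoothedValue_le M hσ hu (PC.isPolicy _ hx.2))
  refine abs_pot_le hξ hΛ (tauSeq_pos ht).le (tauSeq_le_one ht) hx.1 ?_ ?_
  · linarith [h M.r M.r_mem, abs_nonneg M.b]
  · exact (abs_sub _ _).trans (by linarith [h M.c M.c_mem])

theorem deriv_lagrangian (M : CMDP S A) (PC : PolicyClass S A d) (σ : ℝ) (θ : Param d) (y : ℝ) :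
    deriv (fun y => lagrangian M PC σ θ y) y
      = atInitial M (smoothedValue M σ M.c (PC.π θ)) - M.b := by
  unfold lagrangian
  simp

theorem gradient_lagrangian [Nonempty S] (M : CMDP S A) (PC : PolicyClass S A d) {σ : ℝ}
    (hσ : σ < 0) {θ : Param d} (hθ : θ ∈ PC.Θ) (lam : ℝ) :
    gradient (fun y => lagrangian M PC σ y lam) θ
      = gradEstimate M PC σ θ (smoothedQ M σ M.r (PC.π θ))
        + lam • gradEstimate M PC σ θ (smoothedQ M σ M.c (PC.π θ)) := by
  refine HasGradientAt.gradient ?_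
  rw [hasGradientAt_iff_hasFDerivAt, map_add, map_smul]
  exact (hasGradientAt_atInitial M PC hσ M.r hθ).hasFDerivAt.add
    (((hasGradientAt_atInitial M PC hσ M.c hθ).hasFDerivAt.sub_const M.b).const_mul lam)

theorem one_div_beta (p : StepParams) : 1 / beta p = p.ξ := by simp [beta]

theorem abs_gradMap_fst (M : CMDP S A) (PC : PolicyClass S A d) (σ : ℝ) {p : StepParams}
    (hξ : 0 < p.ξ) (t : ℕ) (x : ℝ × Param d) :
    |(gradMap M PC σ p t x).fst| = 1 / p.ξ * |x.1 - clampTo p.Λ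
      (x.1 - p.ξ * (atInitial M (smoothedValue M σ M.c (PC.π x.2)) - M.b))| := by
  have : (gradMap M PC σ p t x).fst = 1 / p.ξ * (x.1 - clampTo p.Λ
      (x.1 - p.ξ * (atInitial M (smoothedValue M σ M.c (PC.π x.2)) - M.b))) := by
    simp only [gradMap]
    rw [deriv_lagrangian, one_div_beta]
    rfl
  rw [this, abs_mul, abs_of_pos (by positivity : 0 < 1 / p.ξ)]

/-- Nonexpansiveness of the projection compares the exact gradient mapping with the step along any
other direction `g`; the factors `α` and `1 / α` cancel in the error. -/
theorem norm_gradMap_snd_le [Nonempty S] (M : CMDP S A) (PC : PolicyClass S A d) {σ : ℝ}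
    (hσ : σ < 0) {p : StepParams} {t : ℕ} (hα : 0 < alphaSeq M PC σ p t) {x : ℝ × Param d}
    (hx : x.2 ∈ PC.Θ) (g : Param d) :
    ‖(gradMap M PC σ p t x).snd‖ ≤ alphaSeq M PC σ p t *
        ‖metricProj PC.Θ (x.2 + (1 / alphaSeq M PC σ p t) • g) - x.2‖
      + ‖g - (gradEstimate M PC σ x.2 (smoothedQ M σ M.r (PC.π x.2))
        + x.1 • gradEstimate M PC σ x.2 (smoothedQ M σ M.c (PC.π x.2)))‖ := by
  rw [← gradient_lagrangian M PC hσ hx]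
  have e1 : (gradMap M PC σ p t x).snd = alphaSeq M PC σ p t • (x.2 - metricProj PC.Θ
      (x.2 + (1 / alphaSeq M PC σ p t) • gradient (fun y => lagrangian M PC σ y x.1) x.2)) := rfl
  rw [e1]
  generalize gradient (fun y => lagrangian M PC σ y x.1) x.2 = G
  revert hα
  generalize alphaSeq M PC σ p t = α
  intro hα
  have e2 : x.2 - metricProj PC.Θ (x.2 + (1 / α) • G)
      = -(metricProj PC.Θ (x.2 + (1 / α) • g) - x.2)
        + (metricProj PC.Θ (x.2 + (1 / α) • g) - metricProj PC.Θ (x.2 + (1 / α) • G)) := by abel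
  have e3 : ‖metricProj PC.Θ (x.2 + (1 / α) • g) - metricProj PC.Θ (x.2 + (1 / α) • G)‖
      ≤ 1 / α * ‖g - G‖ := by
    refine (norm_metricProj_sub_le PC.nonempty PC.closed PC.convex _ _).trans (le_of_eq ?_)
    rw [add_sub_add_left_eq_sub, ← smul_sub, norm_smul, Real.norm_of_nonneg (by positivity)]
  rw [e2, norm_smul, Real.norm_of_nonneg hα.le]
  calc _ ≤ α * (‖metricProj PC.Θ (x.2 + (1 / α) • g) - x.2‖ + 1 / α * ‖g - G‖) := by
        refine mul_le_mul_of_nonneg_left ((norm_add_le _ _).trans ?_) hα.le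
        rw [norm_neg]
        exact add_le_add le_rfl e3
    _ = _ := by field_simp

/-- `pot_step` with `g₀, g₁` the exact gradients, `h₀, h₁` their estimates, `w` the estimated
constraint slack and `Δ` the primal displacement. -/
theorem potAt_rpdStep_le [Nonempty S] [Nonempty A] (M : CMDP S A) (PC : PolicyClass S A d)
    {σ : ℝ} (hσ : σ < 0) {p : StepParams} (hp : p.Admissible M PC σ) {L K κ : ℝ}
    (hL : 0 ≤ L) (hK : 0 ≤ K) (hκ : 0 ≤ κ)
    (hT : ∀ u : S → A → ℝ, u = M.r ∨ u = M.c → ∀ θ ∈ PC.Θ, ∀ θ' ∈ PC.Θ,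
      atInitial M (smoothedValue M σ u (PC.π θ))
        + inner ℝ (gradEstimate M PC σ θ (smoothedQ M σ u (PC.π θ))) (θ' - θ) - L * ‖θ' - θ‖ ^ 2
      ≤ atInitial M (smoothedValue M σ u (PC.π θ')))
    (hE : ∀ u : S → A → ℝ, u = M.r ∨ u = M.c → ∀ θ ∈ PC.Θ, ∀ Q : S → A → ℝ,
      ‖gradEstimate M PC σ θ Q - gradEstimate M PC σ θ (smoothedQ M σ u (PC.π θ))‖
        ≤ K * ‖Q - smoothedQ M σ u (PC.π θ)‖)
    (hκα : 6 * (κ * (p.ξ * CVsig M PC σ ^ 2 + 40 * p.τ * (CVsig M PC σ ^ 2 * p.ξ))) ≤ 1)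
    (hκF : κ * (8 / p.ξ ^ 2 + 12 * CVsig M PC σ ^ 2) ≤ 1 / (2 * p.ξ))
    {t : ℕ} (ht : 1 ≤ t) (hαL : 8 * (L * (1 + p.Λ)) ≤ alphaSeq M PC σ p t)
    {x : ℝ × Param d} (hx : Feasible PC p x) (Qr Qc : S → A → ℝ) {e : ℝ}
    (her : ‖Qr - smoothedQ M σ M.r (PC.π x.2)‖ ≤ e)
    (hec : ‖Qc - smoothedQ M σ M.c (PC.π x.2)‖ ≤ e) :
    potAt M PC σ p (t + 1) (rpdStep M PC σ p t x Qr Qc)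
      + κ / Real.sqrt t * ‖gradMap M PC σ p t x‖ ^ 2 ≤ potAt M PC σ p t x
      + ((K * (1 + p.Λ) + CVsig M PC σ * p.ξ) ^ 2 *
        (1 / (16 * CVsig M PC σ ^ 2 * p.ξ) + 3 * κ) + 5 * p.ξ) * e ^ 2
      + (2 * κ * (p.Λ / p.ξ) ^ 2 + 6 * (p.Λ ^ 2 / p.ξ)) / t := by
  have hξ := hp.bounds.1
  have hΛ := hp.1
  have hC := CVsig_pos M PC σ
  have hα0 := alphaSeq_pos hp t
  have hlo := alphaSeq_lower hp t
  have hκα' : 6 * (κ * (alphaSeq M PC σ p t * tauSeq t ^ 2)) ≤ 1 := by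
    have := mul_le_mul_of_nonneg_left (alphaSeq_upper hp ht) hκ
    linarith
  have hx' : Feasible PC p (rpdStep M PC σ p t x Qr Qc) := feasible_rpdStep M PC σ hΛ.le t x Qr Qc
  obtain ⟨x', hx'_def⟩ : ∃ y, y = rpdStep M PC σ p t x Qr Qc := ⟨_, rfl⟩
  have hlam' : x'.1 = clampTo p.Λ (x.1 - p.ξ * (atInitial M (stateValue (PC.π x.2) Qc) - M.b)
      - p.ξ * (19 / 20 * tauSeq t / p.ξ) * x.1) := by
    rw [hx'_def]
    simp only [rpdStep]
    rw [one_div_beta, bSeq_eq, div_eq_mul_one_div _ (beta p), one_div_beta, mul_comm _ p.ξ]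
  have hprim : x'.2 = metricProj PC.Θ (x.2 + (1 / alphaSeq M PC σ p t) •
      (gradEstimate M PC σ x.2 Qr + x'.1 • gradEstimate M PC σ x.2 Qc)) := by
    rw [hx'_def]; rfl
  rw [← hx'_def] at hx' ⊢
  have hw : |(atInitial M (stateValue (PC.π x.2) Qc) - M.b)
      - (atInitial M (smoothedValue M σ M.c (PC.π x.2)) - M.b)| ≤ e := by
    rw [sub_sub_sub_cancel_right, ← stateValue_smoothedQ M hσ M.c (PC.contractive M hx.2)]
    exact ((abs_atInitial_sub_le M _ _).trans
      (norm_stateValue_sub_le (PC.isPolicy _ hx.2) _ _)).trans hec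
  have hTr := hT M.r (Or.inl rfl) x.2 hx.2 x'.2 hx'.2
  have hTc := hT M.c (Or.inr rfl) x.2 hx.2 x'.2 hx'.2
  have hgm : ‖gradMap M PC σ p t x‖ ^ 2 = (gradMap M PC σ p t x).fst ^ 2
      + ‖(gradMap M PC σ p t x).snd‖ ^ 2 := by
    rw [WithLp.prod_norm_sq_eq_of_L2, Real.norm_eq_abs, sq_abs]
  have hstep := mul_sq_norm_le_inner_of_step PC.nonempty PC.closed PC.convex hx.2
    (gradEstimate M PC σ x.2 Qr + x'.1 • gradEstimate M PC σ x.2 Qc) hα0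
  have hprimal := norm_gradMap_snd_le M PC hσ hα0 hx.2
    (gradEstimate M PC σ x.2 Qr + x'.1 • gradEstimate M PC σ x.2 Qc)
  rw [← hprim] at hstep hprimal
  rw [← abs_norm] at hprimal
  have hvC : |(atInitial M (smoothedValue M σ M.c (PC.π x'.2)) - M.b)
      - (atInitial M (smoothedValue M σ M.c (PC.π x.2)) - M.b)|
      ≤ CVsig M PC σ * ‖x'.2 - x.2‖ := by
    rw [sub_sub_sub_cancel_right]
    exact (abs_atInitial_sub_le M _ _).trans (norm_value_sub_le M PC hσ M.c_mem hx'.2 hx.2)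
  have key := pot_step hξ hΛ.le hC hL hκ (tauSeq_pos (t := t + 1) (by omega)) (tauSeq_succ_le ht)
    (tauSeq_le_one ht) hlo hαL hκα' hκF hw hTr (by linarith) hvC
    (norm_gradEstimate_le M PC hσ M.c_mem hx.2)
    ((hE M.r (Or.inl rfl) x.2 hx.2 Qr).trans (mul_le_mul_of_nonneg_left her hK))
    ((hE M.c (Or.inr rfl) x.2 hx.2 Qc).trans (mul_le_mul_of_nonneg_left hec hK))
    hlam' hstep (abs_gradMap_fst M PC σ hξ t x).le hprimal
  rw [← hgm, tauSeq_sq, mul_one_div, tauSeq_pow_four] at key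
  have hdr := regularization_drift_le (κ := κ) (Λ := p.Λ) hξ ht
  unfold potAt
  linarith

/-- The Taylor constant obtained above is not compared with `Lsig`. Since `α_t` tends to infinity it
dominates any fixed smoothness constant from some `t₀` on, and earlier iterations need no decrease.
-/
theorem exists_pot_decrease [Nonempty S] [Nonempty A] (M : CMDP S A) (PC : PolicyClass S A d)
    {σ : ℝ} (hσ : σ < 0) {p : StepParams} (hp : p.Admissible M PC σ) :
    ∃ (κ C₁ : ℝ) (t₀ : ℕ), 0 < κ ∧ 0 ≤ C₁ ∧ 1 ≤ t₀ ∧ ∀ t, t₀ ≤ t → ∀ x, Feasible PC p x →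
      ∀ Qr Qc : S → A → ℝ,
        potAt M PC σ p (t + 1) (rpdStep M PC σ p t x Qr Qc)
            + κ / Real.sqrt t * ‖gradMap M PC σ p t x‖ ^ 2
          ≤ potAt M PC σ p t x + C₁ * (‖Qr - smoothedQ M σ M.r (PC.π x.2)‖ ^ 2
            + ‖Qc - smoothedQ M σ M.c (PC.π x.2)‖ ^ 2) + C₁ / t := by
  have hξ := hp.bounds.1
  have hΛ := hp.1
  have hτ : 0 < p.τ := by linarith [hp.2.2.1]
  have hC := CVsig_pos M PC σ
  obtain ⟨Lr, hLr, hTr⟩ := exists_taylor_atInitial M PC hσ M.r_mem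
  obtain ⟨Lc, hLc, hTc⟩ := exists_taylor_atInitial M PC hσ M.c_mem
  obtain ⟨Kr, hKr, hEr⟩ := exists_gradEstimate_error M PC hσ M.r_mem
  obtain ⟨Kc, hKc, hEc⟩ := exists_gradEstimate_error M PC hσ M.c_mem
  have hL : 0 ≤ max Lr Lc := hLr.trans (le_max_left _ _)
  have hK : 0 ≤ max Kr Kc := hKr.trans (le_max_left _ _)
  obtain ⟨Ahi, hAhi⟩ : ∃ y, y = p.ξ * CVsig M PC σ ^ 2 + 40 * p.τ * (CVsig M PC σ ^ 2 * p.ξ) :=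
    ⟨_, rfl⟩
  have hAhi0 : 0 < Ahi := by rw [hAhi]; positivity
  obtain ⟨H, hH⟩ : ∃ y, y = 8 / p.ξ ^ 2 + 12 * CVsig M PC σ ^ 2 := ⟨_, rfl⟩
  have hH0 : 0 < H := by rw [hH]; positivity
  -- The two entries are what the primal and the dual absorption in `gradientMapping_sq_le` require.
  obtain ⟨κ, hκ⟩ : ∃ y, y = min (1 / (6 * Ahi)) (1 / (2 * p.ξ * H)) := ⟨_, rfl⟩
  have hκ0 : 0 < κ := by rw [hκ]; positivity
  have hκα : 6 * (κ * Ahi) ≤ 1 := by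
    have h1 : κ * Ahi ≤ 1 / (6 * Ahi) * Ahi := by rw [hκ]; gcongr; exact min_le_left _ _
    rw [show 1 / (6 * Ahi) * Ahi = 1 / 6 by field_simp] at h1
    linarith
  have hκF : κ * H ≤ 1 / (2 * p.ξ) := by
    calc κ * H ≤ 1 / (2 * p.ξ * H) * H := by rw [hκ]; gcongr; exact min_le_right _ _
      _ = _ := by field_simp
  obtain ⟨D₁, hD₁⟩ : ∃ y, y = (max Kr Kc * (1 + p.Λ) + CVsig M PC σ * p.ξ) ^ 2 *
        (1 / (16 * CVsig M PC σ ^ 2 * p.ξ) + 3 * κ) + 5 * p.ξ := ⟨_, rfl⟩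
  have hD₁0 : 0 ≤ D₁ := by rw [hD₁]; positivity
  obtain ⟨D₂, hD₂⟩ : ∃ y, y = 2 * κ * (p.Λ / p.ξ) ^ 2 + 6 * (p.Λ ^ 2 / p.ξ) := ⟨_, rfl⟩
  have hD₂0 : 0 ≤ D₂ := by rw [hD₂]; positivity
  -- By `alphaSeq_lower`, `α_t` is at least `32 C² ξ √(t + 1)`; past `n₀` this exceeds the
  -- smoothness requirement.
  obtain ⟨n₀, hn₀⟩ :=
    exists_nat_ge ((8 * (max Lr Lc * (1 + p.Λ)) / (32 * CVsig M PC σ ^ 2 * p.ξ)) ^ 2)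
  refine ⟨κ, D₁ + D₂, n₀ + 1, hκ0, by positivity, by omega, fun t ht x hx Qr Qc => ?_⟩
  have hαL : 8 * (max Lr Lc * (1 + p.Λ)) ≤ alphaSeq M PC σ p t := by
    have hα := alphaSeq_lower hp t
    have h1 : 8 * (max Lr Lc * (1 + p.Λ)) / (32 * CVsig M PC σ ^ 2 * p.ξ)
        ≤ Real.sqrt (t + 1 : ℕ) := by
      refine Real.le_sqrt_of_sq_le (hn₀.trans ?_)
      exact_mod_cast (by omega : n₀ ≤ t + 1)
    rw [div_le_iff₀ (by positivity)] at h1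
    refine h1.trans ?_
    rw [tauSeq_sq, mul_one_div, le_div_iff₀ (by positivity)] at hα
    linarith
  have key := potAt_rpdStep_le M PC hσ hp hL hK hκ0.le
    (fun u hu θ hθ θ' hθ' => by
      rcases hu with rfl | rfl
      · refine le_trans ?_ (hTr θ hθ θ' hθ'); gcongr; exact le_max_left _ _
      · refine le_trans ?_ (hTc θ hθ θ' hθ'); gcongr; exact le_max_right _ _)
    (fun u hu θ hθ Q => by
      rcases hu with rfl | rfl
      · refine (hEr θ hθ Q).trans ?_; gcongr; exact le_max_left _ _
      · refine (hEc θ hθ Q).trans ?_; gcongr; exact le_max_right _ _)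
    (by rw [← hAhi]; exact hκα) (by rw [← hH]; exact hκF) (by omega) hαL hx Qr Qc
    (le_max_left _ _) (le_max_right _ _)
  rw [← hD₁, ← hD₂] at key
  refine key.trans ?_
  generalize ‖Qr - smoothedQ M σ M.r (PC.π x.2)‖ = er
  generalize ‖Qc - smoothedQ M σ M.c (PC.π x.2)‖ = ec
  have hesq : max er ec ^ 2 ≤ er ^ 2 + ec ^ 2 := by
    rcases max_cases er ec with ⟨h, -⟩ | ⟨h, -⟩ <;> rw [h] <;>
      linarith [sq_nonneg er, sq_nonneg ec]
  have f4 : D₁ * max er ec ^ 2 ≤ (D₁ + D₂) * (er ^ 2 + ec ^ 2) := by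
    gcongr; linarith
  have f5 : D₂ / (t : ℝ) ≤ (D₁ + D₂) / t := by gcongr; linarith
  linarith

end AlgorithmStep

/-! ### Sums over the second half of the horizon; accuracy and iteration count. -/

section Horizon

theorem sqrt_div_three_le_sum {T : ℕ} (hT : 2 ≤ T) :
    Real.sqrt T / 3 ≤ ∑ t ∈ Finset.Ico ((T + 1) / 2) T, 1 / Real.sqrt t := by
  have hT0 : (0 : ℝ) < T := by exact_mod_cast (by omega : 0 < T)
  have hs : 0 < Real.sqrt T := Real.sqrt_pos.2 hT0
  have h1 : ∀ t ∈ Finset.Ico ((T + 1) / 2) T, 1 / Real.sqrt T ≤ 1 / Real.sqrt t := fun t ht => by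
    rw [Finset.mem_Ico] at ht
    have : (0 : ℝ) < t := by exact_mod_cast (by omega : 0 < t)
    have := Real.sqrt_pos.2 this
    gcongr
    exact ht.2.le
  refine le_trans ?_ (Finset.card_nsmul_le_sum _ _ _ h1)
  rw [Nat.card_Ico, nsmul_eq_mul]
  have h2 : (T : ℝ) / 3 ≤ ((T - (T + 1) / 2 : ℕ) : ℝ) := by
    rw [div_le_iff₀ (by norm_num)]
    exact_mod_cast (by omega : T ≤ (T - (T + 1) / 2) * 3)
  calc Real.sqrt T / 3 = (T : ℝ) / 3 * (1 / Real.sqrt T) := by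
        have := Real.mul_self_sqrt hT0.le
        field_simp
        linarith
    _ ≤ _ := by gcongr

/-- Starting at half the horizon keeps the harmonic sum bounded, where a sum from `1` would cost a
logarithm. -/
theorem sum_inv_Ico_le {T n : ℕ} (hT : 2 ≤ T) (hn : n ≤ T + 1) :
    ∑ t ∈ Finset.Ico ((T + 1) / 2) n, 1 / (t : ℝ) ≤ 2 := by
  have hN : (0 : ℝ) < ((T + 1) / 2 : ℕ) := by exact_mod_cast (by omega : 0 < (T + 1) / 2)
  have h1 : ∀ t ∈ Finset.Ico ((T + 1) / 2) n, 1 / (t : ℝ) ≤ 1 / ((T + 1) / 2 : ℕ) :=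
    fun t ht => by
      rw [Finset.mem_Ico] at ht
      have : (((T + 1) / 2 : ℕ) : ℝ) ≤ t := by exact_mod_cast ht.1
      gcongr
  refine (Finset.sum_le_card_nsmul _ _ _ h1).trans ?_
  rw [Nat.card_Ico, nsmul_eq_mul, mul_one_div, div_le_iff₀ hN]
  exact_mod_cast (by omega : n - (T + 1) / 2 ≤ 2 * ((T + 1) / 2))

theorem le_numIter (C ε : ℝ) : C / ε ^ 4 ≤ numIter C ε := Nat.le_ceil _

theorem two_le_numIter {C ε : ℝ} {t₀ : ℕ} (hC : (2 * t₀ + 2 : ℝ) ≤ C) (hε : 0 < ε) (hε1 : ε ≤ 1) :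
    2 * t₀ + 2 ≤ numIter C ε := by
  have h1 : C ≤ C / ε ^ 4 := by
    rw [le_div_iff₀ (by positivity)]
    have hC0 : 0 ≤ C := le_trans (by positivity) hC
    exact mul_le_of_le_one_right hC0 (pow_le_one₀ hε.le hε1)
  have : ((2 * t₀ + 2 : ℕ) : ℝ) ≤ numIter C ε := by
    push_cast; exact hC.trans (h1.trans (le_numIter C ε))
  exact_mod_cast this

theorem le_mul_sqrt_numIter {C ε κ R : ℝ} (hκ : 0 < κ) (hε : 0 < ε)
    (hC : (3 * R / κ) ^ 2 ≤ C) : R ≤ ε ^ 2 * (κ * (Real.sqrt (numIter C ε) / 3)) := by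
  have h1 : 3 * R / κ / ε ^ 2 ≤ Real.sqrt (numIter C ε) := by
    refine Real.le_sqrt_of_sq_le (le_trans ?_ (le_numIter C ε))
    rw [div_pow, ← pow_mul]
    gcongr
  calc R = ε ^ 2 * (κ * (3 * R / κ / ε ^ 2 / 3)) := by field_simp
    _ ≤ _ := by gcongr

theorem estAccuracy_one_pos {ε : ℝ} (hε : 0 < ε) {t : ℕ} (ht : 1 ≤ t) : 0 < estAccuracy 1 ε t := by
  have : (0 : ℝ) < t := by exact_mod_cast ht
  unfold estAccuracy; positivity

theorem sq_estAccuracy_one (ε : ℝ) (t : ℕ) :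
    estAccuracy 1 ε t ^ 2 = ε ^ 4 / (t : ℝ) ^ (3 / 2 : ℝ) := by
  unfold estAccuracy
  rw [div_pow, ← Real.rpow_natCast ((t : ℝ) ^ (3 / 4 : ℝ)), ← Real.rpow_mul (Nat.cast_nonneg t)]
  norm_num
  ring

/-- The squared accuracy is `ε⁴ / t^{3/2}`; only this weaker bound, the order of the regularization
drift, is needed. -/
theorem sq_estAccuracy_one_le {ε : ℝ} (hε : 0 < ε) (hε1 : ε ≤ 1) {t : ℕ} (ht : 1 ≤ t) :
    estAccuracy 1 ε t ^ 2 ≤ 1 / t := by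
  have h1 : (1 : ℝ) ≤ t := by exact_mod_cast ht
  rw [sq_estAccuracy_one]
  have h2 : (t : ℝ) ≤ (t : ℝ) ^ (3 / 2 : ℝ) := by
    conv_lhs => rw [← Real.rpow_one (t : ℝ)]
    exact Real.rpow_le_rpow_of_exponent_le h1 (by norm_num)
  have h3 : ε ^ 4 ≤ 1 := pow_le_one₀ hε.le hε1
  gcongr

end Horizon

/-! ### Convergence with estimates of prescribed accuracy. -/

section Deterministic

variable {S A : Type*} [Fintype S] [Fintype A] [DecidableEq S] {d : ℕ}

/-- Convergence of the primal-dual algorithm with estimates of accuracy `ε_est`. -/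
theorem exists_small_gradMap [Nonempty S] (M : CMDP S A) (PC : PolicyClass S A d)
    {σ : ℝ} {p : StepParams} (hΛ : 0 ≤ p.Λ) {κ C₁ B CT : ℝ} {t₀ : ℕ}
    (hκ : 0 < κ) (hC₁ : 0 ≤ C₁) (ht₀ : 1 ≤ t₀)
    (hpot : ∀ t, 1 ≤ t → ∀ x, Feasible PC p x → |potAt M PC σ p t x| ≤ B)
    (hdec : ∀ t, t₀ ≤ t → ∀ x, Feasible PC p x → ∀ Qr Qc : S → A → ℝ,
        potAt M PC σ p (t + 1) (rpdStep M PC σ p t x Qr Qc)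
            + κ / Real.sqrt t * ‖gradMap M PC σ p t x‖ ^ 2
          ≤ potAt M PC σ p t x + C₁ * (‖Qr - smoothedQ M σ M.r (PC.π x.2)‖ ^ 2
            + ‖Qc - smoothedQ M σ M.c (PC.π x.2)‖ ^ 2) + C₁ / t)
    (hCT : (2 * t₀ + 2 : ℝ) ≤ CT) (hCT' : (3 * (2 * B + 6 * C₁ + 1) / κ) ^ 2 ≤ CT)
    {ε : ℝ} (hε : 0 < ε) (hε1 : ε ≤ 1) (x : ℕ → ℝ × Param d) (Qr Qc : ℕ → S → A → ℝ)
    (hx1 : Feasible PC p (x 1))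
    (hrun : ∀ t, 1 ≤ t → t < numIter CT ε →
      ‖Qr t - smoothedQ M σ M.r (PC.π (x t).2)‖ ≤ estAccuracy 1 ε t ∧
      ‖Qc t - smoothedQ M σ M.c (PC.π (x t).2)‖ ≤ estAccuracy 1 ε t ∧
      x (t + 1) = rpdStep M PC σ p t (x t) (Qr t) (Qc t)) :
    ∃ t, 1 ≤ t ∧ t ≤ numIter CT ε ∧ ‖gradMap M PC σ p t (x t)‖ ≤ ε := by
  have hT := two_le_numIter hCT hε hε1
  have hR := le_mul_sqrt_numIter (R := 2 * B + 6 * C₁ + 1) hκ hε hCT'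
  set T := numIter CT ε
  set N := (T + 1) / 2 with hN
  have hfeas : ∀ t, 1 ≤ t → t ≤ T → Feasible PC p (x t) := by
    intro t ht
    induction t, ht using Nat.le_induction with
    | base => exact fun _ => hx1
    | succ t ht _ =>
      intro hle
      rw [(hrun t ht (by omega)).2.2]
      exact feasible_rpdStep M PC σ hΛ t _ _ _
  -- Telescoping begins at `N ≥ t₀`, guaranteed by `2 t₀ + 2 ≤ T`. The factor `3` collects the two
  -- estimation errors and the drift, each of order `1 / t`.
  have tele : ∀ n, N ≤ n → n ≤ T → potAt M PC σ p n (x n)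
      + ∑ t ∈ Finset.Ico N n, κ / Real.sqrt t * ‖gradMap M PC σ p t (x t)‖ ^ 2
      ≤ potAt M PC σ p N (x N) + 3 * C₁ * ∑ t ∈ Finset.Ico N n, 1 / (t : ℝ) := by
    intro n hn
    induction n, hn using Nat.le_induction with
    | base => intro _; simp
    | succ n hn ih =>
      intro hle
      have hn1 : 1 ≤ n := by omega
      obtain ⟨h1, h2, h3⟩ := hrun n hn1 (by omega)
      have h := hdec n (by omega) (x n) (hfeas n hn1 (by omega)) (Qr n) (Qc n)
      rw [← h3] at h
      have hacc := sq_estAccuracy_one_le hε hε1 hn1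
      have q1 := pow_le_pow_left₀ (norm_nonneg _) h1 2
      have q2 := pow_le_pow_left₀ (norm_nonneg _) h2 2
      have q3 := mul_le_mul_of_nonneg_left
        (by linarith : ‖Qr n - smoothedQ M σ M.r (PC.π (x n).2)‖ ^ 2
          + ‖Qc n - smoothedQ M σ M.c (PC.π (x n).2)‖ ^ 2 ≤ 2 * (1 / (n : ℝ))) hC₁
      have q4 : C₁ / (n : ℝ) = C₁ * (1 / n) := by ring
      rw [Finset.sum_Ico_succ_top hn, Finset.sum_Ico_succ_top hn]
      linarith [ih (by omega)]
  by_contra hcon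
  push Not at hcon
  have h1 := tele T (by omega) le_rfl
  have h2 := sum_inv_Ico_le (T := T) (n := T) (by omega) (by omega)
  have b1 := abs_le.1 (hpot T (by omega) _ (hfeas T (by omega) le_rfl))
  have b2 := abs_le.1 (hpot N (by omega) _ (hfeas N (by omega) (by omega)))
  have h3 : ε ^ 2 * (κ * (Real.sqrt T / 3))
      ≤ ∑ t ∈ Finset.Ico N T, κ / Real.sqrt t * ‖gradMap M PC σ p t (x t)‖ ^ 2 := by
    calc ε ^ 2 * (κ * (Real.sqrt T / 3))
        ≤ ε ^ 2 * (κ * ∑ t ∈ Finset.Ico N T, 1 / Real.sqrt t) := by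
          gcongr; exact sqrt_div_three_le_sum (by omega)
      _ = ∑ t ∈ Finset.Ico N T, κ / Real.sqrt t * ε ^ 2 := by
          rw [Finset.mul_sum, Finset.mul_sum]
          exact Finset.sum_congr rfl fun t _ => by ring
      _ ≤ _ := by
          refine Finset.sum_le_sum fun t ht => ?_
          rw [Finset.mem_Ico] at ht
          have := hcon t (by omega) (by omega)
          gcongr
  have h4 := mul_le_mul_of_nonneg_left h2 (by positivity : 0 ≤ 3 * C₁)
  -- The sum is at most `2B + 6C₁`, while the choice of `CT` makes it at least `2B + 6C₁ + 1`.
  linarith [b1.1, b2.2]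

end Deterministic

/-! ### Expectations under finitely supported laws. -/

section Expectation

variable {α β : Type*}

theorem expect_eq_sum {μ : PMF α} {s : Finset α} (hs : μ.support ⊆ s) (f : α → ℝ) :
    expect μ f = ∑ x ∈ s, (μ x).toReal * f x := by
  refine tsum_eq_sum fun x hx => ?_
  have : μ x = 0 := by
    by_contra h
    exact hx (hs ((PMF.mem_support_iff _ _).2 h))
  rw [this, ENNReal.toReal_zero, zero_mul]

theorem expect_eq_sum_support {μ : PMF α} (h : μ.support.Finite) (f : α → ℝ) :
    expect μ f = ∑ x ∈ h.toFinset, (μ x).toReal * f x :=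
  expect_eq_sum (by simp) f

theorem expect_fintype [Fintype α] (μ : PMF α) (f : α → ℝ) :
    expect μ f = ∑ x, (μ x).toReal * f x :=
  expect_eq_sum (by simp) f

theorem expect_pure (a : α) (f : α → ℝ) : expect (PMF.pure a) f = f a := by
  rw [expect_eq_sum (s := {a}) (by simp)]
  simp

theorem finite_support_bind {μ : PMF α} {ν : α → PMF β} (hμ : μ.support.Finite)
    (hν : ∀ a ∈ μ.support, (ν a).support.Finite) : (μ.bind ν).support.Finite := by
  rw [PMF.support_bind]
  exact hμ.biUnion hν

theorem sum_toReal_support {μ : PMF α} (h : μ.support.Finite) :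
    ∑ x ∈ h.toFinset, (μ x).toReal = 1 := by
  have h1 : ∑ x ∈ h.toFinset, μ x = 1 := by
    rw [← μ.tsum_coe]
    refine (tsum_eq_sum fun x hx => ?_).symm
    by_contra h'
    exact hx (h.mem_toFinset.2 ((PMF.mem_support_iff _ _).2 h'))
  rw [← ENNReal.toReal_sum fun i _ => μ.apply_ne_top i, h1, ENNReal.toReal_one]

/-- The tower property. With finite supports it is an exchange of finite sums, and no integrability
enters. -/
theorem expect_bind {μ : PMF α} {ν : α → PMF β} (hμ : μ.support.Finite)
    (hν : ∀ a ∈ μ.support, (ν a).support.Finite) (f : β → ℝ) :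
    expect (μ.bind ν) f = expect μ fun a => expect (ν a) f := by
  classical
  set s := hμ.toFinset with hs
  set t := (finite_support_bind hμ hν).toFinset with ht
  have hsub : ∀ a ∈ s, (ν a).support ⊆ t := fun a ha b hb => by
    rw [ht, Set.Finite.coe_toFinset, PMF.support_bind]
    exact Set.mem_biUnion (hμ.mem_toFinset.1 ha) hb
  have hbind : ∀ b, (μ.bind ν b).toReal = ∑ a ∈ s, (μ a).toReal * (ν a b).toReal := fun b => by
    rw [PMF.bind_apply, tsum_eq_sum (s := s) fun a ha => ?_, ENNReal.toReal_sum fun a _ =>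
      ENNReal.mul_ne_top (μ.apply_ne_top a) ((ν a).apply_ne_top b)]
    · simp only [ENNReal.toReal_mul]
    · have : μ a = 0 := by
        by_contra h
        exact ha (hμ.mem_toFinset.2 ((PMF.mem_support_iff _ _).2 h))
      rw [this, zero_mul]
  rw [expect_eq_sum_support (finite_support_bind hμ hν), expect_eq_sum_support hμ]
  simp only [hbind, Finset.sum_mul]
  rw [Finset.sum_comm]
  refine Finset.sum_congr rfl fun a ha => ?_
  rw [expect_eq_sum (hsub a ha), Finset.mul_sum]
  exact Finset.sum_congr rfl fun b _ => by ring

theorem expect_map {μ : PMF α} (hμ : μ.support.Finite) (g : α → β) (f : β → ℝ) :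
    expect (μ.map g) f = expect μ fun a => f (g a) := by
  rw [← PMF.bind_pure_comp, expect_bind hμ fun a _ => by simp]
  simp only [Function.comp, expect_pure]

theorem expect_mono {μ : PMF α} (hμ : μ.support.Finite) {f g : α → ℝ}
    (h : ∀ a ∈ μ.support, f a ≤ g a) : expect μ f ≤ expect μ g := by
  rw [expect_eq_sum_support hμ, expect_eq_sum_support hμ]
  exact Finset.sum_le_sum fun a ha =>
    mul_le_mul_of_nonneg_left (h a (hμ.mem_toFinset.1 ha)) ENNReal.toReal_nonneg

theorem expect_add {μ : PMF α} (hμ : μ.support.Finite) (f g : α → ℝ) :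
    expect μ (fun a => f a + g a) = expect μ f + expect μ g := by
  simp only [expect_eq_sum_support hμ, mul_add, Finset.sum_add_distrib]

theorem expect_const_mul {μ : PMF α} (c : ℝ) (f : α → ℝ) :
    expect μ (fun a => c * f a) = c * expect μ f := by
  unfold expect
  rw [← tsum_mul_left]
  exact tsum_congr fun a => by ring

theorem expect_const {μ : PMF α} (hμ : μ.support.Finite) (c : ℝ) :
    expect μ (fun _ => c) = c := by
  rw [expect_eq_sum_support hμ, ← Finset.sum_mul, sum_toReal_support hμ, one_mul]

end Expectation

/-! ### The law of TD, one transition at a time. -/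

section TDLaw

variable {S A : Type*} [Fintype S] [Fintype A] [DecidableEq S] [DecidableEq A] [Nonempty A]

theorem simplexPMF_toReal {q : A → ℝ} (hq : q ∈ stdSimplex ℝ A) (a : A) :
    (simplexPMF q a).toReal = q a := by
  unfold simplexPMF
  rw [dif_pos hq, PMF.ofFintype_apply, ENNReal.toReal_ofReal (hq.1 a)]

theorem finite_support_tdLaw (M : CMDP S A) (σ : ℝ) (u pol : S → A → ℝ) (η : ℕ → ℝ)
    (Q₀ : S → A → ℝ) (s₀ : S) (n : ℕ) : (tdLaw M σ u pol η Q₀ s₀ n).support.Finite := by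
  induction n with
  | zero => simp [tdLaw]
  | succ n ih =>
    exact finite_support_bind ih fun z _ => finite_support_bind (Set.toFinite _) fun a _ =>
      finite_support_bind (Set.toFinite _) fun s' _ => by simp

theorem expect_tdLaw_succ (M : CMDP S A) (σ : ℝ) (u : S → A → ℝ) {pol : S → A → ℝ}
    (hpol : ∀ s, pol s ∈ stdSimplex ℝ A) (η : ℕ → ℝ) (Q₀ : S → A → ℝ) (s₀ : S) (n : ℕ)
    (f : (S → A → ℝ) × S → ℝ) :
    expect (tdLaw M σ u pol η Q₀ s₀ (n + 1)) f = expect (tdLaw M σ u pol η Q₀ s₀ n) fun z =>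
      ∑ a, pol z.2 a * ∑ s', (M.P z.2 a s').toReal *
        f (tdUpdate M σ u pol (η n) z.1 z.2 a s', s') := by
  rw [tdLaw, expect_bind (finite_support_tdLaw M σ u pol η Q₀ s₀ n) fun z _ =>
    finite_support_bind (Set.toFinite _) fun a _ =>
      finite_support_bind (Set.toFinite _) fun s' _ => by simp]
  congr 1
  funext z
  rw [expect_bind (Set.toFinite _) fun a _ =>
    finite_support_bind (Set.toFinite _) fun s' _ => by simp, expect_fintype]
  refine Finset.sum_congr rfl fun a _ => ?_
  rw [simplexPMF_toReal (hpol z.2), expect_bind (Set.toFinite _) fun s' _ => by simp,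
    expect_fintype]
  simp only [expect_pure]

/-- A property that TD updates preserve holds on the support of the law of TD. -/
theorem tdLaw_support_induction (M : CMDP S A) (σ : ℝ) (u pol : S → A → ℝ) (η : ℕ → ℝ)
    (Q₀ : S → A → ℝ) (s₀ : S) {p : (S → A → ℝ) → Prop} (h0 : p Q₀)
    (hstep : ∀ n Q s a s', p Q → p (tdUpdate M σ u pol (η n) Q s a s')) (n : ℕ) :
    ∀ z ∈ (tdLaw M σ u pol η Q₀ s₀ n).support, p z.1 := by
  induction n with
  | zero =>
    intro z hz
    rw [tdLaw, PMF.support_pure, Set.mem_singleton_iff] at hz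
    rw [hz]; exact h0
  | succ n ih =>
    intro z hz
    rw [tdLaw, PMF.mem_support_bind_iff] at hz
    obtain ⟨y, hy, hz⟩ := hz
    rw [PMF.mem_support_bind_iff] at hz
    obtain ⟨a, -, hz⟩ := hz
    rw [PMF.mem_support_bind_iff] at hz
    obtain ⟨s', -, hz⟩ := hz
    rw [PMF.support_pure, Set.mem_singleton_iff] at hz
    rw [hz]
    exact hstep n y.1 y.2 a s' (ih y hy)

end TDLaw

/-! ### Inequalities for powers and a stochastic approximation recursion. -/

section PowerInequalities

theorem abs_pow_add_sub_le (x y : ℝ) (n : ℕ) :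
    |(x + y) ^ (n + 1) - x ^ (n + 1)| ≤ (n + 1) * |y| * (|x| + |y|) ^ n := by
  induction n with
  | zero => simp
  | succ n ih =>
    have e : (x + y) ^ (n + 1 + 1) - x ^ (n + 1 + 1)
        = (x + y) * ((x + y) ^ (n + 1) - x ^ (n + 1)) + y * x ^ (n + 1) := by ring
    rw [e]
    refine (abs_add_le _ _).trans ?_
    rw [abs_mul, abs_mul, abs_pow]
    have h1 : |x + y| * |(x + y) ^ (n + 1) - x ^ (n + 1)|
        ≤ (|x| + |y|) * ((n + 1) * |y| * (|x| + |y|) ^ n) :=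
      mul_le_mul (abs_add_le _ _) ih (abs_nonneg _) (by positivity)
    have h2 : |y| * |x| ^ (n + 1) ≤ |y| * (|x| + |y|) ^ (n + 1) := by
      gcongr; linarith [abs_nonneg y]
    push_cast
    calc _ ≤ _ := add_le_add h1 h2
      _ = _ := by ring

/-- Multiplying the remainder by `x + y` produces one new term `(n + 2) y² x^{n+1}`; the constant
survives the induction because `(n + 2)² + (n + 2) ≤ (n + 3)²`. -/
theorem abs_pow_add_sub_taylor_le (x y : ℝ) (n : ℕ) :
    |(x + y) ^ (n + 2) - x ^ (n + 2) - (n + 2) * x ^ (n + 1) * y|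
      ≤ (n + 2) ^ 2 * y ^ 2 * (|x| + |y|) ^ n := by
  induction n with
  | zero =>
    have : (x + y) ^ (0 + 2) - x ^ (0 + 2) - ((0 : ℕ) + 2) * x ^ (0 + 1) * y = y ^ 2 := by
      push_cast; ring
    rw [this, abs_of_nonneg (sq_nonneg y)]
    push_cast
    nlinarith [sq_nonneg y]
  | succ n ih =>
    have e : (x + y) ^ (n + 1 + 2) - x ^ (n + 1 + 2) - ((n + 1 : ℕ) + 2) * x ^ (n + 1 + 1) * y
        = (x + y) * ((x + y) ^ (n + 2) - x ^ (n + 2) - (n + 2) * x ^ (n + 1) * y)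
          + (n + 2) * y ^ 2 * x ^ (n + 1) := by push_cast; ring
    rw [e]
    refine (abs_add_le _ _).trans ?_
    have h1 : |(x + y) * ((x + y) ^ (n + 2) - x ^ (n + 2) - (n + 2) * x ^ (n + 1) * y)|
        ≤ (|x| + |y|) * ((n + 2) ^ 2 * y ^ 2 * (|x| + |y|) ^ n) := by
      rw [abs_mul]
      exact mul_le_mul (abs_add_le _ _) ih (abs_nonneg _) (by positivity)
    have h2 : |(n + 2) * y ^ 2 * x ^ (n + 1)| ≤ (n + 2) * y ^ 2 * (|x| + |y|) ^ (n + 1) := by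
      rw [abs_mul, abs_of_nonneg (by positivity : (0 : ℝ) ≤ (n + 2) * y ^ 2), abs_pow]
      gcongr; linarith [abs_nonneg y]
    have h3 : 0 ≤ y ^ 2 * (|x| + |y|) ^ (n + 1) := by positivity
    push_cast
    calc _ ≤ _ := add_le_add h1 h2
      _ = ((n + 2 : ℝ) ^ 2 + (n + 2)) * (y ^ 2 * (|x| + |y|) ^ (n + 1)) := by ring
      _ ≤ (n + 1 + 2 : ℝ) ^ 2 * (y ^ 2 * (|x| + |y|) ^ (n + 1)) := by
          gcongr; nlinarith [(Nat.cast_nonneg n : (0 : ℝ) ≤ n)]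
      _ = _ := by ring

/-- Drift of a power of the error under a `γ`-contraction in the supremum norm. -/
theorem contraction_drift_le {γ u m : ℝ} (hγ : 0 ≤ γ) (hγ1 : γ < 1) (hu : 0 ≤ u) (hum : u ≤ m)
    (n : ℕ) : γ * u ^ n * m - u ^ (n + 1)
      ≤ ((1 + γ) / 2) ^ (n + 1) * m ^ (n + 1) - (1 - γ) / (1 + γ) * u ^ (n + 1) := by
  have hm : 0 ≤ m := hu.trans hum
  -- Entries close to the maximal error have a genuine negative drift; for the others the power of
  -- `(1 + γ) / 2` is small once the exponent is large.
  rcases le_total ((1 + γ) / 2 * m) u with h | h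
  · have h1 : m ≤ 2 / (1 + γ) * u := by
      rw [div_mul_eq_mul_div, le_div_iff₀ (by linarith)]; linarith
    have h2 : γ * u ^ n * m ≤ γ * u ^ n * (2 / (1 + γ) * u) := by gcongr
    have h3 : γ * u ^ n * (2 / (1 + γ) * u) = 2 * γ / (1 + γ) * u ^ (n + 1) := by ring
    have h4 : 2 * γ / (1 + γ) = 1 - (1 - γ) / (1 + γ) := by field_simp; ring
    have h5 : 0 ≤ ((1 + γ) / 2) ^ (n + 1) * m ^ (n + 1) := by positivity
    rw [h3, h4] at h2
    linarith
  · have h1 : γ * u ^ n * m ≤ (1 + γ) / 2 * ((1 + γ) / 2 * m) ^ n * m := by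
      gcongr; linarith
    have h2 : (1 + γ) / 2 * ((1 + γ) / 2 * m) ^ n * m
        = ((1 + γ) / 2) ^ (n + 1) * m ^ (n + 1) := by rw [mul_pow]; ring
    have h3 : (1 - γ) / (1 + γ) * u ^ (n + 1) ≤ 1 * u ^ (n + 1) := by
      gcongr
      rw [div_le_one (by linarith)]; linarith
    linarith

theorem mul_pow_le_young {η X κ : ℝ} (hη : 0 ≤ η) (hX : 0 ≤ X) (hκ : 0 < κ) (k : ℕ) :
    η * X ^ k ≤ κ * X ^ (k + 1) + η ^ (k + 1) / κ ^ k := by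
  rcases le_total (η / κ) X with h | h
  · have h1 : η ≤ κ * X := by rwa [div_le_iff₀ hκ, mul_comm] at h
    have h2 : η * X ^ k ≤ κ * X * X ^ k := by gcongr
    have h3 : 0 ≤ η ^ (k + 1) / κ ^ k := by positivity
    calc _ ≤ _ := h2
      _ = κ * X ^ (k + 1) := by ring
      _ ≤ _ := by linarith
  · have h1 : η * X ^ k ≤ η * (η / κ) ^ k := by gcongr
    have h2 : η * (η / κ) ^ k = η ^ (k + 1) / κ ^ k := by rw [div_pow]; ring
    have h3 : 0 ≤ κ * X ^ (k + 1) := by positivity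
    linarith

/-- Second order noise is absorbed by the drift, up to a higher power of the step size. -/
theorem exists_noise_absorb (k : ℕ) {W C κ : ℝ} (hW : 0 ≤ W) (hC : 0 ≤ C) (hκ : 0 < κ) :
    ∃ D, 0 ≤ D ∧ ∀ m η : ℝ, 0 ≤ m → 0 ≤ η → η ≤ 1 →
      C * η ^ 2 * (m + η * W) ^ (2 * k) ≤ κ * η * m ^ (2 * k + 2) + D * η ^ (k + 2) := by
  -- Small enough to cover the factor `C` and the `2^{2k+2}` lost in splitting the power of `m + η
  -- W`; `C + 1` avoids dividing by zero.
  set κ' : ℝ := κ / ((C + 1) * 2 ^ (2 * k + 2)) with hκ'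
  have hκ'0 : 0 < κ' := by positivity
  refine ⟨C * (κ' * 2 ^ (2 * k + 2) * W ^ (2 * k + 2) + 1 / κ' ^ k), by positivity,
    fun m η hm hη hη1 => ?_⟩
  have h1 := mul_pow_le_young hη (by positivity : 0 ≤ (m + η * W) ^ 2) hκ'0 k
  rw [← pow_mul, ← pow_mul, show 2 * (k + 1) = 2 * k + 2 by ring] at h1
  have h2 : (m + η * W) ^ (2 * k + 2)
      ≤ 2 ^ (2 * k + 2) * (m ^ (2 * k + 2) + (η * W) ^ (2 * k + 2)) := by
    have hmx : m + η * W ≤ 2 * max m (η * W) := by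
      linarith [le_max_left m (η * W), le_max_right m (η * W)]
    have hnn : 0 ≤ η * W := by positivity
    calc (m + η * W) ^ (2 * k + 2) ≤ (2 * max m (η * W)) ^ (2 * k + 2) := by gcongr
      _ = 2 ^ (2 * k + 2) * max m (η * W) ^ (2 * k + 2) := mul_pow _ _ _
      _ ≤ _ := by
          gcongr
          have p1 : 0 ≤ m ^ (2 * k + 2) := by positivity
          have p2 : 0 ≤ (η * W) ^ (2 * k + 2) := by positivity
          rcases max_cases m (η * W) with ⟨h, -⟩ | ⟨h, -⟩ <;> rw [h] <;> linarith
  have h3 : η ^ (2 * k + 2) ≤ η ^ (k + 1) := pow_le_pow_of_le_one hη hη1 (by omega)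
  have h4 : (η * W) ^ (2 * k + 2) ≤ η ^ (k + 1) * W ^ (2 * k + 2) := by
    rw [mul_pow]; gcongr
  have h5 : η * (m + η * W) ^ (2 * k) ≤ κ' * (2 ^ (2 * k + 2) * (m ^ (2 * k + 2)
      + η ^ (k + 1) * W ^ (2 * k + 2))) + η ^ (k + 1) / κ' ^ k := by
    refine h1.trans ?_
    gcongr
    exact h2.trans (by gcongr)
  have h6 : C * (κ' * 2 ^ (2 * k + 2)) ≤ κ := by
    rw [hκ', show C * (κ / ((C + 1) * 2 ^ (2 * k + 2)) * 2 ^ (2 * k + 2)) = C / (C + 1) * κ by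
      field_simp]
    exact mul_le_of_le_one_left hκ.le ((div_le_one (by linarith)).2 (by linarith))
  calc C * η ^ 2 * (m + η * W) ^ (2 * k) = C * η * (η * (m + η * W) ^ (2 * k)) := by ring
    _ ≤ C * η * (κ' * (2 ^ (2 * k + 2) * (m ^ (2 * k + 2)
      + η ^ (k + 1) * W ^ (2 * k + 2))) + η ^ (k + 1) / κ' ^ k) := by gcongr
    _ = C * (κ' * 2 ^ (2 * k + 2)) * (η * m ^ (2 * k + 2))
      + C * (κ' * 2 ^ (2 * k + 2) * W ^ (2 * k + 2) + 1 / κ' ^ k) * η ^ (k + 2) := by ring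
    _ ≤ κ * (η * m ^ (2 * k + 2))
      + C * (κ' * 2 ^ (2 * k + 2) * W ^ (2 * k + 2) + 1 / κ' ^ k) * η ^ (k + 2) := by gcongr
    _ = _ := by ring

/-- The rate of a stochastic approximation recursion with step sizes `c / (n + n₀)`. -/
theorem recursion_rate {e : ℕ → ℝ} {a c C D : ℝ} {r n₀ : ℕ} (hn₀ : r + 1 ≤ n₀)
    (hac : a * c = r + 1) (h0 : e 0 * n₀ ^ r ≤ D) (hCD : C * c ^ (r + 1) ≤ D) (hD : 0 ≤ D)
    (hrec : ∀ n, e (n + 1) ≤ (1 - a * (c / (n + n₀ : ℝ))) * e n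
      + C * (c / (n + n₀ : ℝ)) ^ (r + 1)) (n : ℕ) : e n ≤ D / (n + n₀ : ℝ) ^ r := by
  induction n with
  | zero =>
    have : (0 : ℝ) < n₀ := by exact_mod_cast (by omega : 0 < n₀)
    rw [le_div_iff₀ (by positivity)]
    simpa using h0
  | succ n ih =>
    set N : ℝ := n + n₀ with hN
    have hNr : (r + 1 : ℝ) ≤ N := by
      have h1 : ((r + 1 : ℕ) : ℝ) ≤ n₀ := by exact_mod_cast hn₀
      push_cast at h1
      have : (0 : ℝ) ≤ n := Nat.cast_nonneg n
      linarith
    have hN0 : 0 < N := lt_of_lt_of_le (by positivity) hNr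
    have e1 : a * (c / N) = (r + 1) / N := by rw [← hac]; ring
    have hcoef : 0 ≤ 1 - (r + 1 : ℝ) / N := sub_nonneg.2 ((div_le_one hN0).2 hNr)
    have hr := hrec n
    rw [← hN, e1] at hr
    have h2 : C * (c / N) ^ (r + 1) ≤ D / N ^ (r + 1) := by
      rw [div_pow, ← mul_div_assoc]; gcongr
    -- Of the contraction `(r + 1) / N`, one unit pays for the noise; by Bernoulli the remaining `r
    -- / N` suffices to pass from `N^{-r}` to `(N + 1)^{-r}`.
    have hbern : 1 - (r : ℝ) / N ≤ (N / (N + 1)) ^ r := by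
      have hb := one_add_mul_le_pow (a := -(1 / (N + 1))) (by
        have : 1 / (N + 1) ≤ 1 := (div_le_one (by linarith)).2 (by linarith)
        linarith) r
      have e2 : (1 : ℝ) + -(1 / (N + 1)) = N / (N + 1) := by field_simp; ring
      rw [e2] at hb
      have : (r : ℝ) * (1 / (N + 1)) ≤ r / N := by
        rw [mul_one_div]; gcongr; linarith
      linarith
    have e3 : ((n + 1 : ℕ) : ℝ) + n₀ = N + 1 := by rw [hN]; push_cast; ring
    rw [e3]
    calc e (n + 1) ≤ (1 - (r + 1) / N) * (D / N ^ r) + D / N ^ (r + 1) := by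
          have := mul_le_mul_of_nonneg_left ih hcoef
          linarith
      _ = D / N ^ r * (1 - r / N) := by field_simp; ring
      _ ≤ D / N ^ r * (N / (N + 1)) ^ r := by gcongr
      _ = D / (N + 1) ^ r := by rw [div_pow]; field_simp

end PowerInequalities

/-! ### A Lyapunov function for hitting times. -/

section Hitting

variable {S A : Type*} [Fintype S] [Fintype A]

/-- `s` can be reached from `x` in `n` steps of `R`. -/
def ReachIn (R : S → S → Prop) (s : S) : ℕ → S → Prop
  | 0, x => x = s
  | n + 1, x => ∃ y, R x y ∧ ReachIn R s n y

/-- The rank is the length of a shortest path to `s`; the first step of such a path lowers it. -/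
theorem exists_rank {R : S → S → Prop} (s : S) (h : ∀ x, Relation.ReflTransGen R x s) :
    ∃ f : S → ℕ, ∀ x, x ≠ s → ∃ y, R x y ∧ f y + 1 ≤ f x := by
  classical
  have hex : ∀ x, ∃ n, ReachIn R s n x := fun x => by
    induction h x using Relation.ReflTransGen.head_induction_on with
    | refl => exact ⟨0, rfl⟩
    | head hxy _ ih =>
      obtain ⟨n, hn⟩ := ih
      exact ⟨n + 1, _, hxy, hn⟩
  refine ⟨fun x => Nat.find (hex x), fun x hx => ?_⟩
  have hspec := Nat.find_spec (hex x)
  rcases hn : Nat.find (hex x) with _ | n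
  · rw [hn] at hspec; exact absurd hspec hx
  · rw [hn] at hspec
    obtain ⟨y, hxy, hy⟩ := hspec
    exact ⟨y, hxy, by simpa [hn] using Nat.find_min' (hex y) hy⟩

/-- A Lyapunov function for the hitting times of all states, uniformly over the policies that
take every action with probability at least `q`. -/
theorem exists_hitting_function [DecidableEq S] (M : CMDP S A) {q : ℝ} (hq : 0 < q)
    (hreach : ∀ s s', Relation.ReflTransGen (fun x y => ∃ a, M.P x a y ≠ 0) s s') :
    ∃ (h : S → S → ℝ) (H : ℝ), 0 < H ∧ (∀ s x, 0 ≤ h s x ∧ h s x ≤ H) ∧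
      ∀ pol : S → A → ℝ, (∀ s, pol s ∈ stdSimplex ℝ A) → (∀ s a, q ≤ pol s a) → ∀ s x,
        ∑ a, pol x a * ∑ y, (M.P x a y).toReal * h s y
          ≤ h s x - 1 + if s = x then H + 1 else 0 := by
  choose f hf using fun s => exists_rank s fun x => hreach x s
  obtain ⟨N, hN⟩ : ∃ N, ∀ s x, f s x ≤ N := by
    refine ⟨∑ s, ∑ x, f s x, fun s x => ?_⟩
    exact (Finset.single_le_sum (f := fun x => f s x) (fun _ _ => Nat.zero_le _)
      (Finset.mem_univ x)).trans (Finset.single_le_sum (f := fun s => ∑ x, f s x)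
        (fun _ _ => Nat.zero_le _) (Finset.mem_univ s))
  -- A lower bound, uniform over the exploring policies, on the probability of each possible action
  -- and transition.
  obtain ⟨p₀, hp0, hp1, hp⟩ : ∃ p₀ : ℝ, 0 < p₀ ∧ p₀ ≤ 1 ∧
      ∀ x a y, M.P x a y ≠ 0 → p₀ ≤ q * (M.P x a y).toReal := by
    classical
    set v : S × A × S → ℝ := fun z =>
      if M.P z.1 z.2.1 z.2.2 ≠ 0 then q * (M.P z.1 z.2.1 z.2.2).toReal else 1
    have hv : ∀ z, 0 < v z := fun z => by
      simp only [v]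
      split_ifs with hz
      · exact mul_pos hq (ENNReal.toReal_pos hz (PMF.apply_ne_top _ _))
      · exact one_pos
    rcases isEmpty_or_nonempty (S × A × S) with hE | hE
    · exact ⟨1, one_pos, le_rfl, fun x a y _ => (hE.false (x, a, y)).elim⟩
    · obtain ⟨z₀, hz₀⟩ := Finite.exists_min v
      refine ⟨min 1 (v z₀), lt_min one_pos (hv z₀), min_le_left _ _, fun x a y hxy => ?_⟩
      refine (min_le_right _ _).trans ((hz₀ (x, a, y)).trans ?_)
      simp only [v]
      rw [if_pos hxy]
  -- From rank `j + 1` the mean of `ρ^rank` after one step is at least `p₀ ρ^j = 2 ρ^{j+1}`, twice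
  -- its present value. So `C (1 - ρ^rank)` falls by at least `C ρ^{j+1}`, and the choice of `C`
  -- makes this at least `1` for all ranks up to `N`.
  set ρ : ℝ := p₀ / 2 with hρ
  have hρ0 : 0 < ρ := by positivity
  have hρ1 : ρ ≤ 1 := by rw [hρ]; linarith
  set C : ℝ := 1 / (ρ * ρ ^ N) with hC
  have hC0 : 0 < C := by positivity
  have hle : ∀ s x, C * (1 - ρ ^ f s x) ≤ C := fun s x =>
    mul_le_of_le_one_right hC0.le (by linarith [pow_pos hρ0 (f s x)])
  refine ⟨fun s x => C * (1 - ρ ^ f s x), C, hC0, fun s x => ⟨mul_nonneg hC0.le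
    (sub_nonneg.2 (pow_le_one₀ hρ0.le hρ1)), hle s x⟩, fun pol hpol hqpol s x => ?_⟩
  have hsum : ∑ a, pol x a * ∑ y, (M.P x a y).toReal * (C * (1 - ρ ^ f s y))
      = C - C * ∑ a, pol x a * ∑ y, (M.P x a y).toReal * ρ ^ f s y := by
    have h1 : ∀ a, ∑ y, (M.P x a y).toReal * (C * (1 - ρ ^ f s y))
        = C - C * ∑ y, (M.P x a y).toReal * ρ ^ f s y := fun a => by
      have : ∀ y, (M.P x a y).toReal * (C * (1 - ρ ^ f s y))
          = (M.P x a y).toReal * C - C * ((M.P x a y).toReal * ρ ^ f s y) := fun y => by ring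
      simp only [this, Finset.sum_sub_distrib, ← Finset.sum_mul, ← Finset.mul_sum]
      rw [sum_toReal_pmf, one_mul]
    have h2 : ∀ a, pol x a * (C - C * ∑ y, (M.P x a y).toReal * ρ ^ f s y)
        = pol x a * C - C * (pol x a * ∑ y, (M.P x a y).toReal * ρ ^ f s y) := fun a => by ring
    simp only [h1, h2, Finset.sum_sub_distrib, ← Finset.sum_mul, ← Finset.mul_sum]
    rw [(hpol x).2, one_mul]
  have hnn : ∀ a y, 0 ≤ (M.P x a y).toReal * ρ ^ f s y := fun a y =>
    mul_nonneg ENNReal.toReal_nonneg (pow_pos hρ0 _).le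
  have hnn' : ∀ a, 0 ≤ pol x a * ∑ y, (M.P x a y).toReal * ρ ^ f s y := fun a =>
    mul_nonneg ((hpol x).1 a) (Finset.sum_nonneg fun y _ => hnn a y)
  rw [hsum]
  split_ifs with hsx
  · have h1 : 0 ≤ C * ∑ a, pol x a * ∑ y, (M.P x a y).toReal * ρ ^ f s y :=
      mul_nonneg hC0.le (Finset.sum_nonneg fun a _ => hnn' a)
    have h2 : 0 ≤ C * (1 - ρ ^ f s x) :=
      mul_nonneg hC0.le (sub_nonneg.2 (pow_le_one₀ hρ0.le hρ1))
    linarith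
  · obtain ⟨y, ⟨a, hxy⟩, hy⟩ := hf s x (Ne.symm hsx)
    obtain ⟨j, hj⟩ : ∃ j, f s x = j + 1 := ⟨f s x - 1, by omega⟩
    have h1 : p₀ * ρ ^ j ≤ ∑ a, pol x a * ∑ y, (M.P x a y).toReal * ρ ^ f s y := by
      have hP0 : 0 ≤ (M.P x a y).toReal := ENNReal.toReal_nonneg
      calc p₀ * ρ ^ j ≤ (q * (M.P x a y).toReal) * ρ ^ f s y := by
            have := hp x a y hxy
            have h2 : ρ ^ j ≤ ρ ^ f s y := pow_le_pow_of_le_one hρ0.le hρ1 (by omega)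
            gcongr
        _ ≤ pol x a * ((M.P x a y).toReal * ρ ^ f s y) := by
            rw [mul_assoc]
            exact mul_le_mul_of_nonneg_right (hqpol x a) (hnn a y)
        _ ≤ pol x a * ∑ y, (M.P x a y).toReal * ρ ^ f s y :=
            mul_le_mul_of_nonneg_left (Finset.single_le_sum
              (f := fun y => (M.P x a y).toReal * ρ ^ f s y)
              (fun y _ => hnn a y) (Finset.mem_univ y)) ((hpol x).1 a)
        _ ≤ _ := Finset.single_le_sum
            (f := fun a => pol x a * ∑ y, (M.P x a y).toReal * ρ ^ f s y)
            (fun a _ => hnn' a) (Finset.mem_univ a)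
    have h2 : 1 ≤ C * (ρ * ρ ^ j) := by
      have h3 : ρ ^ N ≤ ρ ^ j := pow_le_pow_of_le_one hρ0.le hρ1 (by have := hN s x; omega)
      calc (1 : ℝ) = C * (ρ * ρ ^ N) := by rw [hC]; field_simp
        _ ≤ _ := by gcongr
    have h4 := mul_le_mul_of_nonneg_left h1 hC0.le
    have h5 : C * (p₀ * ρ ^ j) = 2 * (C * (ρ * ρ ^ j)) := by rw [hρ]; ring
    change _ ≤ C * (1 - ρ ^ f s x) - 1 + 0
    rw [hj, pow_succ']
    linarith

end Hitting

/-! ### The temporal difference error: bounds and mean contraction. -/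

section TDIncrement

variable {S A : Type*} [Fintype S] [Fintype A] [DecidableEq S] [DecidableEq A]

/-- The temporal difference error of the table `Q` at the transition `s, a, s'`. -/
def tdError (M : CMDP S A) (σ : ℝ) (u pol : S → A → ℝ) (Q : S → A → ℝ) (s : S) (a : A)
    (s' : S) : ℝ :=
  u s a + M.γ * (1 - M.δ) * stateValue pol Q s' + M.γ * M.δ * LSE σ (stateValue pol Q) - Q s a

theorem tdUpdate_apply_self (M : CMDP S A) (σ : ℝ) (u pol : S → A → ℝ) (η : ℝ)
    (Q : S → A → ℝ) (s : S) (a : A) (s' : S) :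
    tdUpdate M σ u pol η Q s a s' s a = Q s a + η * tdError M σ u pol Q s a s' := by
  simp [tdUpdate, tdError]

theorem tdUpdate_apply_of_ne (M : CMDP S A) (σ : ℝ) (u pol : S → A → ℝ) (η : ℝ)
    (Q : S → A → ℝ) (s : S) (a : A) (s' : S) {x : S} {b : A} (h : x = s → b ≠ a) :
    tdUpdate M σ u pol η Q s a s' x b = Q x b := by
  unfold tdUpdate
  by_cases hx : x = s
  · subst hx
    rw [Function.update_self, Function.update_of_ne (h rfl)]
  · rw [Function.update_of_ne hx]

theorem sum_mul_tdError (M : CMDP S A) (σ : ℝ) (u pol : S → A → ℝ) (Q : S → A → ℝ) (s : S)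
    (a : A) : ∑ s', (M.P s a s').toReal * tdError M σ u pol Q s a s'
      = lookahead M σ u (stateValue pol Q) s a - Q s a := by
  have h : ∀ s', (M.P s a s').toReal * tdError M σ u pol Q s a s'
      = M.γ * (1 - M.δ) * ((M.P s a s').toReal * stateValue pol Q s')
        + (M.P s a s').toReal * (u s a + M.γ * M.δ * LSE σ (stateValue pol Q) - Q s a) :=
    fun s' => by unfold tdError; ring
  simp only [h, Finset.sum_add_distrib, ← Finset.mul_sum, ← Finset.sum_mul]
  rw [sum_toReal_pmf, lookahead]
  ring

theorem abs_tdTarget_le [Nonempty S] (M : CMDP S A) {σ : ℝ} (hσ : σ < 0) {u pol : S → A → ℝ}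
    (hu : ∀ s a, u s a ∈ Set.Icc (0 : ℝ) 1) (hpol : ∀ s, pol s ∈ stdSimplex ℝ A)
    {Q : S → A → ℝ} {R : ℝ} (hQ : ‖Q‖ ≤ R) (s : S) (a : A) (s' : S) :
    |tdError M σ u pol Q s a s' + Q s a|
      ≤ 1 + Real.log (Fintype.card S) / |σ| + M.γ * R := by
  have hL0 : 0 ≤ Real.log (Fintype.card S) / |σ| :=
    div_nonneg (Real.log_natCast_nonneg _) (abs_nonneg _)
  have hv : ‖stateValue pol Q‖ ≤ R := (norm_stateValue_le hpol Q).trans hQ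
  have h1 : |stateValue pol Q s'| ≤ R := (norm_le_pi_norm (stateValue pol Q) s').trans hv
  have h2 : |LSE σ (stateValue pol Q)| ≤ R + Real.log (Fintype.card S) / |σ| :=
    (abs_LSE_le hσ _).trans (by linarith)
  have h3 : |u s a| ≤ 1 := abs_le.2 ⟨by linarith [(hu s a).1], (hu s a).2⟩
  have hd := M.discount_nonneg
  have hgd := M.γδ_nonneg
  have hgd1 : M.γ * M.δ ≤ 1 := mul_le_one₀ M.γ_mem.2.le M.δ_mem.1 M.δ_mem.2
  have e : tdError M σ u pol Q s a s' + Q s a = u s a + M.γ * (1 - M.δ) * stateValue pol Q s'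
      + M.γ * M.δ * LSE σ (stateValue pol Q) := by unfold tdError; ring
  rw [e]
  refine (abs_add_three _ _ _).trans ?_
  rw [abs_mul (M.γ * (1 - M.δ)), abs_mul (M.γ * M.δ), abs_of_nonneg hd, abs_of_nonneg hgd]
  have h4 := mul_le_mul_of_nonneg_left h1 hd
  have h5 := mul_le_mul_of_nonneg_left h2 hgd
  have h6 := mul_le_mul_of_nonneg_right hgd1 hL0
  nlinarith

/-- The changed entry is a convex combination of its old value and the bootstrap target, and `R` is
large enough for the target to stay in the ball. Hence the noise is bounded along the whole run. -/
theorem norm_tdUpdate_le [Nonempty S] (M : CMDP S A) {σ : ℝ} (hσ : σ < 0) {u pol : S → A → ℝ}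
    (hu : ∀ s a, u s a ∈ Set.Icc (0 : ℝ) 1) (hpol : ∀ s, pol s ∈ stdSimplex ℝ A)
    {Q : S → A → ℝ} {R η : ℝ} (hQ : ‖Q‖ ≤ R)
    (hR : 1 + Real.log (Fintype.card S) / |σ| ≤ (1 - M.γ) * R) (hη : 0 ≤ η) (hη1 : η ≤ 1)
    (s : S) (a : A) (s' : S) : ‖tdUpdate M σ u pol η Q s a s'‖ ≤ R := by
  have hR0 : 0 ≤ R := (norm_nonneg _).trans hQ
  refine (pi_norm_le_iff_of_nonneg hR0).2 fun x => (pi_norm_le_iff_of_nonneg hR0).2 fun b => ?_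
  rw [Real.norm_eq_abs]
  by_cases h : x = s ∧ b = a
  · obtain ⟨rfl, rfl⟩ := h
    rw [tdUpdate_apply_self]
    have h1 := abs_tdTarget_le M hσ hu hpol hQ x b s'
    have h2 := (abs_apply_apply_le_norm Q x b).trans hQ
    have e : Q x b + η * tdError M σ u pol Q x b s'
        = (1 - η) * Q x b + η * (tdError M σ u pol Q x b s' + Q x b) := by ring
    rw [e]
    refine (abs_add_le _ _).trans ?_
    rw [abs_mul, abs_mul, abs_of_nonneg hη, abs_of_nonneg (sub_nonneg.2 hη1)]
    have h3 := mul_le_mul_of_nonneg_left (h1.trans (by linarith : _ ≤ R)) hη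
    have h4 := mul_le_mul_of_nonneg_left h2 (sub_nonneg.2 hη1)
    linarith
  · rw [tdUpdate_apply_of_ne M σ u pol η Q s a s' fun hx hb => h ⟨hx, hb⟩]
    exact (abs_apply_apply_le_norm Q x b).trans hQ

theorem abs_tdError_le [Nonempty S] (M : CMDP S A) {σ : ℝ} (hσ : σ < 0) {u pol : S → A → ℝ}
    (hu : ∀ s a, u s a ∈ Set.Icc (0 : ℝ) 1) (hpol : ∀ s, pol s ∈ stdSimplex ℝ A)
    {Q : S → A → ℝ} {R : ℝ} (hQ : ‖Q‖ ≤ R)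
    (hR : 1 + Real.log (Fintype.card S) / |σ| ≤ (1 - M.γ) * R) (s : S) (a : A) (s' : S) :
    |tdError M σ u pol Q s a s'| ≤ 2 * R := by
  have h1 := abs_tdTarget_le M hσ hu hpol hQ s a s'
  have h2 := (abs_apply_apply_le_norm Q s a).trans hQ
  have e : tdError M σ u pol Q s a s' = (tdError M σ u pol Q s a s' + Q s a) - Q s a := by ring
  rw [e]
  exact (abs_sub _ _).trans (by linarith)

/-- The expected temporal difference error contracts towards the smoothed action values. -/
theorem abs_expected_tdError_add_le [Nonempty S] (M : CMDP S A) {σ : ℝ} (hσ : σ < 0)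
    {u pol : S → A → ℝ} (hpol : ∀ s, pol s ∈ stdSimplex ℝ A) (Q : S → A → ℝ) (s : S) (a : A) :
    |∑ s', (M.P s a s').toReal * tdError M σ u pol Q s a s'
      + (Q s a - smoothedQ M σ u pol s a)| ≤ M.γ * ‖Q - smoothedQ M σ u pol‖ := by
  rw [sum_mul_tdError]
  have e : lookahead M σ u (stateValue pol Q) s a - Q s a + (Q s a - smoothedQ M σ u pol s a)
      = lookahead M σ u (stateValue pol Q) s a
        - lookahead M σ u (stateValue pol (smoothedQ M σ u pol)) s a := by
    rw [stateValue_smoothedQ M hσ u (Contractive.of_policy M hpol), smoothedQ]; ring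
  rw [e]
  exact (abs_lookahead_sub_le M hσ u _ _ s a).trans
    (mul_le_mul_of_nonneg_left (norm_stateValue_sub_le hpol _ _) M.γ_mem.1)

end TDIncrement

/-! ### Weighted error powers and their change in one update. -/

section TDPotential

variable {S A : Type*} [Fintype S] [Fintype A] [DecidableEq S] [DecidableEq A]

/-- `∑ₐ (Q(s,a) - Q*(s,a))ᵖ`. -/
def errPow (Qs : S → A → ℝ) (p : ℕ) (Q : S → A → ℝ) (s : S) : ℝ := ∑ a, (Q s a - Qs s a) ^ p

theorem errPow_nonneg (Qs : S → A → ℝ) (k : ℕ) (Q : S → A → ℝ) (s : S) :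
    0 ≤ errPow Qs (2 * k + 2) Q s :=
  Finset.sum_nonneg fun _ _ => Even.pow_nonneg (by use k + 1; ring) _

theorem errPow_tdUpdate (M : CMDP S A) (σ : ℝ) (u pol : S → A → ℝ) (η : ℝ) (Qs Q : S → A → ℝ)
    (p : ℕ) (x : S) (a : A) (y s : S) :
    errPow Qs p (tdUpdate M σ u pol η Q x a y) s = errPow Qs p Q s + if s = x then
      (Q x a - Qs x a + η * tdError M σ u pol Q x a y) ^ p - (Q x a - Qs x a) ^ p else 0 := by
  unfold errPow
  split_ifs with h
  · subst h
    rw [← Finset.add_sum_erase _ _ (Finset.mem_univ a),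
      ← Finset.add_sum_erase (a := a) (f := fun b => (Q s b - Qs s b) ^ p) _ (Finset.mem_univ a),
      tdUpdate_apply_self, Finset.sum_congr rfl fun b hb => by
        rw [tdUpdate_apply_of_ne M σ u pol η Q s a y fun _ => Finset.ne_of_mem_erase hb]]
    ring
  · rw [add_zero]
    exact Finset.sum_congr rfl fun b _ => by
      rw [tdUpdate_apply_of_ne M σ u pol η Q x a y fun hx => absurd hx h]

/-- With even exponents every summand is nonnegative, so the sum dominates the largest entry: the
smooth surrogate controls the sup norm. -/
theorem norm_pow_le_sum_errPow [Nonempty S] [Nonempty A] (Qs Q : S → A → ℝ) (k : ℕ) :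
    ‖Q - Qs‖ ^ (2 * k + 2) ≤ ∑ s, errPow Qs (2 * k + 2) Q s := by
  obtain ⟨s, hs⟩ : ∃ s, ‖Q - Qs‖ = ‖(Q - Qs) s‖ := by
    obtain ⟨s, hs⟩ := Finite.exists_max fun s => ‖(Q - Qs) s‖
    exact ⟨s, le_antisymm ((pi_norm_le_iff_of_nonneg (norm_nonneg _)).2 hs) (norm_le_pi_norm _ s)⟩
  obtain ⟨a, ha⟩ : ∃ a, ‖(Q - Qs) s‖ = ‖(Q - Qs) s a‖ := by
    obtain ⟨a, ha⟩ := Finite.exists_max fun a => ‖(Q - Qs) s a‖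
    exact ⟨a, le_antisymm ((pi_norm_le_iff_of_nonneg (norm_nonneg _)).2 ha) (norm_le_pi_norm _ a)⟩
  rw [hs, ha, Real.norm_eq_abs, Even.pow_abs (by use k + 1; ring)]
  refine le_trans ?_ (Finset.single_le_sum (fun s _ => errPow_nonneg Qs k Q s)
    (Finset.mem_univ s))
  exact Finset.single_le_sum (f := fun a => (Q s a - Qs s a) ^ (2 * k + 2))
    (fun a _ => Even.pow_nonneg (by use k + 1; ring) _) (Finset.mem_univ a)

theorem sum_errPow_le (Qs Q : S → A → ℝ) (k : ℕ) {m : ℝ} (hm : ‖Q - Qs‖ ≤ m) :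
    ∑ s, errPow Qs (2 * k + 2) Q s ≤ Fintype.card S * (Fintype.card A * m ^ (2 * k + 2)) := by
  have h : ∀ s, errPow Qs (2 * k + 2) Q s ≤ Fintype.card A * m ^ (2 * k + 2) := fun s => by
    refine (Finset.sum_le_card_nsmul _ _ (m ^ (2 * k + 2)) fun a _ => ?_).trans (by simp)
    rw [← Even.pow_abs (by use k + 1; ring)]
    exact pow_le_pow_left₀ (abs_nonneg _) ((abs_apply_apply_le_norm (Q - Qs) s a).trans hm) _
  exact (Finset.sum_le_card_nsmul _ _ _ fun s _ => h s).trans (by simp)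

/-- The Lyapunov function of smoothed robust TD: the error powers of the states, weighted by how
long they have to wait for their next visit. -/
def tdPot (h : S → S → ℝ) (Qs : S → A → ℝ) (p : ℕ) (w : ℝ) (z : (S → A → ℝ) × S) : ℝ :=
  ∑ s, (1 + w * h s z.2) * errPow Qs p z.1 s

theorem tdPot_mono {h : S → S → ℝ} (hh : ∀ s x, 0 ≤ h s x) (Qs : S → A → ℝ) (k : ℕ) {w w' : ℝ}
    (hw : w ≤ w') (z : (S → A → ℝ) × S) :
    tdPot h Qs (2 * k + 2) w z ≤ tdPot h Qs (2 * k + 2) w' z :=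
  Finset.sum_le_sum fun s _ => mul_le_mul_of_nonneg_right
    (by have := mul_le_mul_of_nonneg_right hw (hh s z.2); linarith) (errPow_nonneg _ _ _ _)

theorem sum_errPow_le_tdPot {h : S → S → ℝ} (hh : ∀ s x, 0 ≤ h s x) (Qs : S → A → ℝ) (k : ℕ)
    {w : ℝ} (hw : 0 ≤ w) (z : (S → A → ℝ) × S) :
    ∑ s, errPow Qs (2 * k + 2) z.1 s ≤ tdPot h Qs (2 * k + 2) w z := by
  refine le_trans (le_of_eq ?_) (tdPot_mono hh Qs k hw z)
  simp [tdPot]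

theorem tdPot_le {h : S → S → ℝ} {H : ℝ} (hh : ∀ s x, h s x ≤ H) (Qs : S → A → ℝ)
    (k : ℕ) {w : ℝ} (hw : 0 ≤ w) (z : (S → A → ℝ) × S) :
    tdPot h Qs (2 * k + 2) w z ≤ (1 + w * H) * ∑ s, errPow Qs (2 * k + 2) z.1 s := by
  rw [Finset.mul_sum]
  exact Finset.sum_le_sum fun s _ => mul_le_mul_of_nonneg_right
    (by have := mul_le_mul_of_nonneg_left (hh s z.2) hw; linarith) (errPow_nonneg _ _ _ _)

/-- The change of the Lyapunov function along one transition. -/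
theorem tdPot_tdUpdate_le (M : CMDP S A) (σ : ℝ) (u pol : S → A → ℝ) {h : S → S → ℝ} {H : ℝ}
    (hh : ∀ s x, 0 ≤ h s x ∧ h s x ≤ H) (Qs Q : S → A → ℝ) (k : ℕ) {c η W m₀ : ℝ} (hc : 0 ≤ c)
    (hη : 0 ≤ η) (hη1 : η ≤ 1) (x : S) (a : A) (y : S) (hm₀ : ‖Q - Qs‖ ≤ m₀)
    (hW : |tdError M σ u pol Q x a y| ≤ W) :
    tdPot h Qs (2 * k + 2) (c * η) (tdUpdate M σ u pol η Q x a y, y)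
      ≤ ∑ s, (1 + c * η * h s y) * errPow Qs (2 * k + 2) Q s
        + (2 * k + 2) * η * ((Q x a - Qs x a) ^ (2 * k + 1) * tdError M σ u pol Q x a y)
        + ((2 * k + 2) ^ 2 * W ^ 2 + c * H * ((2 * k + 2) * W * (m₀ + W))) * η ^ 2
          * (‖Q - Qs‖ + η * W) ^ (2 * k) := by
  set D := Q x a - Qs x a with hD
  set Y := tdError M σ u pol Q x a y with hY
  set m := ‖Q - Qs‖ with hm
  have hW0 : 0 ≤ W := (abs_nonneg _).trans hW
  have hm0 : 0 ≤ m := norm_nonneg _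
  have hH0 : 0 ≤ H := (hh x x).1.trans (hh x x).2
  have hDm : |D| ≤ m := abs_apply_apply_le_norm (Q - Qs) x a
  have hηY : |η * Y| ≤ η * W := by
    rw [abs_mul, abs_of_nonneg hη]; exact mul_le_mul_of_nonneg_left hW hη
  have hb : |D| + |η * Y| ≤ m + η * W := add_le_add hDm hηY
  have hb0 : 0 ≤ |D| + |η * Y| := by positivity
  have hηW : 0 ≤ η * W := by positivity
  set F := (D + η * Y) ^ (2 * k + 2) - D ^ (2 * k + 2) with hF
  have e1 : tdPot h Qs (2 * k + 2) (c * η) (tdUpdate M σ u pol η Q x a y, y)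
      = ∑ s, (1 + c * η * h s y) * errPow Qs (2 * k + 2) Q s + (1 + c * η * h x y) * F := by
    simp only [tdPot, errPow_tdUpdate, mul_add, Finset.sum_add_distrib, mul_ite, mul_zero,
      Finset.sum_ite_eq', Finset.mem_univ, if_true]
    rw [hF]
  have h1 : F ≤ (2 * k + 2) * η * (D ^ (2 * k + 1) * Y)
      + (2 * k + 2) ^ 2 * W ^ 2 * η ^ 2 * (m + η * W) ^ (2 * k) := by
    have := (le_abs_self _).trans (abs_pow_add_sub_taylor_le D (η * Y) (2 * k))
    push_cast at this
    have h2 : (2 * (k : ℝ) + 2) ^ 2 * (η * Y) ^ 2 * (|D| + |η * Y|) ^ (2 * k)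
        ≤ (2 * (k : ℝ) + 2) ^ 2 * (η * W) ^ 2 * (m + η * W) ^ (2 * k) := by
      have h3 : (η * Y) ^ 2 ≤ (η * W) ^ 2 := by
        rw [← sq_abs]; exact pow_le_pow_left₀ (abs_nonneg _) hηY 2
      gcongr
    calc F = F - (2 * k + 2) * D ^ (2 * k + 1) * (η * Y)
          + (2 * k + 2) * η * (D ^ (2 * k + 1) * Y) := by ring
      _ ≤ (2 * (k : ℝ) + 2) ^ 2 * (η * W) ^ 2 * (m + η * W) ^ (2 * k)
          + (2 * k + 2) * η * (D ^ (2 * k + 1) * Y) := by linarith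
      _ = _ := by ring
  -- The varying part of the weight already carries a factor `η`, so a first-order bound on the
  -- change is enough for a term of order `η²`.
  have h2 : |F| ≤ (2 * k + 2) * (η * W) * ((m₀ + W) * (m + η * W) ^ (2 * k)) := by
    have h3 := abs_pow_add_sub_le D (η * Y) (2 * k + 1)
    push_cast at h3
    have h4 : m + η * W ≤ m₀ + W := add_le_add hm₀ (mul_le_of_le_one_left hW0 hη1)
    calc |F| ≤ (2 * (k : ℝ) + 1 + 1) * |η * Y| * (|D| + |η * Y|) ^ (2 * k + 1) := h3
      _ ≤ (2 * (k : ℝ) + 1 + 1) * (η * W) * (m + η * W) ^ (2 * k + 1) := by gcongr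
      _ = (2 * (k : ℝ) + 2) * (η * W) * ((m + η * W) * (m + η * W) ^ (2 * k)) := by ring
      _ ≤ _ := by gcongr
  have h3 : c * η * h x y * F
      ≤ c * η * H * ((2 * k + 2) * (η * W) * ((m₀ + W) * (m + η * W) ^ (2 * k))) := by
    have h5 : 0 ≤ c * η * h x y := mul_nonneg (by positivity) (hh x y).1
    calc _ ≤ c * η * h x y * |F| := mul_le_mul_of_nonneg_left (le_abs_self _) h5
      _ ≤ c * η * H * ((2 * k + 2) * (η * W) * ((m₀ + W) * (m + η * W) ^ (2 * k))) :=
        mul_le_mul (mul_le_mul_of_nonneg_left (hh x y).2 (by positivity)) h2 (abs_nonneg _)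
          (by positivity)
  rw [e1]
  calc _ = ∑ s, (1 + c * η * h s y) * errPow Qs (2 * k + 2) Q s + (F + c * η * h x y * F) := by
        ring
    _ ≤ _ := add_le_add_right (add_le_add h1 h3) _
    _ = _ := by ring

end TDPotential

/-! ### Averages over one transition. -/

section StepAverage

variable {S A : Type*} [Fintype S] [Fintype A]

/-- The average of `f` over the action and the next state from `x`. -/
def stepAvg (M : CMDP S A) (pol : S → A → ℝ) (x : S) (f : A → S → ℝ) : ℝ :=
  ∑ a, pol x a * ∑ y, (M.P x a y).toReal * f a y

theorem stepAvg_mono (M : CMDP S A) {pol : S → A → ℝ} (hpol : ∀ s, pol s ∈ stdSimplex ℝ A) (x : S)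
    {f g : A → S → ℝ} (h : ∀ a y, f a y ≤ g a y) : stepAvg M pol x f ≤ stepAvg M pol x g :=
  Finset.sum_le_sum fun a _ => mul_le_mul_of_nonneg_left (Finset.sum_le_sum fun y _ =>
    mul_le_mul_of_nonneg_left (h a y) ENNReal.toReal_nonneg) ((hpol x).1 a)

theorem stepAvg_add (M : CMDP S A) (pol : S → A → ℝ) (x : S) (f g : A → S → ℝ) :
    stepAvg M pol x (fun a y => f a y + g a y) = stepAvg M pol x f + stepAvg M pol x g := by
  simp only [stepAvg, mul_add, Finset.sum_add_distrib]

theorem stepAvg_mul (M : CMDP S A) (pol : S → A → ℝ) (x : S) (e : A → ℝ) (f : A → S → ℝ) :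
    stepAvg M pol x (fun a y => e a * f a y)
      = ∑ a, pol x a * (e a * ∑ y, (M.P x a y).toReal * f a y) := by
  simp only [stepAvg, Finset.mul_sum]
  exact Finset.sum_congr rfl fun a _ => Finset.sum_congr rfl fun y _ => by ring

theorem stepAvg_const_mul (M : CMDP S A) (pol : S → A → ℝ) (x : S) (e : ℝ) (f : A → S → ℝ) :
    stepAvg M pol x (fun a y => e * f a y) = e * stepAvg M pol x f := by
  rw [stepAvg_mul M pol x (fun _ => e) f, stepAvg, Finset.mul_sum]
  exact Finset.sum_congr rfl fun a _ => by ring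

theorem stepAvg_const (M : CMDP S A) {pol : S → A → ℝ} (hpol : ∀ s, pol s ∈ stdSimplex ℝ A) (x : S)
    (e : ℝ) : stepAvg M pol x (fun _ _ => e) = e := by
  simp only [stepAvg, ← Finset.sum_mul, sum_toReal_pmf, (hpol x).2, one_mul]

theorem stepAvg_sum {ι : Type*} (t : Finset ι) (M : CMDP S A) (pol : S → A → ℝ) (x : S)
    (f : ι → A → S → ℝ) : stepAvg M pol x (fun a y => ∑ i ∈ t, f i a y)
      = ∑ i ∈ t, stepAvg M pol x (f i) := by
  simp only [stepAvg, Finset.mul_sum]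
  exact (Finset.sum_congr rfl fun a _ => Finset.sum_comm).trans Finset.sum_comm

end StepAverage

/-! ### The expected drift of the TD Lyapunov function. -/

section TDDrift

variable {S A : Type*} [Fintype S] [Fintype A] [DecidableEq S] [DecidableEq A]

/-- The expected change of the error power of the current state. -/
theorem expected_power_drift_le [Nonempty S] (M : CMDP S A) {σ : ℝ} (hσ : σ < 0)
    {u pol : S → A → ℝ} (hpol : ∀ s, pol s ∈ stdSimplex ℝ A) {q : ℝ}
    (hq : ∀ s a, q ≤ pol s a) (Q : S → A → ℝ) (k : ℕ) (x : S) :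
    stepAvg M pol x (fun a y => (Q x a - smoothedQ M σ u pol x a) ^ (2 * k + 1)
        * tdError M σ u pol Q x a y)
      ≤ ((1 + M.γ) / 2) ^ (2 * k + 2) * ‖Q - smoothedQ M σ u pol‖ ^ (2 * k + 2)
        - (1 - M.γ) / (1 + M.γ) * q * errPow (smoothedQ M σ u pol) (2 * k + 2) Q x := by
  set Qs := smoothedQ M σ u pol with hQs
  set B := (1 - M.γ) / (1 + M.γ) with hB
  set m := ‖Q - Qs‖ with hm
  set t := ((1 + M.γ) / 2) ^ (2 * k + 2) * m ^ (2 * k + 2) with ht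
  have hγ0 := M.γ_mem.1
  have hγ1 := M.γ_mem.2
  have hB0 : 0 ≤ B := div_nonneg (by linarith) (by linarith)
  have h1 : ∀ a, (Q x a - Qs x a) ^ (2 * k + 1)
      * ∑ y, (M.P x a y).toReal * tdError M σ u pol Q x a y
        ≤ t - B * (Q x a - Qs x a) ^ (2 * k + 2) := fun a => by
    set D := Q x a - Qs x a with hD
    set Y := ∑ y, (M.P x a y).toReal * tdError M σ u pol Q x a y with hY
    have h2 : |Y + D| ≤ M.γ * m := abs_expected_tdError_add_le M hσ hpol Q x a
    have hDm : |D| ≤ m := abs_apply_apply_le_norm (Q - Qs) x a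
    have hev : |D| ^ (2 * k + 2) = D ^ (2 * k + 2) := Even.pow_abs (by use k + 1; ring) D
    have h3 := contraction_drift_le hγ0 hγ1 (abs_nonneg D) hDm (2 * k + 1)
    -- The exponent is even, so the absolute value introduced for `contraction_drift_le` disappears.
    rw [show 2 * k + 1 + 1 = 2 * k + 2 by ring, hev] at h3
    have h4 : D ^ (2 * k + 1) * (Y + D) ≤ |D| ^ (2 * k + 1) * (M.γ * m) := by
      refine (le_abs_self _).trans ?_
      rw [abs_mul, abs_pow]
      gcongr
    calc D ^ (2 * k + 1) * Y = D ^ (2 * k + 1) * (Y + D) - D ^ (2 * k + 2) := by ring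
      _ ≤ _ := by linarith
  rw [stepAvg_mul]
  calc _ ≤ ∑ a, pol x a * (t - B * (Q x a - Qs x a) ^ (2 * k + 2)) :=
        Finset.sum_le_sum fun a _ => mul_le_mul_of_nonneg_left (h1 a) ((hpol x).1 a)
    _ = t - ∑ a, pol x a * (B * (Q x a - Qs x a) ^ (2 * k + 2)) := by
        simp only [mul_sub, Finset.sum_sub_distrib, ← Finset.sum_mul, (hpol x).2, one_mul]
    _ ≤ t - ∑ a, q * (B * (Q x a - Qs x a) ^ (2 * k + 2)) := by
        refine sub_le_sub_left (Finset.sum_le_sum fun a _ => ?_) _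
        exact mul_le_mul_of_nonneg_right (hq x a)
          (mul_nonneg hB0 (Even.pow_nonneg (by use k + 1; ring) _))
    _ = _ := by rw [errPow, ← Finset.mul_sum, ← Finset.mul_sum]; ring

/-- The expected change of the Lyapunov function of smoothed robust TD. -/
theorem expected_tdPot_le [Nonempty S] [Nonempty A] (M : CMDP S A) {σ : ℝ} (hσ : σ < 0)
    {u pol : S → A → ℝ} (hpol : ∀ s, pol s ∈ stdSimplex ℝ A) {q : ℝ}
    (hq : ∀ s a, q ≤ pol s a) {h : S → S → ℝ} {H : ℝ}
    (hh : ∀ s x, 0 ≤ h s x ∧ h s x ≤ H)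
    (hhit : ∀ s x, stepAvg M pol x (fun _ y => h s y) ≤ h s x - 1 + if s = x then H + 1 else 0)
    {k : ℕ} (hk : ((1 + M.γ) / 2) ^ (2 * k + 2) ≤ (1 - M.γ) / (1 + M.γ) * q / (2 * (H + 1)))
    {c : ℝ} (hc : c = (2 * k + 2) * ((1 - M.γ) / (1 + M.γ)) * q / (H + 1)) (hc0 : 0 ≤ c)
    {Q : S → A → ℝ} {η W m₀ : ℝ} (hη : 0 ≤ η) (hη1 : η ≤ 1)
    (hm₀ : ‖Q - smoothedQ M σ u pol‖ ≤ m₀) (x : S)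
    (hW : ∀ a y, |tdError M σ u pol Q x a y| ≤ W) :
    stepAvg M pol x (fun a y => tdPot h (smoothedQ M σ u pol) (2 * k + 2) (c * η)
        (tdUpdate M σ u pol η Q x a y, y))
      ≤ tdPot h (smoothedQ M σ u pol) (2 * k + 2) (c * η) (Q, x)
        - c / 2 * η * ∑ s, errPow (smoothedQ M σ u pol) (2 * k + 2) Q s
        + ((2 * k + 2) ^ 2 * W ^ 2 + c * H * ((2 * k + 2) * W * (m₀ + W))) * η ^ 2
          * (‖Q - smoothedQ M σ u pol‖ + η * W) ^ (2 * k) := by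
  set Qs := smoothedQ M σ u pol with hQs
  set B := (1 - M.γ) / (1 + M.γ) with hB
  set m := ‖Q - Qs‖ with hm
  set E : S → ℝ := errPow Qs (2 * k + 2) Q with hE
  set N := ((2 * k + 2) ^ 2 * W ^ 2 + c * H * ((2 * k + 2) * W * (m₀ + W))) * η ^ 2
          * (m + η * W) ^ (2 * k) with hN
  have hH1 : 0 < H + 1 := by linarith [(hh x x).1.trans (hh x x).2]
  have hE0 : ∀ s, 0 ≤ E s := fun s => errPow_nonneg Qs k Q s
  have h1 := stepAvg_mono M hpol x fun a y =>
    tdPot_tdUpdate_le M σ u pol hh Qs Q k hc0 hη hη1 x a y hm₀ (hW a y)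
  simp only [← hN, ← hm] at h1
  rw [stepAvg_add M pol x (fun a y => _ + _) (fun a y => N), stepAvg_add,
    stepAvg_const M hpol, stepAvg_const_mul, stepAvg_sum] at h1
  -- The drift of `h` lowers the weighted power of every state by `c η E s`, at the price of `c η (H
  -- + 1) E x` for the state being visited.
  have h2 : ∀ s, stepAvg M pol x (fun _ y => (1 + c * η * h s y) * errPow Qs (2 * k + 2) Q s)
      ≤ (1 + c * η * h s x) * E s - c * η * E s + if s = x then c * η * (H + 1) * E s else 0 :=
    fun s => by
      have e : stepAvg M pol x (fun _ y => (1 + c * η * h s y) * errPow Qs (2 * k + 2) Q s)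
          = E s + c * η * E s * stepAvg M pol x (fun _ y => h s y) := by
        have : (fun (_ : A) y => (1 + c * η * h s y) * errPow Qs (2 * k + 2) Q s)
            = fun _ y => E s + c * η * E s * h s y := by
          funext _ y; rw [← hE]; ring
        rw [this, stepAvg_add M pol x (fun _ _ => E s), stepAvg_const M hpol, stepAvg_const_mul]
      rw [e]
      have h3 := mul_le_mul_of_nonneg_left (hhit s x)
        (mul_nonneg (mul_nonneg hc0 hη) (hE0 s))
      split_ifs at h3 ⊢ <;> linarith
  have h3 := expected_power_drift_le M hσ hpol (u := u) hq Q k x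
  rw [← hQs, ← hm, ← hB] at h3
  have h4 : m ^ (2 * k + 2) ≤ ∑ s, E s := norm_pow_le_sum_errPow Qs Q k
  have h5 : ((1 + M.γ) / 2) ^ (2 * k + 2) * m ^ (2 * k + 2)
      ≤ B * q / (2 * (H + 1)) * ∑ s, E s :=
    mul_le_mul hk h4 (by positivity) (le_trans (pow_nonneg (by linarith [M.γ_mem.1]) _) hk)
  have h6 := mul_le_mul_of_nonneg_left (h3.trans (sub_le_sub_right h5 _))
    (by positivity : 0 ≤ (2 * (k : ℝ) + 2) * η)
  have h7 := Finset.sum_le_sum fun s (_ : s ∈ Finset.univ) => h2 s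
  rw [Finset.sum_add_distrib, Finset.sum_sub_distrib, ← Finset.mul_sum,
    Finset.sum_ite_eq' Finset.univ x, if_pos (Finset.mem_univ x)] at h7
  -- The constant `c` is chosen so that the TD drift at `x` cancels the price of the visit exactly;
  -- by the choice of `k` the cross term consumes only half of the gain `c η ∑ E`.
  have e1 : (2 * (k : ℝ) + 2) * η * (B * q / (2 * (H + 1)) * ∑ s, E s - B * q * E x)
      = c / 2 * η * ∑ s, E s - c * η * (H + 1) * E x := by
    rw [hc]; field_simp
  rw [e1] at h6
  have e2 : tdPot h Qs (2 * k + 2) (c * η) (Q, x) = ∑ s, (1 + c * η * h s x) * E s := rfl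
  rw [e2]
  linarith

end TDDrift

/-! ### The mean square rate of TD. -/

section TDRate

variable {S A : Type*} [Fintype S] [Fintype A] [DecidableEq S] [DecidableEq A]

/-- Applied to `n ‖Q - Q*‖²`, this passes from the moment of order `2k + 2` to the second moment in
place of Jensen's inequality. -/
theorem le_one_add_pow {x : ℝ} (hx : 0 ≤ x) (n : ℕ) : x ≤ 1 + x ^ (n + 1) := by
  rcases le_total x 1 with h | h
  · linarith [pow_nonneg hx (n + 1)]
  · have := le_self_pow₀ h (by omega : n + 1 ≠ 0)
    linarith

/-- One step of the recursion for the expected Lyapunov function of smoothed robust TD. -/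
theorem expected_tdPot_contract [Nonempty S] [Nonempty A] (M : CMDP S A) {σ : ℝ} (hσ : σ < 0)
    {u pol : S → A → ℝ} (hu : ∀ s a, u s a ∈ Set.Icc (0 : ℝ) 1)
    (hpol : ∀ s, pol s ∈ stdSimplex ℝ A) {q : ℝ}
    (hq : ∀ s a, q ≤ pol s a) {h : S → S → ℝ} {H : ℝ}
    (hh : ∀ s x, 0 ≤ h s x ∧ h s x ≤ H)
    (hhit : ∀ s x, stepAvg M pol x (fun _ y => h s y) ≤ h s x - 1 + if s = x then H + 1 else 0)
    {k : ℕ} (hk : ((1 + M.γ) / 2) ^ (2 * k + 2) ≤ (1 - M.γ) / (1 + M.γ) * q / (2 * (H + 1)))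
    {c : ℝ} (hc : c = (2 * k + 2) * ((1 - M.γ) / (1 + M.γ)) * q / (H + 1)) (hc0 : 0 < c)
    {R D : ℝ} (hR : 1 + Real.log (Fintype.card S) / |σ| ≤ (1 - M.γ) * R)
    (hD : ∀ m η : ℝ, 0 ≤ m → 0 ≤ η → η ≤ 1 →
      ((2 * k + 2) ^ 2 * (2 * R) ^ 2 + c * H * ((2 * k + 2) * (2 * R) * (R + Csig M σ + 2 * R)))
        * η ^ 2 * (m + η * (2 * R)) ^ (2 * k) ≤ c / 4 * η * m ^ (2 * k + 2) + D * η ^ (k + 2))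
    {Q : S → A → ℝ} (hQ : ‖Q‖ ≤ R) {η η' : ℝ} (hη : 0 ≤ η) (hη1 : η ≤ 1) (hη' : η' ≤ η) (x : S) :
    stepAvg M pol x (fun a y => tdPot h (smoothedQ M σ u pol) (2 * k + 2) (c * η')
        (tdUpdate M σ u pol η Q x a y, y))
      ≤ (1 - c / (4 * (1 + c * H)) * η)
          * tdPot h (smoothedQ M σ u pol) (2 * k + 2) (c * η) (Q, x) + D * η ^ (k + 2) := by
  set Qs := smoothedQ M σ u pol with hQs
  have hm₀ : ‖Q - Qs‖ ≤ R + Csig M σ := (norm_sub_le _ _).trans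
    (add_le_add hQ (norm_smoothedQ_le M hσ hu (hpol)))
  have hH0 : 0 ≤ H := (hh x x).1.trans (hh x x).2
  have h1 := expected_tdPot_le M hσ hpol (u := u) hq hh hhit hk hc hc0.le hη hη1 hm₀ x
    fun a y => abs_tdError_le M hσ hu hpol hQ hR x a y
  have h2 := stepAvg_mono M hpol x fun a y => tdPot_mono (fun s x => (hh s x).1) Qs k
    (mul_le_mul_of_nonneg_left hη' hc0.le) (tdUpdate M σ u pol η Q x a y, y)
  have h3 := hD ‖Q - Qs‖ η (norm_nonneg _) hη hη1
  have h4 := mul_le_mul_of_nonneg_left (norm_pow_le_sum_errPow Qs Q k)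
    (by positivity : 0 ≤ c / 4 * η)
  have h5 : c / (4 * (1 + c * H)) * η * tdPot h Qs (2 * k + 2) (c * η) (Q, x)
      ≤ c / 4 * η * ∑ s, errPow Qs (2 * k + 2) Q s := by
    have h6 : tdPot h Qs (2 * k + 2) (c * η) (Q, x)
        ≤ (1 + c * H) * ∑ s, errPow Qs (2 * k + 2) Q s := by
      refine (tdPot_mono (fun s x => (hh s x).1) Qs k
        (mul_le_of_le_one_right hc0.le hη1) (Q, x)).trans ?_
      exact tdPot_le (fun s x => (hh s x).2) Qs k hc0.le (Q, x)
    calc _ ≤ c / (4 * (1 + c * H)) * η * ((1 + c * H) * ∑ s, errPow Qs (2 * k + 2) Q s) :=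
          mul_le_mul_of_nonneg_left h6 (by positivity)
      _ = _ := by field_simp
  rw [← hQs] at h1
  linarith

/-- Smoothed robust TD converges at the rate `1 / n` in mean square, uniformly over the policies
that take every action with probability at least `q`. -/
theorem exists_td_rate [Nonempty S] [Nonempty A] (M : CMDP S A) {σ : ℝ} (hσ : σ < 0) {q : ℝ}
    (hq : 0 < q) (hreach : ∀ s s', Relation.ReflTransGen (fun x y => ∃ a, M.P x a y ≠ 0) s s')
    (Q₀ : S → A → ℝ) (s₀ : S) :
    ∃ (η : ℕ → ℝ) (C : ℝ), (∀ n, 0 < η n ∧ η n ≤ 1) ∧ 0 < C ∧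
      ∀ u : S → A → ℝ, (∀ s a, u s a ∈ Set.Icc (0 : ℝ) 1) →
      ∀ pol : S → A → ℝ, (∀ s, pol s ∈ stdSimplex ℝ A) → (∀ s a, q ≤ pol s a) → ∀ n : ℕ,
        n * expect (tdOutput M σ u pol η Q₀ s₀ n) (fun Q => ‖Q - smoothedQ M σ u pol‖ ^ 2)
          ≤ C := by
  obtain ⟨h, H, hH, hh, hhit⟩ := exists_hitting_function M hq hreach
  have hγ0 := M.γ_mem.1
  have hγ1 := M.γ_mem.2
  have h1γ := M.one_sub_γ_pos
  have hB : 0 < (1 - M.γ) / (1 + M.γ) := by positivity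
  obtain ⟨k, hk⟩ : ∃ k : ℕ, ((1 + M.γ) / 2) ^ (2 * k + 2)
      ≤ (1 - M.γ) / (1 + M.γ) * q / (2 * (H + 1)) := by
    obtain ⟨k, hk⟩ := exists_pow_lt_of_lt_one
      (by positivity : 0 < (1 - M.γ) / (1 + M.γ) * q / (2 * (H + 1)))
      (by linarith : (1 + M.γ) / 2 < 1)
    exact ⟨k, (pow_le_pow_of_le_one (by positivity) (by linarith) (by omega)).trans hk.le⟩
  obtain ⟨c, hc⟩ : ∃ c, c = (2 * k + 2) * ((1 - M.γ) / (1 + M.γ)) * q / (H + 1) := ⟨_, rfl⟩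
  have hc0 : 0 < c := by rw [hc]; positivity
  set R : ℝ := max ‖Q₀‖ ((1 + Real.log (Fintype.card S) / |σ|) / (1 - M.γ)) with hR
  have hR0 : 0 ≤ R := (norm_nonneg _).trans (le_max_left _ _)
  have hR1 : 1 + Real.log (Fintype.card S) / |σ| ≤ (1 - M.γ) * R := by
    have := le_max_right ‖Q₀‖ ((1 + Real.log (Fintype.card S) / |σ|) / (1 - M.γ))
    rw [← hR, div_le_iff₀ h1γ] at this
    linarith
  have hCs := Csig_pos M σ
  obtain ⟨D, hD0, hD⟩ := exists_noise_absorb k (W := 2 * R) (by positivity)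
    (C := (2 * k + 2) ^ 2 * (2 * R) ^ 2
      + c * H * ((2 * k + 2) * (2 * R) * (R + Csig M σ + 2 * R)))
    (by positivity) (κ := c / 4) (by positivity)
  set a : ℝ := c / (4 * (1 + c * H)) with ha
  have ha0 : 0 < a := by positivity
  -- Gives `a c₂ = k + 2`, the value that `recursion_rate` needs for the order `k + 1`; the shift
  -- `n₀` keeps the step sizes at most one.
  set c₂ : ℝ := ((k + 1 : ℕ) + 1) / a with hc₂
  have hc₂0 : 0 < c₂ := by positivity
  set n₀ : ℕ := max (k + 1 + 1) ⌈c₂⌉₊ with hn₀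
  have hn₀1 : k + 1 + 1 ≤ n₀ := le_max_left _ _
  have hn₀2 : c₂ ≤ n₀ := (Nat.le_ceil c₂).trans (by exact_mod_cast le_max_right _ _)
  have hn₀0 : (0 : ℝ) < n₀ := hc₂0.trans_le hn₀2
  set η : ℕ → ℝ := fun n => c₂ / (n + n₀ : ℝ) with hη
  have hηpos : ∀ n, 0 < η n := fun n => by simp only [hη]; positivity
  have hη1 : ∀ n, η n ≤ 1 := fun n => by
    simp only [hη]
    rw [div_le_one (by positivity)]
    linarith [(Nat.cast_nonneg n : (0 : ℝ) ≤ n)]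
  have hηanti : ∀ n, η (n + 1) ≤ η n := fun n => by
    simp only [hη]
    gcongr
    linarith
  set E₀ : ℝ := (1 + c * H) * (Fintype.card S * (Fintype.card A * (R + Csig M σ) ^ (2 * k + 2)))
    with hE₀
  set D' : ℝ := max (E₀ * n₀ ^ (k + 1)) (D * c₂ ^ (k + 1 + 1)) with hD'
  have hD'0 : 0 ≤ D' := le_max_of_le_right (by positivity)
  refine ⟨η, 1 + D', fun n => ⟨hηpos n, hη1 n⟩, by positivity, fun u hu pol hpol hqpol n => ?_⟩
  set Qs := smoothedQ M σ u pol with hQs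
  have hfin := finite_support_tdLaw M σ u pol η Q₀ s₀
  have hbound : ∀ n, ∀ z ∈ (tdLaw M σ u pol η Q₀ s₀ n).support, ‖z.1‖ ≤ R :=
    tdLaw_support_induction M σ u pol η Q₀ s₀ (p := fun Q => ‖Q‖ ≤ R) (le_max_left _ _)
      fun n Q s a s' hQ => norm_tdUpdate_le M hσ hu hpol hQ hR1 (hηpos n).le (hη1 n) s a s'
  set e : ℕ → ℝ := fun n => expect (tdLaw M σ u pol η Q₀ s₀ n)
    (tdPot h Qs (2 * k + 2) (c * η n)) with he
  have hrate : e n ≤ D' / (n + n₀ : ℝ) ^ (k + 1) := by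
    refine recursion_rate (a := a) (c := c₂) (C := D) hn₀1 ?_ ?_ (le_max_right _ _) hD'0 ?_ n
    · rw [hc₂]; field_simp
    · refine le_trans ?_ (le_max_left _ _)
      refine mul_le_mul_of_nonneg_right ?_ (by positivity)
      simp only [he, tdLaw, expect_pure]
      refine (tdPot_mono (fun s x => (hh s x).1) Qs k
        (mul_le_of_le_one_right hc0.le (hη1 0)) (Q₀, s₀)).trans ?_
      refine (tdPot_le (fun s x => (hh s x).2) Qs k hc0.le (Q₀, s₀)).trans ?_
      refine mul_le_mul_of_nonneg_left (sum_errPow_le Qs Q₀ k ?_) (by positivity)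
      exact (norm_sub_le _ _).trans
        (add_le_add (le_max_left _ _) (norm_smoothedQ_le M hσ hu hpol))
    · intro n
      change expect _ _ ≤ (1 - a * η n) * expect _ _ + D * η n ^ (k + 1 + 1)
      rw [expect_tdLaw_succ M σ u hpol, ← expect_const_mul, ← expect_const (hfin n) (D * _),
        ← expect_add (hfin n)]
      refine expect_mono (hfin n) fun z hz => ?_
      exact expected_tdPot_contract M hσ hu hpol hqpol hh (hhit pol hpol hqpol) hk hc hc0 hR1 hD
        (hbound n z hz) (hηpos n).le (hη1 n) (hηanti n) z.2
  rw [tdOutput, expect_map (hfin n), ← expect_const_mul]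
  have hle : expect (tdLaw M σ u pol η Q₀ s₀ n) (fun z => n * ‖z.1 - Qs‖ ^ 2)
      ≤ 1 + n ^ (k + 1) * e n := by
    simp only [he]
    rw [← expect_const_mul, ← expect_const (hfin n) (1 : ℝ), ← expect_add (hfin n)]
    refine expect_mono (hfin n) fun z _ => ?_
    refine (le_one_add_pow (by positivity) k).trans ?_
    rw [mul_pow, ← pow_mul, show 2 * (k + 1) = 2 * k + 2 by ring]
    gcongr
    exact (norm_pow_le_sum_errPow Qs z.1 k).trans
      (sum_errPow_le_tdPot (fun s x => (hh s x).1) Qs k (mul_nonneg hc0.le (hηpos n).le) z)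
  refine hle.trans ?_
  have h1 : (n : ℝ) ^ (k + 1) * e n ≤ (n + n₀ : ℝ) ^ (k + 1) * (D' / (n + n₀ : ℝ) ^ (k + 1)) := by
    have he0 : 0 ≤ e n := by
      simp only [he]
      rw [← expect_const (hfin n) (0 : ℝ)]
      exact expect_mono (hfin n) fun z _ => le_trans
        (Finset.sum_nonneg fun s _ => errPow_nonneg Qs k z.1 s)
        (sum_errPow_le_tdPot (fun s x => (hh s x).1) Qs k (mul_nonneg hc0.le (hηpos n).le) z)
    have : (n : ℝ) ≤ n + n₀ := by linarith
    gcongr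
  rw [mul_div_cancel₀ _ (by positivity)] at h1
  linarith

end TDRate

/-! ### The online algorithm in expectation. -/

section OnlineLaw

variable {S A : Type*} [Fintype S] [Fintype A] [DecidableEq S] [DecidableEq A] [Nonempty A] {d : ℕ}

theorem finite_support_tdOutput (M : CMDP S A) (σ : ℝ) (u pol : S → A → ℝ) (η : ℕ → ℝ)
    (Q₀ : S → A → ℝ) (s₀ : S) (n : ℕ) : (tdOutput M σ u pol η Q₀ s₀ n).support.Finite := by
  rw [tdOutput, PMF.support_map]
  exact (finite_support_tdLaw M σ u pol η Q₀ s₀ n).image _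

theorem finite_support_rpdLaw (M : CMDP S A) (PC : PolicyClass S A d) (σ : ℝ) (p : StepParams)
    (η : ℕ → ℝ) (Q₀ : S → A → ℝ) (s₀ : S) (Tin : ℕ → ℕ) (x₁ : ℝ × Param d) (n : ℕ) :
    (rpdLaw M PC σ p η Q₀ s₀ Tin x₁ n).support.Finite := by
  induction n with
  | zero => simp [rpdLaw]
  | succ n ih =>
    exact finite_support_bind ih fun h _ =>
      finite_support_bind (finite_support_tdOutput ..) fun Qr _ =>
        finite_support_bind (finite_support_tdOutput ..) fun Qc _ => by simp

theorem expect_rpdLaw_succ (M : CMDP S A) (PC : PolicyClass S A d) (σ : ℝ) (p : StepParams)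
    (η : ℕ → ℝ) (Q₀ : S → A → ℝ) (s₀ : S) (Tin : ℕ → ℕ) (x₁ : ℝ × Param d) (n : ℕ)
    (f : (ℕ → ℝ × Param d) → ℝ) :
    expect (rpdLaw M PC σ p η Q₀ s₀ Tin x₁ (n + 1)) f
      = expect (rpdLaw M PC σ p η Q₀ s₀ Tin x₁ n) fun h =>
        expect (tdOutput M σ M.r (PC.π (h (n + 1)).2) η Q₀ s₀ (Tin (n + 1))) fun Qr =>
          expect (tdOutput M σ M.c (PC.π (h (n + 1)).2) η Q₀ s₀ (Tin (n + 1))) fun Qc =>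
            f (Function.update h (n + 2) (rpdStep M PC σ p (n + 1) (h (n + 1)) Qr Qc)) := by
  rw [rpdLaw, expect_bind (finite_support_rpdLaw ..) fun h _ =>
    finite_support_bind (finite_support_tdOutput ..) fun Qr _ =>
      finite_support_bind (finite_support_tdOutput ..) fun Qc _ => by simp]
  congr 1
  funext h
  rw [expect_bind (finite_support_tdOutput ..) fun Qr _ =>
    finite_support_bind (finite_support_tdOutput ..) fun Qc _ => by simp]
  congr 1
  funext Qr
  rw [expect_bind (finite_support_tdOutput ..) fun Qc _ => by simp]
  simp only [expect_pure]

theorem feasible_of_mem_support_rpdLaw (M : CMDP S A) (PC : PolicyClass S A d) (σ : ℝ)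
    {p : StepParams} (hΛ : 0 ≤ p.Λ) (η : ℕ → ℝ) (Q₀ : S → A → ℝ) (s₀ : S) (Tin : ℕ → ℕ)
    {x₁ : ℝ × Param d} (hx₁ : Feasible PC p x₁) (n : ℕ) :
    ∀ h ∈ (rpdLaw M PC σ p η Q₀ s₀ Tin x₁ n).support, Feasible PC p (h (n + 1)) := by
  cases n with
  | zero =>
    intro h hh
    rw [rpdLaw, PMF.support_pure, Set.mem_singleton_iff] at hh
    rw [hh]; exact hx₁
  | succ n =>
    intro h hh
    rw [rpdLaw, PMF.mem_support_bind_iff] at hh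
    obtain ⟨h', -, hh⟩ := hh
    rw [PMF.mem_support_bind_iff] at hh
    obtain ⟨Qr, -, hh⟩ := hh
    rw [PMF.mem_support_bind_iff] at hh
    obtain ⟨Qc, -, hh⟩ := hh
    rw [PMF.support_pure, Set.mem_singleton_iff] at hh
    rw [hh, Function.update_self]
    exact feasible_rpdStep M PC σ hΛ _ _ _ _

/-- The expected potential of the online algorithm together with the accumulated gradient
mappings. -/
theorem expect_pot_add_sum_le [Nonempty S] (M : CMDP S A) (PC : PolicyClass S A d)
    {σ : ℝ} {p : StepParams} (hΛ : 0 ≤ p.Λ) {κ C₁ B : ℝ} {t₀ : ℕ} (hC₁ : 0 ≤ C₁)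
    (hpot : ∀ t, 1 ≤ t → ∀ x, Feasible PC p x → |potAt M PC σ p t x| ≤ B)
    (hdec : ∀ t, t₀ ≤ t → ∀ x, Feasible PC p x → ∀ Qr Qc : S → A → ℝ,
        potAt M PC σ p (t + 1) (rpdStep M PC σ p t x Qr Qc)
            + κ / Real.sqrt t * ‖gradMap M PC σ p t x‖ ^ 2
          ≤ potAt M PC σ p t x + C₁ * (‖Qr - smoothedQ M σ M.r (PC.π x.2)‖ ^ 2
            + ‖Qc - smoothedQ M σ M.c (PC.π x.2)‖ ^ 2) + C₁ / t)
    {η : ℕ → ℝ} {Q₀ : S → A → ℝ} {s₀ : S} {Tin : ℕ → ℕ}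
    (htd : ∀ θ ∈ PC.Θ, ∀ t, 1 ≤ t →
      expect (tdOutput M σ M.r (PC.π θ) η Q₀ s₀ (Tin t))
        (fun Q => ‖Q - smoothedQ M σ M.r (PC.π θ)‖ ^ 2) ≤ 1 / t ∧
      expect (tdOutput M σ M.c (PC.π θ) η Q₀ s₀ (Tin t))
        (fun Q => ‖Q - smoothedQ M σ M.c (PC.π θ)‖ ^ 2) ≤ 1 / t)
    {x₁ : ℝ × Param d} (hx₁ : Feasible PC p x₁) {N : ℕ} (hN : t₀ ≤ N) {n : ℕ} (hn : N ≤ n + 1)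
    (hN1 : 1 ≤ N) :
    expect (rpdLaw M PC σ p η Q₀ s₀ Tin x₁ n) (fun h => potAt M PC σ p (n + 1) (h (n + 1))
        + ∑ t ∈ Finset.Ico N (n + 1), κ / Real.sqrt t * ‖gradMap M PC σ p t (h t)‖ ^ 2)
      ≤ B + 3 * C₁ * ∑ t ∈ Finset.Ico N (n + 1), 1 / (t : ℝ) := by
  have hfin := finite_support_rpdLaw M PC σ p η Q₀ s₀ Tin x₁
  have hfeas := feasible_of_mem_support_rpdLaw M PC σ hΛ η Q₀ s₀ Tin hx₁
  -- After `n` iterations the newest iterate has index `n + 1`, so the induction on `n` starts at `N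
  -- - 1`.
  obtain ⟨m, rfl⟩ : ∃ m, N = m + 1 := ⟨N - 1, by omega⟩
  have hmn : m ≤ n := by omega
  clear hn
  induction n, hmn using Nat.le_induction with
  | base =>
    simp only [Finset.Ico_self, Finset.sum_empty, add_zero, mul_zero]
    rw [← expect_const (hfin m) B]
    exact expect_mono (hfin m) fun h hh =>
      (le_abs_self _).trans (hpot _ (by omega) _ (hfeas m h hh))
  | succ n hmn ih =>
    rw [expect_rpdLaw_succ,
      Finset.sum_Ico_succ_top (by omega : m + 1 ≤ n + 1) (fun t => 1 / (t : ℝ))]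
    set J : (ℕ → ℝ × Param d) → ℝ := fun h => potAt M PC σ p (n + 1) (h (n + 1))
        + ∑ t ∈ Finset.Ico (m + 1) (n + 1), κ / Real.sqrt t * ‖gradMap M PC σ p t (h t)‖ ^ 2
      with hJ
    have hstep : ∀ h ∈ (rpdLaw M PC σ p η Q₀ s₀ Tin x₁ n).support,
        expect (tdOutput M σ M.r (PC.π (h (n + 1)).2) η Q₀ s₀ (Tin (n + 1))) (fun Qr =>
          expect (tdOutput M σ M.c (PC.π (h (n + 1)).2) η Q₀ s₀ (Tin (n + 1))) fun Qc =>
            potAt M PC σ p (n + 1 + 1) (Function.update h (n + 2)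
              (rpdStep M PC σ p (n + 1) (h (n + 1)) Qr Qc) (n + 1 + 1))
            + ∑ t ∈ Finset.Ico (m + 1) (n + 1 + 1), κ / Real.sqrt t * ‖gradMap M PC σ p t
              (Function.update h (n + 2) (rpdStep M PC σ p (n + 1) (h (n + 1)) Qr Qc) t)‖ ^ 2)
        ≤ J h + 3 * C₁ * (1 / ((n + 1 : ℕ) : ℝ)) := by
      intro h hh
      have hf := hfeas n h hh
      obtain ⟨h1, h2⟩ := htd _ hf.2 (n + 1) (by omega)
      have hfr := finite_support_tdOutput M σ M.r (PC.π (h (n + 1)).2) η Q₀ s₀ (Tin (n + 1))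
      have hfc := finite_support_tdOutput M σ M.c (PC.π (h (n + 1)).2) η Q₀ s₀ (Tin (n + 1))
      set Er : (S → A → ℝ) → ℝ := fun Q => ‖Q - smoothedQ M σ M.r (PC.π (h (n + 1)).2)‖ ^ 2
      set Ec : (S → A → ℝ) → ℝ := fun Q => ‖Q - smoothedQ M σ M.c (PC.π (h (n + 1)).2)‖ ^ 2
      -- The update writes only entry `n + 2`, so the gradient mappings already summed are unchanged
      -- and one deterministic decrease applies.
      have hpoint : ∀ Qr Qc, potAt M PC σ p (n + 1 + 1) (Function.update h (n + 2)
              (rpdStep M PC σ p (n + 1) (h (n + 1)) Qr Qc) (n + 1 + 1))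
            + ∑ t ∈ Finset.Ico (m + 1) (n + 1 + 1), κ / Real.sqrt t * ‖gradMap M PC σ p t
              (Function.update h (n + 2) (rpdStep M PC σ p (n + 1) (h (n + 1)) Qr Qc) t)‖ ^ 2
          ≤ (J h + C₁ / ((n + 1 : ℕ) : ℝ) + C₁ * Er Qr) + C₁ * Ec Qc := fun Qr Qc => by
        rw [Function.update_self, Finset.sum_congr rfl fun t ht => by
          rw [Function.update_of_ne (by have := (Finset.mem_Ico.1 ht).2; omega : t ≠ n + 2)],
          Finset.sum_Ico_succ_top (by omega)]
        have := hdec (n + 1) (by omega) _ hf Qr Qc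
        simp only [hJ, Er, Ec]
        linarith
      have hin : ∀ Qr, expect (tdOutput M σ M.c (PC.π (h (n + 1)).2) η Q₀ s₀ (Tin (n + 1)))
          (fun Qc => (J h + C₁ / ((n + 1 : ℕ) : ℝ) + C₁ * Er Qr) + C₁ * Ec Qc)
          ≤ (J h + C₁ / ((n + 1 : ℕ) : ℝ) + C₁ * (1 / ((n + 1 : ℕ) : ℝ))) + C₁ * Er Qr :=
        fun Qr => by
          rw [expect_add hfc, expect_const hfc, expect_const_mul]
          linarith [mul_le_mul_of_nonneg_left h2 hC₁]
      refine (expect_mono hfr fun Qr _ =>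
        (expect_mono hfc fun Qc _ => hpoint Qr Qc).trans (hin Qr)).trans ?_
      rw [expect_add hfr, expect_const hfr, expect_const_mul]
      have e : C₁ / ((n + 1 : ℕ) : ℝ) = C₁ * (1 / ((n + 1 : ℕ) : ℝ)) := by ring
      linarith [mul_le_mul_of_nonneg_left h1 hC₁]
    refine (expect_mono (hfin n) hstep).trans ?_
    rw [expect_add (hfin n), expect_const (hfin n)]
    linarith

/-- Convergence of the online algorithm. -/
theorem expect_iInf_gradMap_le [Nonempty S] (M : CMDP S A) (PC : PolicyClass S A d)
    {σ : ℝ} {p : StepParams} (hΛ : 0 ≤ p.Λ) {κ C₁ B CT : ℝ} {t₀ : ℕ}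
    (hκ : 0 < κ) (hC₁ : 0 ≤ C₁) (ht₀ : 1 ≤ t₀)
    (hpot : ∀ t, 1 ≤ t → ∀ x, Feasible PC p x → |potAt M PC σ p t x| ≤ B)
    (hdec : ∀ t, t₀ ≤ t → ∀ x, Feasible PC p x → ∀ Qr Qc : S → A → ℝ,
        potAt M PC σ p (t + 1) (rpdStep M PC σ p t x Qr Qc)
            + κ / Real.sqrt t * ‖gradMap M PC σ p t x‖ ^ 2
          ≤ potAt M PC σ p t x + C₁ * (‖Qr - smoothedQ M σ M.r (PC.π x.2)‖ ^ 2
            + ‖Qc - smoothedQ M σ M.c (PC.π x.2)‖ ^ 2) + C₁ / t)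
    (hCT : (2 * t₀ + 2 : ℝ) ≤ CT) (hCT' : (3 * (2 * B + 6 * C₁ + 1) / κ) ^ 2 ≤ CT)
    {η : ℕ → ℝ} {Q₀ : S → A → ℝ} {s₀ : S} {Tin : ℕ → ℕ}
    (htd : ∀ θ ∈ PC.Θ, ∀ t, 1 ≤ t →
      expect (tdOutput M σ M.r (PC.π θ) η Q₀ s₀ (Tin t))
        (fun Q => ‖Q - smoothedQ M σ M.r (PC.π θ)‖ ^ 2) ≤ 1 / t ∧
      expect (tdOutput M σ M.c (PC.π θ) η Q₀ s₀ (Tin t))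
        (fun Q => ‖Q - smoothedQ M σ M.c (PC.π θ)‖ ^ 2) ≤ 1 / t)
    {ε : ℝ} (hε : 0 < ε) (hε1 : ε ≤ 1) {x₁ : ℝ × Param d} (hx₁ : Feasible PC p x₁) :
    expect (rpdLaw M PC σ p η Q₀ s₀ Tin x₁ (numIter CT ε))
      (fun x => ⨅ t : Finset.Icc 1 (numIter CT ε), ‖gradMap M PC σ p t (x t)‖) ≤ ε := by
  have hT := two_le_numIter hCT hε hε1
  have hR := le_mul_sqrt_numIter (R := 2 * B + 6 * C₁ + 1) hκ hε hCT'
  set T := numIter CT ε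
  set N := (T + 1) / 2 with hN
  have hfin := finite_support_rpdLaw M PC σ p η Q₀ s₀ Tin x₁ T
  have hfeas := feasible_of_mem_support_rpdLaw M PC σ hΛ η Q₀ s₀ Tin hx₁ T
  have h1 := expect_pot_add_sum_le M PC hΛ hC₁ hpot hdec htd hx₁ (N := N) (by omega)
    (n := T) (by omega) (by omega)
  have h2 := sum_inv_Ico_le (T := T) (n := T + 1) (by omega) le_rfl
  set I : (ℕ → ℝ × Param d) → ℝ := fun x => ⨅ t : Finset.Icc 1 T, ‖gradMap M PC σ p t (x t)‖
    with hI
  have hI0 : ∀ x, 0 ≤ I x := fun x => Real.iInf_nonneg fun t => norm_nonneg _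
  have hIle : ∀ x, ∀ t, 1 ≤ t → t ≤ T → I x ≤ ‖gradMap M PC σ p t (x t)‖ := fun x t ht htT =>
    ciInf_le (f := fun t : Finset.Icc 1 T => ‖gradMap M PC σ p t (x t)‖)
      ⟨0, by rintro _ ⟨t, rfl⟩; exact norm_nonneg _⟩ ⟨t, Finset.mem_Icc.2 ⟨ht, htT⟩⟩
  set w : ℝ := κ * (Real.sqrt T / 3) with hw
  have hw0 : 0 < w := by
    have : (0 : ℝ) < T := by exact_mod_cast (by omega : 0 < T)
    have := Real.sqrt_pos.2 this
    positivity
  have h3 : ∀ x, w * I x ^ 2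
      ≤ ∑ t ∈ Finset.Ico N (T + 1), κ / Real.sqrt t * ‖gradMap M PC σ p t (x t)‖ ^ 2 := fun x => by
    calc w * I x ^ 2 ≤ κ * (∑ t ∈ Finset.Ico N T, 1 / Real.sqrt t) * I x ^ 2 := by
          rw [hw]; gcongr; exact sqrt_div_three_le_sum (by omega)
      _ = ∑ t ∈ Finset.Ico N T, κ / Real.sqrt t * I x ^ 2 := by
          rw [Finset.mul_sum, Finset.sum_mul]
          exact Finset.sum_congr rfl fun t _ => by ring
      _ ≤ ∑ t ∈ Finset.Ico N T, κ / Real.sqrt t * ‖gradMap M PC σ p t (x t)‖ ^ 2 := by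
          refine Finset.sum_le_sum fun t ht => ?_
          rw [Finset.mem_Ico] at ht
          have := hIle x t (by omega) (by omega)
          have := hI0 x
          gcongr
      _ ≤ _ := by
          refine Finset.sum_le_sum_of_subset_of_nonneg
            (Finset.Ico_subset_Ico_right (by omega)) fun t _ _ => by positivity
  have h4 : expect (rpdLaw M PC σ p η Q₀ s₀ Tin x₁ T) (fun x => -B + w * I x ^ 2)
      ≤ B + 3 * C₁ * 2 := by
    refine (expect_mono hfin fun x hx => ?_).trans
      (h1.trans (add_le_add_right (mul_le_mul_of_nonneg_left h2 (by positivity)) B))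
    exact add_le_add (abs_le.1 (hpot _ (by omega) _ (hfeas x hx))).1 (h3 x)
  rw [expect_add hfin, expect_const hfin, expect_const_mul] at h4
  have h5 : expect (rpdLaw M PC σ p η Q₀ s₀ Tin x₁ T) (fun x => I x ^ 2) ≤ ε ^ 2 := by
    refine le_of_mul_le_mul_left ?_ hw0
    linarith
  -- From the second moment to the first by `2 ε I ≤ ε² + I²`.
  have h6 : expect (rpdLaw M PC σ p η Q₀ s₀ Tin x₁ T) (fun x => 2 * ε * I x)
      ≤ expect (rpdLaw M PC σ p η Q₀ s₀ Tin x₁ T) (fun x => ε ^ 2 + I x ^ 2) :=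
    expect_mono hfin fun x _ => by nlinarith [sq_nonneg (I x - ε)]
  rw [expect_add hfin, expect_const hfin, expect_const_mul] at h6
  refine le_of_mul_le_mul_left ?_ (by positivity : 0 < 2 * ε)
  linarith

end OnlineLaw

/-! ### Counting samples. -/

section SampleCount

/-- The total number of samples of the online algorithm. -/
theorem totalSamples_le {Cin CT ε : ℝ} (hCin : 0 < Cin) (hCT : 0 < CT) (hε : 0 < ε) (hε1 : ε ≤ 1) :
    (totalSamples (fun t => numInner Cin (estAccuracy 1 ε t)) (numIter CT ε) : ℝ)
      ≤ 2 * (Cin + 1) * (CT + 1) ^ (5 / 2 : ℝ) / ε ^ 14 := by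
  set T := numIter CT ε with hT
  have hε4 : ε ^ 4 ≤ 1 := pow_le_one₀ hε.le hε1
  have hTle : (T : ℝ) ≤ (CT + 1) / ε ^ 4 := by
    have h1 := (Nat.ceil_lt_add_one (by positivity : 0 ≤ CT / ε ^ 4)).le
    have h2 : (1 : ℝ) ≤ 1 / ε ^ 4 := by rw [le_div_iff₀ (by positivity)]; linarith
    rw [add_div]
    exact h1.trans (by linarith)
  have hterm : ∀ t ∈ Finset.Icc 1 T, ((numInner Cin (estAccuracy 1 ε t)
      + numInner Cin (estAccuracy 1 ε t) : ℕ) : ℝ)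
        -- Every iteration is charged the cost of the last one; this loses only a constant in the
        -- order `T^{5/2}`.
        ≤ 2 * (Cin + 1) / ε ^ 4 * (T : ℝ) ^ (3 / 2 : ℝ) := fun t ht => by
    rw [Finset.mem_Icc] at ht
    have ht1 : (1 : ℝ) ≤ t := by exact_mod_cast ht.1
    have htT : (t : ℝ) ≤ T := by exact_mod_cast ht.2
    have h1 : (1 : ℝ) ≤ (T : ℝ) ^ (3 / 2 : ℝ) := Real.one_le_rpow (ht1.trans htT) (by norm_num)
    have h2 : (t : ℝ) ^ (3 / 2 : ℝ) ≤ (T : ℝ) ^ (3 / 2 : ℝ) :=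
      Real.rpow_le_rpow (by linarith) htT (by norm_num)
    have hacc := estAccuracy_one_pos hε ht.1
    have h3 := (Nat.ceil_lt_add_one (by positivity : 0 ≤ Cin / estAccuracy 1 ε t ^ 2)).le
    rw [sq_estAccuracy_one] at h3
    have h4 : Cin / (ε ^ 4 / (t : ℝ) ^ (3 / 2 : ℝ)) ≤ Cin / ε ^ 4 * (T : ℝ) ^ (3 / 2 : ℝ) := by
      rw [div_div_eq_mul_div, mul_div_right_comm]; gcongr
    have h5 : (1 : ℝ) ≤ 1 / ε ^ 4 * (T : ℝ) ^ (3 / 2 : ℝ) := by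
      have : (1 : ℝ) ≤ 1 / ε ^ 4 := by rw [le_div_iff₀ (by positivity)]; linarith
      nlinarith
    have h6 : ((numInner Cin (estAccuracy 1 ε t) : ℕ) : ℝ)
        ≤ (Cin + 1) / ε ^ 4 * (T : ℝ) ^ (3 / 2 : ℝ) := by
      rw [add_div, add_mul]
      unfold numInner
      rw [sq_estAccuracy_one]
      linarith
    push_cast
    calc _ ≤ 2 * ((Cin + 1) / ε ^ 4 * (T : ℝ) ^ (3 / 2 : ℝ)) := by linarith
      _ = _ := by ring
  have hsum : (totalSamples (fun t => numInner Cin (estAccuracy 1 ε t)) T : ℝ)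
      ≤ T * (2 * (Cin + 1) / ε ^ 4 * (T : ℝ) ^ (3 / 2 : ℝ)) := by
    unfold totalSamples
    rw [Nat.cast_sum]
    refine (Finset.sum_le_card_nsmul _ _ _ hterm).trans ?_
    rw [Nat.card_Icc, nsmul_eq_mul, Nat.add_sub_cancel]
  have hpow : ((CT + 1) / ε ^ 4) ^ (5 / 2 : ℝ) = (CT + 1) ^ (5 / 2 : ℝ) / ε ^ 10 := by
    rw [Real.div_rpow (by positivity) (by positivity), ← Real.rpow_natCast ε 4,
      ← Real.rpow_mul hε.le, ← Real.rpow_natCast ε 10]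
    norm_num
  have hT52 : (T : ℝ) * (T : ℝ) ^ (3 / 2 : ℝ) = (T : ℝ) ^ (5 / 2 : ℝ) := by
    rw [show (5 / 2 : ℝ) = 1 + 3 / 2 by norm_num,
      Real.rpow_add_of_nonneg (Nat.cast_nonneg T) (by norm_num) (by norm_num), Real.rpow_one]
  calc _ ≤ (T : ℝ) * (2 * (Cin + 1) / ε ^ 4 * (T : ℝ) ^ (3 / 2 : ℝ)) := hsum
    _ = 2 * (Cin + 1) / ε ^ 4 * (T : ℝ) ^ (5 / 2 : ℝ) := by rw [← hT52]; ring
    _ ≤ 2 * (Cin + 1) / ε ^ 4 * ((CT + 1) / ε ^ 4) ^ (5 / 2 : ℝ) := by gcongr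
    _ = _ := by rw [hpow]; field_simp

end SampleCount

end RobustRL

end

/-! ### Assembly of the theorem. -/

open RobustRL in
theorem theorem2 {S A : Type*} [Fintype S] [Fintype A] [DecidableEq S] [DecidableEq A]
    [Nonempty A] {d : ℕ} (M : CMDP S A) (PC : PolicyClass S A d) (σ : ℝ) (hσ : σ < 0)
    (p : StepParams) (hp : p.Admissible M PC σ) (Q₀ : S → A → ℝ) (s₀ : S) :
    ∃ Cest CT : ℝ, 0 < Cest ∧ 0 < CT ∧
      -- every run with estimates of accuracy `ε_est` reaches an `(1 + √2) ε`-stationary point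
      (∀ ε : ℝ, 0 < ε → ε ≤ 1 →
        ∀ (x : ℕ → ℝ × Param d) (Qr Qc : ℕ → S → A → ℝ),
          (x 1).1 ∈ Set.Icc 0 p.Λ → (x 1).2 ∈ PC.Θ →
          (∀ t, 1 ≤ t → t < numIter CT ε →
            ‖Qr t - smoothedQ M σ M.r (PC.π (x t).2)‖ ≤ estAccuracy Cest ε t ∧
            ‖Qc t - smoothedQ M σ M.c (PC.π (x t).2)‖ ≤ estAccuracy Cest ε t ∧
            x (t + 1) = rpdStep M PC σ p t (x t) (Qr t) (Qc t)) →
          ∃ t, 1 ≤ t ∧ t ≤ numIter CT ε ∧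
            ‖gradMap M PC σ p t (x t)‖ ≤ (1 + Real.sqrt 2) * ε) ∧
      -- with the estimates of smoothed robust TD
      (Exploring M PC →
        ∃ (η : ℕ → ℝ) (Cin CN : ℝ), (∀ n, 0 < η n ∧ η n ≤ 1) ∧ 0 < Cin ∧ 0 < CN ∧
          -- TD reaches accuracy `e` in mean square with `O(e⁻²)` samples
          (∀ e : ℝ, 0 < e → ∀ θ ∈ PC.Θ, ∀ n : ℕ, Cin / e ^ 2 ≤ n →
            expect (tdOutput M σ M.r (PC.π θ) η Q₀ s₀ n)
              (fun Q => ‖Q - smoothedQ M σ M.r (PC.π θ)‖ ^ 2) ≤ e ^ 2 ∧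
            expect (tdOutput M σ M.c (PC.π θ) η Q₀ s₀ n)
              (fun Q => ‖Q - smoothedQ M σ M.c (PC.π θ)‖ ^ 2) ≤ e ^ 2) ∧
          -- the online algorithm: convergence and total sample complexity
          (∀ ε : ℝ, 0 < ε → ε ≤ 1 →
            (∀ x₁ : ℝ × Param d, x₁.1 ∈ Set.Icc 0 p.Λ → x₁.2 ∈ PC.Θ →
              expect (rpdLaw M PC σ p η Q₀ s₀ (fun t => numInner Cin (estAccuracy Cest ε t)) x₁
                  (numIter CT ε))
                (fun x => ⨅ t : Finset.Icc 1 (numIter CT ε), ‖gradMap M PC σ p t (x t)‖)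
                ≤ (1 + Real.sqrt 2) * ε) ∧
            (totalSamples (fun t => numInner Cin (estAccuracy Cest ε t)) (numIter CT ε) : ℝ)
              ≤ CN / ε ^ 14)) := by
  have : Nonempty S := ⟨s₀⟩
  have hΛ : 0 ≤ p.Λ := hp.1.le
  have hξ := hp.bounds.1
  obtain ⟨κ, C₁, t₀, hκ, hC₁, ht₀, hdec⟩ := exists_pot_decrease M PC hσ hp
  set B : ℝ := (Csig M σ + |M.b|) + (Csig M σ + |M.b|) * p.Λ + 2 * p.Λ ^ 2 / p.ξ with hB
  have hpot : ∀ t, 1 ≤ t → ∀ x, Feasible PC p x → |potAt M PC σ p t x| ≤ B :=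
    fun t ht x hx => abs_potAt_le M PC hσ hξ hΛ ht hx
  obtain ⟨CT, hCT, hCT'⟩ : ∃ CT : ℝ,
      (2 * t₀ + 2 : ℝ) ≤ CT ∧ (3 * (2 * B + 6 * C₁ + 1) / κ) ^ 2 ≤ CT :=
    ⟨max _ _, le_max_left _ _, le_max_right _ _⟩
  have hCT0 : 0 < CT := lt_of_lt_of_le (by positivity) hCT
  have hsqrt : ∀ ε : ℝ, 0 < ε → ε ≤ (1 + Real.sqrt 2) * ε := fun ε hε =>
    le_mul_of_one_le_left hε.le (by linarith [Real.sqrt_nonneg 2])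
  -- The accuracy constant `1` suffices because `CT` is chosen after the error constant `C₁`. The
  -- argument gives the bound `ε` itself, and `hsqrt` relaxes it to `(1 + √2) ε`.
  refine ⟨1, CT, one_pos, hCT0, fun ε hε hε1 x Qr Qc hx1 hx1' hrun => ?_, ?_⟩
  · obtain ⟨t, ht, htT, h⟩ := exists_small_gradMap M PC hΛ hκ hC₁ ht₀ hpot hdec hCT hCT' hε hε1
      x Qr Qc ⟨hx1, hx1'⟩ hrun
    exact ⟨t, ht, htT, h.trans (hsqrt ε hε)⟩
  · rintro ⟨⟨q, hq, hqpol⟩, hreach⟩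
    obtain ⟨η, Cin, hη, hCin, hrate⟩ := exists_td_rate M hσ hq hreach Q₀ s₀
    have htd : ∀ e : ℝ, 0 < e → ∀ θ ∈ PC.Θ, ∀ n : ℕ, Cin / e ^ 2 ≤ n →
        ∀ u : S → A → ℝ, (∀ s a, u s a ∈ Set.Icc (0 : ℝ) 1) →
          expect (tdOutput M σ u (PC.π θ) η Q₀ s₀ n)
            (fun Q => ‖Q - smoothedQ M σ u (PC.π θ)‖ ^ 2) ≤ e ^ 2 := by
      intro e he θ hθ n hn u hu
      have hn0 : (0 : ℝ) < n := lt_of_lt_of_le (by positivity) hn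
      rw [div_le_iff₀ (by positivity)] at hn
      exact le_of_mul_le_mul_left
        ((hrate u hu _ (PC.isPolicy θ hθ) (hqpol θ hθ) n).trans hn) hn0
    refine ⟨η, Cin, 2 * (Cin + 1) * (CT + 1) ^ (5 / 2 : ℝ), hη, hCin, by positivity,
      fun e he θ hθ n hn => ⟨htd e he θ hθ n hn _ M.r_mem, htd e he θ hθ n hn _ M.c_mem⟩,
      fun ε hε hε1 => ⟨fun x₁ hx₁ hx₁' => ?_, totalSamples_le hCin hCT0 hε hε1⟩⟩
    refine (expect_iInf_gradMap_le M PC hΛ hκ hC₁ ht₀ hpot hdec hCT hCT'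
      (fun θ hθ t ht => ?_) hε hε1 ⟨hx₁, hx₁'⟩).trans (hsqrt ε hε)
    -- The inner run is long enough for the mean square error to be at most the squared accuracy,
    -- which is at most `1 / t`.
    have hacc := estAccuracy_one_pos hε ht
    have hle := sq_estAccuracy_one_le hε hε1 ht
    exact ⟨(htd _ hacc θ hθ _ (Nat.le_ceil _) _ M.r_mem).trans hle,
      (htd _ hacc θ hθ _ (Nat.le_ceil _) _ M.c_mem).trans hle⟩
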